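/- Let $T>0$, let $\Omega\subset\mathbb R^N$ be a bounded domain and $\Omega_T=(0,T)\times\Omega$. Let $k,l\in L_{1,loc}([0,\infty))$ be real kernels such that $k$ is nonnegative and nonincreasing and $k\ast l=1$ on $(0,\infty)$, where $(k\ast v)(t)=\int_0^t k(t-\tau)v(\tau)\,d\tau$. Assume in addition that $k$ is completely monotone, i.e. $k\in C^\infty((0,\infty))$ and $(-1)^jk^{(j)}\ge 0$ on $(0,\infty)$ for all integers $j\ge 0$. For $n\in\mathbb N$, $n\ge1$, let $h_n\in L_{1,loc}([0,\infty))$ be the resolvent kernel of $nl$, i.e. the solution of $h_n+n\,(h_n\ast l)=n\,l$, and put $k_n=k\ast h_n$. Write $(l\overset{T}{\ast}g)(t)=\int_t^T l(\tau-t)g(\tau)\,d\tau$, and let $\mathring H^1_2(\Omega)$ be the closure of $C_0^\infty(\Omega)$ in $H^1_2(\Omega)$. Let $u_0\in L_2(\Omega)$, $f\in L_2(\Omega_T)$, $u\in L_2(\Omega_T)$ with $k\ast u\in C([0,T];L_2(\Omega))$ and $(k\ast u)|_{t=0}=0$. Let $X=\mathring H^1_2(\Omega)$ (Dirichlet case)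 or $X=H^1_2(\Omega)$ (Neumann case), and let $w\in L_2((0,T);X)$ with $w\ge 0$ be such that for every $n\ge1$ and every $\psi\in X$ with $\psi\ge0$, $$\int_\Omega\Big(\psi\,\partial_t\big(k_n\ast[u-u_0]\big)+(h_n\ast\nabla w)\cdot\nabla\psi\Big)\,dx\le\int_\Omega(h_n\ast f)\,\psi\,dx\quad\text{for a.a. }t\in(0,T),$$ where $\partial_t$ is the weak time derivative. Then all integrals below are absolutely convergent and $$\int_0^T\!\!\int_\Omega wu\,dx\,dt+\frac12\int_0^T\!\!\int_\Omega\big[k(T-t)+k(t)\big]\,|l\overset{T}{\ast}\nabla w|^2\,dx\,dt$$ $$+\frac12\int_0^T\!\!\int_0^t\!\!\int_\Omega\frac1s\big(k(s)-k(2s)\big)\big|(l\overset{T}{\ast}\nabla w)(t,x)-(l\overset{T}{\ast}\nabla w)(t-s,x)\big|^2\,dx\,ds\,dt\le\int_0^T\!\!\int_\Omega\big(u_0+l\ast f\big)\,w\,dx\,dt.$$ -/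

import Mathlib

open Set Filter Topology MeasureTheory
open scoped ContDiff

namespace Subdiffusion

noncomputable section

/-- Convolution on the positive half-line, `(k ∗ v)(t) = ∫_0^t k(t-τ) v(τ) dτ`. -/
def conv {F : Type*} [NormedAddCommGroup F] [NormedSpace ℝ F]
    (k : ℝ → ℝ) (v : ℝ → F) (t : ℝ) : F :=
  ∫ τ in (0 : ℝ)..t, k (t - τ) • v τ

/-- Dual convolution with respect to `(0,T)`, `∫_t^T l(τ-t) g(τ) dτ`. -/
def dualConv {F : Type*} [NormedAddCommGroup F] [NormedSpace ℝ F]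
    (T : ℝ) (l : ℝ → ℝ) (g : ℝ → F) (t : ℝ) : F :=
  ∫ τ in t..T, l (τ - t) • g τ

/-- `(k, l)` is a pair of `PC`-kernels: both are in `L_{1,loc}([0,∞))`, `k` is nonnegative and
nonincreasing on `(0,∞)`, and `k ∗ l = 1` almost everywhere on `(0,∞)`. -/
structure IsPCPair (k l : ℝ → ℝ) : Prop where
  locallyIntegrable_k : LocallyIntegrableOn k (Ici 0)
  locallyIntegrable_l : LocallyIntegrableOn l (Ici 0)
  nonneg : ∀ t, 0 < t → 0 ≤ k t
  antitone : AntitoneOn k (Ioi 0)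
  conv_eq_one : ∀ᵐ t ∂(volume.restrict (Ioi (0 : ℝ))), conv k l t = 1

/-- `k` is smooth on `(0,∞)` and `(-1)^j k^{(j)} ≥ 0` there for all `j ≥ 0`. -/
def CompletelyMonotone (k : ℝ → ℝ) : Prop :=
  ContDiffOn ℝ ∞ k (Ioi 0) ∧
    ∀ j : ℕ, ∀ t, 0 < t → 0 ≤ (-1 : ℝ) ^ j * iteratedDeriv j k t

/-- `h` is the resolvent kernel associated with `γ l`: `h ∈ L_{1,loc}([0,∞))` and
`h + γ (h ∗ l) = γ l` almost everywhere on `(0,∞)`. For `l ∈ L_{1,loc}([0,∞))` such an `h` exists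
and is unique up to null sets. -/
def IsResolventKernel (γ : ℝ) (l h : ℝ → ℝ) : Prop :=
  LocallyIntegrableOn h (Ici 0) ∧
    ∀ᵐ t ∂(volume.restrict (Ioi (0 : ℝ))), h t + γ * conv h l t = γ * l t

/-- The space-time cylinder `Ω_T = (0,T) × Ω`. -/
def cylinder {N : ℕ} (T : ℝ) (Ω : Set (EuclideanSpace ℝ (Fin N))) :
    Set (ℝ × EuclideanSpace ℝ (Fin N)) :=
  Ioo 0 T ×ˢ Ω

/-- The set of all `(t, s, x)` with `0 < t < T`, `0 < s < t`, `x ∈ Ω`. -/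
def tripleDomain {N : ℕ} (T : ℝ) (Ω : Set (EuclideanSpace ℝ (Fin N))) :
    Set (ℝ × ℝ × EuclideanSpace ℝ (Fin N)) :=
  {p | 0 < p.1 ∧ p.1 < T ∧ 0 < p.2.1 ∧ p.2.1 < p.1 ∧ p.2.2 ∈ Ω}

/-- `φ ∈ C_0^∞(U)`. -/
def IsTestFun {V : Type*} [NormedAddCommGroup V] [NormedSpace ℝ V]
    (U : Set V) (φ : V → ℝ) : Prop :=
  ContDiff ℝ ∞ φ ∧ HasCompactSupport φ ∧ tsupport φ ⊆ U

/-- `v ∈ H^1_2(Ω)`, with weak gradient `G`. -/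
structure MemH1 {N : ℕ} (Ω : Set (EuclideanSpace ℝ (Fin N)))
    (v : EuclideanSpace ℝ (Fin N) → ℝ)
    (G : EuclideanSpace ℝ (Fin N) → EuclideanSpace ℝ (Fin N)) : Prop where
  memLp : MemLp v 2 (volume.restrict Ω)
  memLp_grad : MemLp G 2 (volume.restrict Ω)
  weakGrad : ∀ φ : EuclideanSpace ℝ (Fin N) → ℝ, IsTestFun Ω φ → ∀ i : Fin N,
    ∫ x in Ω, v x * fderiv ℝ φ x (EuclideanSpace.single i 1) = -∫ x in Ω, G x i * φ x

/-- `v` (with weak gradient `G`) is in the closure of `C_0^∞(Ω)` in `H^1_2(Ω)`. -/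
structure MemH10 {N : ℕ} (Ω : Set (EuclideanSpace ℝ (Fin N)))
    (v : EuclideanSpace ℝ (Fin N) → ℝ)
    (G : EuclideanSpace ℝ (Fin N) → EuclideanSpace ℝ (Fin N)) : Prop where
  memH1 : MemH1 Ω v G
  approx : ∃ φ : ℕ → EuclideanSpace ℝ (Fin N) → ℝ, (∀ j, IsTestFun Ω (φ j)) ∧
    Tendsto (fun j => eLpNorm (fun x => φ j x - v x) 2 (volume.restrict Ω)) atTop (𝓝 0) ∧
    Tendsto (fun j => eLpNorm (fun x => gradient (φ j) x - G x) 2 (volume.restrict Ω))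
      atTop (𝓝 0)

/-- `w ∈ L_2((0,T); X)` with spatial weak gradient `Dw`, where `X` is `H^1_2(Ω)` or its subspace
of functions vanishing on the boundary, given by `X = MemH1 Ω` or `X = MemH10 Ω`. -/
structure MemL2H1 {N : ℕ} (T : ℝ) (Ω : Set (EuclideanSpace ℝ (Fin N)))
    (X : (EuclideanSpace ℝ (Fin N) → ℝ) →
      (EuclideanSpace ℝ (Fin N) → EuclideanSpace ℝ (Fin N)) → Prop)
    (w : ℝ → EuclideanSpace ℝ (Fin N) → ℝ)
    (Dw : ℝ → EuclideanSpace ℝ (Fin N) → EuclideanSpace ℝ (Fin N)) : Prop where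
  memLp : MemLp (fun p : ℝ × EuclideanSpace ℝ (Fin N) => w p.1 p.2) 2
    (volume.restrict (cylinder T Ω))
  memLp_grad : MemLp (fun p : ℝ × EuclideanSpace ℝ (Fin N) => Dw p.1 p.2) 2
    (volume.restrict (cylinder T Ω))
  mem_ae : ∀ᵐ t ∂(volume.restrict (Ioo 0 T)), X (w t) (Dw t)

/-- `G ∈ L_2(Ω_T)` is the weak time derivative `∂_t F` of `F` on `Ω_T`. -/
def IsWeakTimeDeriv {N : ℕ} (T : ℝ) (Ω : Set (EuclideanSpace ℝ (Fin N)))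
    (F G : ℝ → EuclideanSpace ℝ (Fin N) → ℝ) : Prop :=
  MemLp (fun p : ℝ × EuclideanSpace ℝ (Fin N) => G p.1 p.2) 2
      (volume.restrict (cylinder T Ω)) ∧
    ∀ φ : ℝ × EuclideanSpace ℝ (Fin N) → ℝ, IsTestFun (cylinder T Ω) φ →
      ∫ p in cylinder T Ω, F p.1 p.2 * fderiv ℝ φ p (1, 0) =
        -∫ p in cylinder T Ω, G p.1 p.2 * φ p

/-- The time-regularized weak form of `∂_t (k ∗ [u - u₀]) - Δ w ≤ f`. With `h = h_n` the resolvent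
kernel of `n l`, `k_n = k ∗ h_n` and `G = ∂_t (k_n ∗ [u - u₀])` it says that, for all `n ≥ 1` and
all nonnegative `ψ` in the test space `X`, for almost all `t ∈ (0,T)`,
`∫_Ω (ψ ∂_t (k_n ∗ [u - u₀]) + (h_n ∗ ∇w) · ∇ψ) dx ≤ ∫_Ω (h_n ∗ f) ψ dx`.
Both `h_n` and `G` exist and are unique up to null sets when `u ∈ L_2(Ω_T)`, `u₀ ∈ L_2(Ω)`. -/
def WeakInequality {N : ℕ} (T : ℝ) (Ω : Set (EuclideanSpace ℝ (Fin N)))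
    (X : (EuclideanSpace ℝ (Fin N) → ℝ) →
      (EuclideanSpace ℝ (Fin N) → EuclideanSpace ℝ (Fin N)) → Prop)
    (k l : ℝ → ℝ) (u₀ : EuclideanSpace ℝ (Fin N) → ℝ)
    (f u : ℝ → EuclideanSpace ℝ (Fin N) → ℝ)
    (Dw : ℝ → EuclideanSpace ℝ (Fin N) → EuclideanSpace ℝ (Fin N)) : Prop :=
  ∀ n : ℕ, 1 ≤ n → ∀ h : ℝ → ℝ, IsResolventKernel (n : ℝ) l h →
  ∀ G : ℝ → EuclideanSpace ℝ (Fin N) → ℝ,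
    IsWeakTimeDeriv T Ω (fun t x => conv (conv k h) (fun τ => u τ x - u₀ x) t) G →
  ∀ (ψ : EuclideanSpace ℝ (Fin N) → ℝ)
    (Dψ : EuclideanSpace ℝ (Fin N) → EuclideanSpace ℝ (Fin N)),
    X ψ Dψ → (∀ᵐ x ∂(volume.restrict Ω), 0 ≤ ψ x) →
  ∀ᵐ t ∂(volume.restrict (Ioo 0 T)),
    ∫ x in Ω, (ψ x * G t x + inner ℝ (conv h (fun τ => Dw τ x) t) (Dψ x)) ≤
      ∫ x in Ω, conv h (fun τ => f τ x) t * ψ x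

/-- `k ∗ u ∈ C([0,T]; L_2(Ω))` and `(k ∗ u)|_{t=0} = 0`. -/
def ConvContinuousVanishing {N : ℕ} (T : ℝ) (Ω : Set (EuclideanSpace ℝ (Fin N)))
    (k : ℝ → ℝ) (u : ℝ → EuclideanSpace ℝ (Fin N) → ℝ) : Prop :=
  ∃ V : ℝ → Lp ℝ 2 (volume.restrict Ω), ContinuousOn V (Icc 0 T) ∧ V 0 = 0 ∧
    ∀ᵐ t ∂(volume.restrict (Ioo 0 T)),
      (V t : EuclideanSpace ℝ (Fin N) → ℝ) =ᵐ[volume.restrict Ω]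
        fun x => conv k (fun τ => u τ x) t

end

end Subdiffusion

/-!
The estimate comes from testing the equation, written in the integrated form
`u - u₀ - l ∗ Δw ≤ l ∗ f`, with `w` itself, and from a lower bound of `∫ ⟨l ∗ ∇w, ∇w⟩ dt` by the
energy on the left-hand side.

**The integrated inequality.** A single regularized inequality suffices, the one with `n = 1`. Let `h`
be the resolvent kernel of `l` (`exists_isResolventKernel`). Since `h + h ∗ l = l` and `k ∗ l = 1`, one
has `k ∗ h = 1 - 1 ∗ h`, so that `∂_t (k ∗ h ∗ v) = v - h ∗ v` for `v = u - u₀`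
(`isWeakTimeDeriv_sub_conv`). The operator `y ↦ y + l ∗ y` maps `v - h ∗ v` to `v` and `h ∗ y` to
`l ∗ y`; it preserves the inequality because `l ≥ 0`, and thus undoes the regularization
(`WeakInequality.ae_integral_nonpos`). By separability of the test space the inequality holds for
almost every `t` and all test functions at once (`ae_forall_test_of_forall_ae`). With `ψ = w(t, ·)`,
integration in `t` gives `∫∫ w u + ∫∫ ⟨l ∗ ∇w, ∇w⟩ ≤ ∫∫ (u₀ + l ∗ f) w` (`WeakInequality.integral_le`).

**The energy inequality.** Let `G ∈ L₂(0,T)` have values in a Hilbert space and let `y = l ∗ G`, which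
formally solves `(k ∗ y)' = G`. Then `2 ∫ ⟨G, y⟩` is at least
`∫ (k(T-t) + k(t)) |y(t)|² dt + ∫_0^T ∫_0^t (k(s) - k(2s)) / s |y(t) - y(t-s)|² ds dt`
(`energy_conv_le`). For the smooth kernel `k(· + ε)` and absolutely continuous `y` there is an
identity with the weight `-k'(s + ε)` (`energy_shift_eq`), and `-s k'(s) ≥ k(s) - k(2s)` by convexity
of `k`. The limit `ε → 0`, and then the approximation of `G` by smooth functions, use Fatou's lemma
for the energy (`energy_le_liminf`). Reversing time turns `l ∗ G` into the dual convolution; applied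
to `∇w(·, x)` for almost every `x` and integrated in `x`, this is the required lower bound
(`energy_dualConv_le`, `integral_energy_dualConv_le`), and it shows that the two energy integrands are
integrable.

**Nonnegativity of `l`.** For `c > 0` the function `p = l - l(· - c)`, with `l` extended by zero,
satisfies `k ∗ p = 1_{(0,c)} ≥ 0`. A maximum principle, obtained by testing with the negative part of
`1 ∗ p`, yields `1 ∗ p ≥ 0` (`primitive_nonneg_of_conv_nonneg`). So the primitive of `l` is
nondecreasing (`IsPCPair.l_nonneg`).
-/

namespace Subdiffusion

section

/-! ### Convolution on a bounded interval -/

open scoped Convolution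
open ContinuousLinearMap (lsmul mul)

variable {F : Type*} [NormedAddCommGroup F] [NormedSpace ℝ F]

/-- On `[0,T]` the half-line convolution is the convolution over `ℝ` of the truncations to
`(0,T)`. -/
theorem conv_eq_convolution {T t : ℝ} (ht : t ∈ Icc 0 T) (a : ℝ → ℝ) (v : ℝ → F) :
    conv a v t =
      ((Ioo 0 T).indicator a ⋆[lsmul ℝ ℝ, volume] (Ioo 0 T).indicator v) t := by
  rw [convolution_lsmul_swap, conv, intervalIntegral.integral_of_le ht.1,
    integral_Ioc_eq_integral_Ioo, ← integral_indicator measurableSet_Ioo]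
  congr 1
  ext τ
  by_cases h : τ ∈ Ioo 0 t
  · have h1 : t - τ ∈ Ioo 0 T := ⟨by linarith [h.2], by linarith [h.1, ht.2]⟩
    have h2 : τ ∈ Ioo 0 T := ⟨h.1, by linarith [h.2, ht.2]⟩
    rw [indicator_of_mem h, indicator_of_mem h1, indicator_of_mem h2]
  · rw [indicator_of_notMem h]
    by_cases h2 : τ ∈ Ioo 0 T
    · have h1 : t - τ ∉ Ioo 0 T := fun h1 => h ⟨h2.1, by linarith [h1.1]⟩
      rw [indicator_of_notMem h1, zero_smul]
    · rw [indicator_of_notMem h2, smul_zero]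

theorem indicator_ae_eq_of_ae_eq_restrict {E : Type*} [Zero E] {T : ℝ} {a a' : ℝ → E}
    (h : a =ᵐ[volume.restrict (Ioo 0 T)] a') :
    (Ioo 0 T).indicator a =ᵐ[volume] (Ioo 0 T).indicator a' := by
  rw [EventuallyEq, ae_restrict_iff' measurableSet_Ioo] at h
  filter_upwards [h] with x hx
  by_cases hx' : x ∈ Ioo 0 T
  · rw [indicator_of_mem hx', indicator_of_mem hx', hx hx']
  · rw [indicator_of_notMem hx', indicator_of_notMem hx']

theorem conv_congr {T t : ℝ} (ht : t ∈ Icc 0 T) {a a' : ℝ → ℝ} {v v' : ℝ → F}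
    (ha : a =ᵐ[volume.restrict (Ioo 0 T)] a') (hv : v =ᵐ[volume.restrict (Ioo 0 T)] v') :
    conv a v t = conv a' v' t := by
  rw [conv_eq_convolution ht, conv_eq_convolution ht]
  exact congrFun (convolution_congr _ (indicator_ae_eq_of_ae_eq_restrict ha)
    (indicator_ae_eq_of_ae_eq_restrict hv)) t

theorem conv_comm {t : ℝ} (ht : 0 ≤ t) (a b : ℝ → ℝ) : conv a b t = conv b a t := by
  rw [conv_eq_convolution ⟨ht, le_rfl⟩, conv_eq_convolution ⟨ht, le_rfl⟩, convolution_lsmul_swap,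
    convolution_lsmul]
  simp_rw [smul_eq_mul, mul_comm]

theorem conv_ae_eq_convolution (T : ℝ) (a : ℝ → ℝ) (v : ℝ → F) :
    conv a v =ᵐ[volume.restrict (Ioo 0 T)]
      ((Ioo 0 T).indicator a ⋆[lsmul ℝ ℝ, volume] (Ioo 0 T).indicator v) := by
  filter_upwards [ae_restrict_mem measurableSet_Ioo] with t ht
  exact conv_eq_convolution (Ioo_subset_Icc_self ht) a v

theorem integrableOn_conv {T : ℝ} {a : ℝ → ℝ} {v : ℝ → F}
    (ha : IntegrableOn a (Ioo 0 T)) (hv : IntegrableOn v (Ioo 0 T)) :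
    IntegrableOn (conv a v) (Ioo 0 T) := by
  have h := Integrable.integrable_convolution (μ := volume) (lsmul ℝ ℝ (E := F))
    (ha.integrable_indicator measurableSet_Ioo) (hv.integrable_indicator measurableSet_Ioo)
  exact (h.integrableOn (s := Ioo 0 T)).congr (conv_ae_eq_convolution T a v).symm

/-- For almost every `t` the integrand of the convolution is absolutely integrable. -/
theorem ae_intervalIntegrable_conv {T : ℝ} {a : ℝ → ℝ} {v : ℝ → F}
    (ha : IntegrableOn a (Ioo 0 T)) (hv : IntegrableOn v (Ioo 0 T)) :
    ∀ᵐ t ∂(volume.restrict (Ioo 0 T)),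
      IntervalIntegrable (fun τ => a (t - τ) • v τ) volume 0 t := by
  have h := Integrable.ae_convolution_exists (μ := volume) (ν := volume) (lsmul ℝ ℝ (E := F))
    (ha.integrable_indicator measurableSet_Ioo) (hv.integrable_indicator measurableSet_Ioo)
  filter_upwards [ae_restrict_mem measurableSet_Ioo, ae_restrict_of_ae h] with t ht h
  have h' := h.integrable_swap
  rw [intervalIntegrable_iff_integrableOn_Ioo_of_le ht.1.le]
  refine (h'.integrableOn (s := Ioo 0 t)).congr ?_
  filter_upwards [ae_restrict_mem measurableSet_Ioo] with τ hτ
  have h1 : t - τ ∈ Ioo 0 T := ⟨by linarith [hτ.2], by linarith [hτ.1, ht.2]⟩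
  have h2 : τ ∈ Ioo 0 T := ⟨hτ.1, by linarith [hτ.2, ht.2]⟩
  rw [indicator_of_mem h1, indicator_of_mem h2]
  rfl

theorem convolution_indicator_of_nonpos {T : ℝ} (c : ℝ → ℝ) (z : ℝ → F) (s : ℝ) (hs : s ≤ 0) :
    ((Ioo 0 T).indicator c ⋆[lsmul ℝ ℝ, volume] (Ioo 0 T).indicator z) s = 0 := by
  rw [convolution_lsmul_swap]
  refine integral_eq_zero_of_ae (Eventually.of_forall fun τ => ?_)
  show (Ioo 0 T).indicator c (s - τ) • (Ioo 0 T).indicator z τ = 0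
  by_cases h : τ ∈ Ioo 0 T
  · have h1 : s - τ ∉ Ioo 0 T := fun h1 => by linarith [h1.1, h.1]
    rw [indicator_of_notMem h1, zero_smul]
  · rw [indicator_of_notMem h, smul_zero]

/-- Associativity holds only almost everywhere, as convolutions of `L₁` functions exist only almost
everywhere. -/
theorem conv_assoc [CompleteSpace F] {T : ℝ} {a b : ℝ → ℝ} {v : ℝ → F}
    (ha : IntegrableOn a (Ioo 0 T)) (hb : IntegrableOn b (Ioo 0 T))
    (hv : IntegrableOn v (Ioo 0 T)) :
    ∀ᵐ t ∂(volume.restrict (Ioo 0 T)), conv (conv a b) v t = conv a (conv b v) t := by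
  have ia := ha.integrable_indicator measurableSet_Ioo
  have ib := hb.integrable_indicator measurableSet_Ioo
  have iv := hv.integrable_indicator measurableSet_Ioo
  have h1 := Integrable.ae_convolution_exists (μ := volume) (ν := volume)
    (lsmul ℝ ℝ (E := ℝ)) ia ib
  have h2 := Integrable.ae_convolution_exists (μ := volume) (ν := volume)
    (mul ℝ ℝ) ib.norm iv.norm
  have h3 := Integrable.ae_convolution_exists (μ := volume) (ν := volume) (mul ℝ ℝ) ia.norm
    (Integrable.integrable_convolution (mul ℝ ℝ) ib.norm iv.norm)
  filter_upwards [ae_restrict_mem measurableSet_Ioo, ae_restrict_of_ae h3] with t ht h3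
  have key := convolution_assoc (L := lsmul ℝ ℝ (E := ℝ)) (L₂ := lsmul ℝ ℝ (E := F))
    (L₃ := lsmul ℝ ℝ (E := F)) (L₄ := lsmul ℝ ℝ (E := F))
    (fun x y z => by simp [mul_smul, smul_comm x y z]) ia.aestronglyMeasurable
    ib.aestronglyMeasurable iv.aestronglyMeasurable h1 h2 h3
  have e1 := conv_congr (T := T) (Ioo_subset_Icc_self ht) (conv_ae_eq_convolution T a b)
    (ae_eq_refl v)
  have e2 := conv_congr (T := T) (Ioo_subset_Icc_self ht) (ae_eq_refl a)
    (conv_ae_eq_convolution T b v)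
  rw [e1, e2, conv_eq_convolution (Ioo_subset_Icc_self ht),
    conv_eq_convolution (Ioo_subset_Icc_self ht)]
  -- Convolutions of truncations vanish on `(-∞, 0]`, and their values beyond `T` do not
  -- contribute at times `t < T`; so the inner truncations can be dropped.
  have trL : ∀ (c : ℝ → ℝ) (z : ℝ → F), (∀ s ≤ 0, c s = 0) →
      ((Ioo 0 T).indicator c ⋆[lsmul ℝ ℝ, volume] (Ioo 0 T).indicator z) t =
        (c ⋆[lsmul ℝ ℝ, volume] (Ioo 0 T).indicator z) t := by
    intro c z hc
    rw [convolution_lsmul_swap, convolution_lsmul_swap]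
    congr 1
    ext τ
    by_cases h : τ ∈ Ioo 0 T
    · by_cases h' : t - τ ∈ Ioo 0 T
      · rw [indicator_of_mem h']
      · rw [indicator_of_notMem h', hc (t - τ)]
        by_contra hh
        exact h' ⟨not_le.1 hh, by linarith [h.1, ht.2]⟩
    · rw [indicator_of_notMem h, smul_zero, smul_zero]
  have trR : ∀ (c : ℝ → ℝ) (z : ℝ → F), (∀ s ≤ 0, z s = 0) →
      ((Ioo 0 T).indicator c ⋆[lsmul ℝ ℝ, volume] (Ioo 0 T).indicator z) t =
        ((Ioo 0 T).indicator c ⋆[lsmul ℝ ℝ, volume] z) t := by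
    intro c z hc
    rw [convolution_lsmul, convolution_lsmul]
    congr 1
    ext τ
    by_cases h : τ ∈ Ioo 0 T
    · by_cases h' : t - τ ∈ Ioo 0 T
      · rw [indicator_of_mem h']
      · rw [indicator_of_notMem h', hc (t - τ)]
        by_contra hh
        exact h' ⟨not_le.1 hh, by linarith [h.1, ht.2]⟩
    · rw [indicator_of_notMem h, zero_smul, zero_smul]
  rw [trL _ _ (convolution_indicator_of_nonpos a b), trR _ _ (convolution_indicator_of_nonpos b v)]
  exact key

theorem conv_add_right {T : ℝ} {a : ℝ → ℝ} {v v' : ℝ → F}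
    (ha : IntegrableOn a (Ioo 0 T)) (hv : IntegrableOn v (Ioo 0 T))
    (hv' : IntegrableOn v' (Ioo 0 T)) :
    ∀ᵐ t ∂(volume.restrict (Ioo 0 T)),
      conv a (fun τ => v τ + v' τ) t = conv a v t + conv a v' t := by
  filter_upwards [ae_intervalIntegrable_conv ha hv, ae_intervalIntegrable_conv ha hv']
    with t h h'
  simp only [conv, smul_add]
  exact intervalIntegral.integral_add h h'

theorem conv_sub_right {T : ℝ} {a : ℝ → ℝ} {v v' : ℝ → F}
    (ha : IntegrableOn a (Ioo 0 T)) (hv : IntegrableOn v (Ioo 0 T))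
    (hv' : IntegrableOn v' (Ioo 0 T)) :
    ∀ᵐ t ∂(volume.restrict (Ioo 0 T)),
      conv a (fun τ => v τ - v' τ) t = conv a v t - conv a v' t := by
  filter_upwards [ae_intervalIntegrable_conv ha hv, ae_intervalIntegrable_conv ha hv']
    with t h h'
  simp only [conv, smul_sub]
  exact intervalIntegral.integral_sub h h'

theorem conv_add_left {T : ℝ} {a a' : ℝ → ℝ} {v : ℝ → F}
    (ha : IntegrableOn a (Ioo 0 T)) (ha' : IntegrableOn a' (Ioo 0 T))
    (hv : IntegrableOn v (Ioo 0 T)) :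
    ∀ᵐ t ∂(volume.restrict (Ioo 0 T)),
      conv (fun τ => a τ + a' τ) v t = conv a v t + conv a' v t := by
  filter_upwards [ae_intervalIntegrable_conv ha hv, ae_intervalIntegrable_conv ha' hv]
    with t h h'
  simp only [conv, add_smul]
  exact intervalIntegral.integral_add h h'

theorem conv_sub_left {T : ℝ} {a a' : ℝ → ℝ} {v : ℝ → F}
    (ha : IntegrableOn a (Ioo 0 T)) (ha' : IntegrableOn a' (Ioo 0 T))
    (hv : IntegrableOn v (Ioo 0 T)) :
    ∀ᵐ t ∂(volume.restrict (Ioo 0 T)),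
      conv (fun τ => a τ - a' τ) v t = conv a v t - conv a' v t := by
  filter_upwards [ae_intervalIntegrable_conv ha hv, ae_intervalIntegrable_conv ha' hv]
    with t h h'
  simp only [conv, sub_smul]
  exact intervalIntegral.integral_sub h h'

theorem conv_const_left (c : ℝ) (v : ℝ → F) (t : ℝ) :
    conv (fun _ => c) v t = c • ∫ τ in (0 : ℝ)..t, v τ := by
  simp [conv, intervalIntegral.integral_smul]

theorem conv_one_left (v : ℝ → F) (t : ℝ) :
    conv (fun _ => 1) v t = ∫ τ in (0 : ℝ)..t, v τ := by
  rw [conv_const_left, one_smul]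

theorem conv_const_right [CompleteSpace F] (a : ℝ → ℝ) (c : F) (t : ℝ) :
    conv a (fun _ => c) t = (∫ τ in (0 : ℝ)..t, a τ) • c := by
  simp only [conv]
  rw [intervalIntegral.integral_smul_const, intervalIntegral.integral_comp_sub_left]
  simp

/-- The Cauchy–Schwarz inequality for the measure with density `f`. -/
theorem lintegral_mul_sq_le {α : Type*} [MeasurableSpace α] {μ : Measure α}
    {f g : α → ENNReal} (hf : AEMeasurable f μ) (hg : AEMeasurable g μ) :
    (∫⁻ x, f x * g x ∂μ) ^ 2 ≤ (∫⁻ x, f x ∂μ) * ∫⁻ x, f x * g x ^ 2 ∂μ := by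
  have h := ENNReal.lintegral_mul_norm_pow_le (μ := μ) hf (hf.mul (hg.pow_const 2))
    (p := 1 / 2) (q := 1 / 2) (by norm_num) (by norm_num) (by norm_num)
  have e : ∀ x, f x ^ (1 / 2 : ℝ) * (f x * g x ^ 2) ^ (1 / 2 : ℝ) = f x * g x := by
    intro x
    rw [ENNReal.mul_rpow_of_nonneg _ _ (by norm_num), ← mul_assoc,
      ← ENNReal.rpow_add_of_nonneg _ _ (by norm_num) (by norm_num), ← ENNReal.rpow_natCast,
      ← ENNReal.rpow_mul]
    norm_num
  simp only [Pi.mul_apply, e] at h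
  calc (∫⁻ x, f x * g x ∂μ) ^ 2 ≤ _ := pow_le_pow_left' h 2
    _ = _ := by
      rw [mul_pow, ← ENNReal.rpow_natCast, ← ENNReal.rpow_natCast, ← ENNReal.rpow_mul,
        ← ENNReal.rpow_mul]
      norm_num

theorem enorm_conv_le {T t : ℝ} (ht : t ∈ Icc 0 T) (a : ℝ → ℝ) (v : ℝ → F) :
    ‖conv a v t‖ₑ ≤
      ∫⁻ τ, ‖(Ioo 0 T).indicator a (t - τ)‖ₑ * ‖(Ioo 0 T).indicator v τ‖ₑ := by
  rw [conv_eq_convolution ht, convolution_lsmul_swap]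
  refine (enorm_integral_le_lintegral_enorm _).trans (le_of_eq ?_)
  simp_rw [enorm_smul]

theorem lintegral_enorm_indicator {E : Type*} [NormedAddCommGroup E] (T : ℝ) (a : ℝ → E) :
    ∫⁻ τ, ‖(Ioo 0 T).indicator a τ‖ₑ = ∫⁻ τ in Ioo 0 T, ‖a τ‖ₑ := by
  rw [← lintegral_indicator measurableSet_Ioo]
  simp_rw [enorm_indicator_eq_indicator_enorm]

theorem lintegral_enorm_conv_le {T : ℝ} {a : ℝ → ℝ} {v : ℝ → F}
    (ha : AEStronglyMeasurable a (volume.restrict (Ioo 0 T)))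
    (hv : AEStronglyMeasurable v (volume.restrict (Ioo 0 T))) :
    ∫⁻ t in Ioo 0 T, ‖conv a v t‖ₑ ≤ (∫⁻ t in Ioo 0 T, ‖a t‖ₑ) * ∫⁻ t in Ioo 0 T, ‖v t‖ₑ := by
  have ma := (aestronglyMeasurable_indicator_iff measurableSet_Ioo).2 ha
  have mv := (aestronglyMeasurable_indicator_iff measurableSet_Ioo).2 hv
  have mm : AEMeasurable (fun p : ℝ × ℝ =>
      ‖(Ioo 0 T).indicator a (p.1 - p.2)‖ₑ * ‖(Ioo 0 T).indicator v p.2‖ₑ)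
      (volume.prod volume) :=
    (ma.comp_quasiMeasurePreserving
      (quasiMeasurePreserving_sub_of_right_invariant volume volume)).enorm.mul
      (mv.comp_snd.enorm)
  calc ∫⁻ t in Ioo 0 T, ‖conv a v t‖ₑ
      ≤ ∫⁻ t in Ioo 0 T, ∫⁻ τ,
          ‖(Ioo 0 T).indicator a (t - τ)‖ₑ * ‖(Ioo 0 T).indicator v τ‖ₑ := by
        refine lintegral_mono_ae ?_
        filter_upwards [ae_restrict_mem measurableSet_Ioo] with t ht
        exact enorm_conv_le (Ioo_subset_Icc_self ht) a v
    _ ≤ ∫⁻ t, ∫⁻ τ, ‖(Ioo 0 T).indicator a (t - τ)‖ₑ * ‖(Ioo 0 T).indicator v τ‖ₑ :=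
        setLIntegral_le_lintegral _ _
    _ = ∫⁻ τ, ∫⁻ t, ‖(Ioo 0 T).indicator a (t - τ)‖ₑ * ‖(Ioo 0 T).indicator v τ‖ₑ :=
        lintegral_lintegral_swap mm
    _ = ∫⁻ τ, (∫⁻ t, ‖(Ioo 0 T).indicator a t‖ₑ) * ‖(Ioo 0 T).indicator v τ‖ₑ := by
        congr 1
        ext τ
        rw [lintegral_mul_const'' _ ?_,
          lintegral_sub_right_eq_self (fun t => ‖(Ioo 0 T).indicator a t‖ₑ)]
        exact (ma.comp_quasiMeasurePreserving
          (measurePreserving_sub_right volume τ).quasiMeasurePreserving).enorm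
    _ = _ := by
        rw [lintegral_const_mul'' _ mv.enorm, lintegral_enorm_indicator, lintegral_enorm_indicator]

/-- Young's inequality `‖a ∗ v‖_{L₂(0,T)} ≤ ‖a‖_{L₁(0,T)} ‖v‖_{L₂(0,T)}`. -/
theorem lintegral_enorm_conv_sq_le {T : ℝ} {a : ℝ → ℝ} {v : ℝ → F}
    (ha : AEStronglyMeasurable a (volume.restrict (Ioo 0 T)))
    (hv : AEStronglyMeasurable v (volume.restrict (Ioo 0 T))) :
    ∫⁻ t in Ioo 0 T, ‖conv a v t‖ₑ ^ 2 ≤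
      (∫⁻ t in Ioo 0 T, ‖a t‖ₑ) ^ 2 * ∫⁻ t in Ioo 0 T, ‖v t‖ₑ ^ 2 := by
  have ma := (aestronglyMeasurable_indicator_iff measurableSet_Ioo).2 ha
  have mv := (aestronglyMeasurable_indicator_iff measurableSet_Ioo).2 hv
  have mm : AEMeasurable (fun p : ℝ × ℝ =>
      ‖(Ioo 0 T).indicator a (p.1 - p.2)‖ₑ * ‖(Ioo 0 T).indicator v p.2‖ₑ ^ 2)
      (volume.prod volume) :=
    (ma.comp_quasiMeasurePreserving
      (quasiMeasurePreserving_sub_of_right_invariant volume volume)).enorm.mul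
      (mv.comp_snd.enorm.pow_const 2)
  have ma' : ∀ t : ℝ, AEMeasurable (fun τ => ‖(Ioo 0 T).indicator a (t - τ)‖ₑ) volume := fun t =>
    (ma.comp_quasiMeasurePreserving
      (quasiMeasurePreserving_sub_left_of_right_invariant volume t)).enorm
  calc ∫⁻ t in Ioo 0 T, ‖conv a v t‖ₑ ^ 2
      ≤ ∫⁻ t in Ioo 0 T, (∫⁻ τ in Ioo 0 T, ‖a τ‖ₑ) * ∫⁻ τ,
          ‖(Ioo 0 T).indicator a (t - τ)‖ₑ * ‖(Ioo 0 T).indicator v τ‖ₑ ^ 2 := by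
        refine lintegral_mono_ae ?_
        filter_upwards [ae_restrict_mem measurableSet_Ioo] with t ht
        refine (pow_le_pow_left' (enorm_conv_le (Ioo_subset_Icc_self ht) a v) 2).trans ?_
        refine (lintegral_mul_sq_le (ma' t) mv.enorm).trans (le_of_eq ?_)
        rw [lintegral_sub_left_eq_self (fun t => ‖(Ioo 0 T).indicator a t‖ₑ),
          lintegral_enorm_indicator]
    _ ≤ ∫⁻ t, (∫⁻ τ in Ioo 0 T, ‖a τ‖ₑ) * ∫⁻ τ,
          ‖(Ioo 0 T).indicator a (t - τ)‖ₑ * ‖(Ioo 0 T).indicator v τ‖ₑ ^ 2 :=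
        setLIntegral_le_lintegral _ _
    _ = (∫⁻ τ in Ioo 0 T, ‖a τ‖ₑ) * ∫⁻ τ, ∫⁻ t,
          ‖(Ioo 0 T).indicator a (t - τ)‖ₑ * ‖(Ioo 0 T).indicator v τ‖ₑ ^ 2 := by
        rw [lintegral_const_mul'' _ mm.lintegral_prod_right', lintegral_lintegral_swap mm]
    _ = (∫⁻ τ in Ioo 0 T, ‖a τ‖ₑ) *
          ∫⁻ τ, (∫⁻ t, ‖(Ioo 0 T).indicator a t‖ₑ) * ‖(Ioo 0 T).indicator v τ‖ₑ ^ 2 := by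
        congr 2
        ext τ
        rw [lintegral_mul_const'' _ ?_,
          lintegral_sub_right_eq_self (fun t => ‖(Ioo 0 T).indicator a t‖ₑ)]
        exact (ma.comp_quasiMeasurePreserving
          (measurePreserving_sub_right volume τ).quasiMeasurePreserving).enorm
    _ = _ := by
        rw [lintegral_const_mul'' _ (mv.enorm.pow_const 2), lintegral_enorm_indicator, ← mul_assoc,
          ← sq]
        congr 1
        rw [← lintegral_indicator measurableSet_Ioo]
        congr 1
        ext τ
        by_cases h : τ ∈ Ioo 0 T
        · rw [indicator_of_mem h, indicator_of_mem h]
        · rw [indicator_of_notMem h, indicator_of_notMem h]; simp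

end

section

/-! ### Completely monotone kernels -/

variable {F : Type*} [NormedAddCommGroup F] [NormedSpace ℝ F]

namespace CompletelyMonotone

variable {k : ℝ → ℝ}

theorem nonneg (hk : CompletelyMonotone k) {t : ℝ} (ht : 0 < t) : 0 ≤ k t := by
  simpa using hk.2 0 t ht

theorem continuousOn (hk : CompletelyMonotone k) : ContinuousOn k (Ioi 0) := hk.1.continuousOn

theorem contDiffOn_deriv (hk : CompletelyMonotone k) : ContDiffOn ℝ ∞ (deriv k) (Ioi 0) :=
  hk.1.deriv_of_isOpen isOpen_Ioi (by simp)

theorem hasDerivAt (hk : CompletelyMonotone k) {t : ℝ} (ht : 0 < t) :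
    HasDerivAt k (deriv k t) t :=
  ((hk.1.contDiffAt (Ioi_mem_nhds ht)).differentiableAt (by simp)).hasDerivAt

theorem deriv_nonpos (hk : CompletelyMonotone k) {t : ℝ} (ht : 0 < t) : deriv k t ≤ 0 := by
  simpa using hk.2 1 t ht

theorem monotoneOn_deriv (hk : CompletelyMonotone k) : MonotoneOn (deriv k) (Ioi 0) := by
  refine monotoneOn_of_deriv_nonneg (convex_Ioi 0) hk.contDiffOn_deriv.continuousOn ?_ ?_
  · rw [interior_Ioi]
    exact hk.contDiffOn_deriv.differentiableOn (by simp)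
  · intro t ht
    rw [interior_Ioi] at ht
    simpa [iteratedDeriv_succ] using hk.2 2 t ht

theorem antitoneOn (hk : CompletelyMonotone k) : AntitoneOn k (Ioi 0) := by
  refine antitoneOn_of_deriv_nonpos (convex_Ioi 0) hk.continuousOn ?_ ?_
  · rw [interior_Ioi]
    exact hk.1.differentiableOn (by simp)
  · intro t ht
    rw [interior_Ioi] at ht
    exact hk.deriv_nonpos ht

/-- Convexity: the difference quotient over `[s, 2s]` is dominated by the slope at the left
end. -/
theorem sub_le_mul_neg_deriv (hk : CompletelyMonotone k) {s ε : ℝ} (hs : 0 < s) (hε : 0 < ε) :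
    k (s + ε) - k (2 * s + ε) ≤ s * -deriv k (s + ε) := by
  obtain ⟨c, hc, hc'⟩ := exists_deriv_eq_slope k (a := s + ε) (b := 2 * s + ε) (by linarith)
    (hk.continuousOn.mono fun x hx => by simp only [mem_Ioi]; linarith [hx.1])
    (fun x hx => (hk.hasDerivAt (by linarith [hx.1])).differentiableAt.differentiableWithinAt)
  have h1 : deriv k (s + ε) ≤ deriv k c :=
    hk.monotoneOn_deriv (by simp only [mem_Ioi]; linarith)
      (by simp only [mem_Ioi]; linarith [hc.1]) hc.1.le
  rw [eq_div_iff (by linarith)] at hc'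
  nlinarith

/-- Unlike `k` itself, the shifted kernel `k(· + ε)` is smooth up to `0`. -/
theorem continuousOn_neg_deriv_shift (hk : CompletelyMonotone k) {ε : ℝ} (hε : 0 < ε) :
    ContinuousOn (fun s => -deriv k (s + ε)) (Ici 0) :=
  (hk.contDiffOn_deriv.continuousOn.comp (by fun_prop) fun x hx => by
    simp only [mem_Ioi]; linarith [mem_Ici.1 hx]).neg

theorem integral_neg_deriv_shift (hk : CompletelyMonotone k) {t ε : ℝ} (ht : 0 ≤ t) (hε : 0 < ε) :
    ∫ s in (0 : ℝ)..t, -deriv k (s + ε) = k ε - k (t + ε) := by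
  have h := intervalIntegral.integral_eq_sub_of_hasDerivAt (a := 0) (b := t)
    (f := fun s => -k (s + ε)) (f' := fun s => -deriv k (s + ε)) (fun s hs => ?_) ?_
  · rw [h, zero_add]; ring
  · rw [uIcc_of_le ht] at hs
    exact ((hk.hasDerivAt (by linarith [hs.1])).comp_add_const s ε).neg
  · refine ContinuousOn.intervalIntegrable ((hk.continuousOn_neg_deriv_shift hε).mono ?_)
    rw [uIcc_of_le ht]
    exact Icc_subset_Ici_self

end CompletelyMonotone

/-! ### The energy identity for regular kernels -/

/-- `∫_0^T (a ∗ v) = ((1 ∗ a) ∗ v)(T)`. -/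
theorem integral_conv [CompleteSpace F] {T : ℝ} {a : ℝ → ℝ} {v : ℝ → F}
    (ha : IntegrableOn a (Ioo 0 T)) (hv : IntegrableOn v (Ioo 0 T)) :
    ∫ t in Ioo 0 T, conv a v t = ∫ τ in Ioo 0 T, (∫ σ in (0 : ℝ)..(T - τ), a σ) • v τ := by
  have ia := ha.integrable_indicator measurableSet_Ioo
  have iv := hv.integrable_indicator measurableSet_Ioo
  have hint : Integrable (fun p : ℝ × ℝ =>
      (Ioo 0 T).indicator a (p.1 - p.2) • (Ioo 0 T).indicator v p.2)
      ((volume.restrict (Ioo 0 T)).prod volume) := by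
    have h := (iv.convolution_integrand (μ := volume) (ContinuousLinearMap.lsmul ℝ ℝ).flip ia)
    refine h.mono_measure ?_
    exact Measure.prod_mono Measure.restrict_le_self le_rfl
  calc ∫ t in Ioo 0 T, conv a v t
      = ∫ t in Ioo 0 T, ∫ τ, (Ioo 0 T).indicator a (t - τ) • (Ioo 0 T).indicator v τ := by
        refine setIntegral_congr_fun measurableSet_Ioo fun t ht => ?_
        rw [conv_eq_convolution (Ioo_subset_Icc_self ht), convolution_lsmul_swap]
    _ = ∫ τ, ∫ t in Ioo 0 T, (Ioo 0 T).indicator a (t - τ) • (Ioo 0 T).indicator v τ :=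
        integral_integral_swap hint
    _ = _ := by
        rw [← integral_indicator measurableSet_Ioo]
        congr 1
        ext τ
        by_cases h : τ ∈ Ioo 0 T
        · rw [indicator_of_mem h, indicator_of_mem h, integral_smul_const]
          congr 1
          rw [intervalIntegral.integral_of_le (by linarith [h.2]), integral_Ioc_eq_integral_Ioo,
            ← integral_indicator measurableSet_Ioo, ← integral_indicator measurableSet_Ioo,
            ← integral_sub_right_eq_self ((Ioo 0 (T - τ)).indicator a) τ]
          congr 1
          ext t
          by_cases h' : t - τ ∈ Ioo 0 (T - τ)
          · rw [indicator_of_mem h', indicator_of_mem, indicator_of_mem]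
            · exact ⟨h'.1, by linarith [h'.2, h.1]⟩
            · exact ⟨by linarith [h'.1, h.1], by linarith [h'.2]⟩
          · rw [indicator_of_notMem h']
            by_cases h2 : t ∈ Ioo 0 T
            · rw [indicator_of_mem h2, indicator_of_notMem]
              exact fun h3 => h' ⟨h3.1, by linarith [h2.2]⟩
            · rw [indicator_of_notMem h2]
        · simp [indicator_of_notMem h]

section Energy

variable {H : Type*} [NormedAddCommGroup H] [InnerProductSpace ℝ H] [CompleteSpace H]

theorem _root_.IntervalIntegrable.smul_of_bounded {m : ℝ → ℝ} {z : ℝ → F} {a b C : ℝ}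
    (hm : IntervalIntegrable m volume a b) (hz : StronglyMeasurable z) (hC : ∀ s, ‖z s‖ ≤ C) :
    IntervalIntegrable (fun s => m s • z s) volume a b := by
  rw [intervalIntegrable_iff] at hm ⊢
  exact Integrable.smul_bdd hm C hz.aestronglyMeasurable (Eventually.of_forall hC)

theorem conv_eq_integral_reflect (a : ℝ → ℝ) (v : ℝ → F) (t : ℝ) :
    conv a v t = ∫ s in (0 : ℝ)..t, a s • v (t - s) := by
  have := intervalIntegral.integral_comp_sub_left (a := 0) (b := t)
    (fun s => a s • v (t - s)) t
  simp only [sub_self, sub_zero, sub_sub_cancel] at this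
  rw [← this, conv]

/-- The quadratic form `⟨m ∗ g, g⟩` through squared increments of `g`, from
`2 ⟨a, b⟩ = |a|² + |b|² - |a - b|²` with `a = g(t)` and `b = g(t-s)`. -/
theorem inner_conv_self_eq {T t C : ℝ} (ht : t ∈ Ioo 0 T) {m : ℝ → ℝ} {g : ℝ → H}
    (hm : IntegrableOn m (Ioo 0 T)) (hg : StronglyMeasurable g) (hC : ∀ t, ‖g t‖ ≤ C) :
    2 * inner ℝ (conv m g t) (g t) =
      (∫ s in (0 : ℝ)..t, m s) * ‖g t‖ ^ 2 + conv m (fun τ => ‖g τ‖ ^ 2) t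
        - ∫ s in (0 : ℝ)..t, m s * ‖g t - g (t - s)‖ ^ 2 := by
  have him : IntervalIntegrable m volume 0 t := by
    rw [intervalIntegrable_iff_integrableOn_Ioo_of_le ht.1.le]
    exact hm.mono_set (Ioo_subset_Ioo_right ht.2.le)
  have hgs : StronglyMeasurable fun s => g (t - s) := hg.comp_measurable (by fun_prop)
  have i1 : IntervalIntegrable (fun s => m s • g (t - s)) volume 0 t :=
    him.smul_of_bounded hgs fun s => hC _
  have hC0 : 0 ≤ C := (norm_nonneg _).trans (hC 0)
  have i2 : IntervalIntegrable (fun s => m s * ‖g (t - s)‖ ^ 2) volume 0 t := by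
    refine him.smul_of_bounded (C := C ^ 2) (hgs.norm.pow 2) fun s => ?_
    rw [norm_pow, norm_norm]
    exact pow_le_pow_left₀ (norm_nonneg _) (hC _) 2
  have i3 : IntervalIntegrable (fun s => m s * ‖g t - g (t - s)‖ ^ 2) volume 0 t := by
    refine him.smul_of_bounded (C := (C + C) ^ 2)
      (((stronglyMeasurable_const (b := g t)).sub hgs).norm.pow 2) fun s => ?_
    rw [norm_pow, norm_norm]
    exact pow_le_pow_left₀ (norm_nonneg _) ((norm_sub_le _ _).trans (add_le_add (hC _) (hC _))) 2
  rw [conv_eq_integral_reflect, conv_eq_integral_reflect, real_inner_comm,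
    ← intervalIntegral.integral_mul_const,
    ← intervalIntegral.integral_add (him.mul_const _) (by simpa using i2),
    ← intervalIntegral.integral_sub ((him.mul_const _).add (by simpa using i2)) i3]
  have : inner ℝ (g t) (∫ s in (0 : ℝ)..t, m s • g (t - s)) =
      ∫ s in (0 : ℝ)..t, m s * inner ℝ (g t) (g (t - s)) := by
    rw [intervalIntegral.integral_of_le ht.1.le, intervalIntegral.integral_of_le ht.1.le,
      ← integral_inner ((intervalIntegrable_iff_integrableOn_Ioc_of_le ht.1.le).1 i1)]
    simp_rw [inner_smul_right]
  rw [this, ← intervalIntegral.integral_const_mul]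
  congr 1
  ext s
  rw [norm_sub_sq_real, smul_eq_mul]
  ring

/-- Integrated form of `inner_conv_self_eq`, for a kernel `κ` whose negative derivative is `m`: on
the left is the integral of `⟨(κ ∗ g)', g⟩`. -/
theorem integral_inner_conv_self_eq {T C : ℝ} {m κ : ℝ → ℝ} {g : ℝ → H}
    (hm : IntegrableOn m (Ioo 0 T)) (hκ : ∀ t ∈ Icc 0 T, ∫ s in (0 : ℝ)..t, m s = κ 0 - κ t)
    (hg : StronglyMeasurable g) (hC : ∀ t, ‖g t‖ ≤ C) :
    IntegrableOn (fun t => κ 0 * ‖g t‖ ^ 2 - inner ℝ (conv m g t) (g t)) (Ioo 0 T) ∧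
    IntegrableOn (fun t => (κ t + κ (T - t)) * ‖g t‖ ^ 2 +
        ∫ s in (0 : ℝ)..t, m s * ‖g t - g (t - s)‖ ^ 2) (Ioo 0 T) ∧
    2 * ∫ t in Ioo 0 T, (κ 0 * ‖g t‖ ^ 2 - inner ℝ (conv m g t) (g t)) =
      ∫ t in Ioo 0 T, ((κ t + κ (T - t)) * ‖g t‖ ^ 2 +
        ∫ s in (0 : ℝ)..t, m s * ‖g t - g (t - s)‖ ^ 2) := by
  have ig : IntegrableOn g (Ioo 0 T) :=
    Integrable.of_bound hg.aestronglyMeasurable C (Eventually.of_forall hC)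
  have hb2 : ∀ t, ‖‖g t‖ ^ 2‖ ≤ C ^ 2 := fun t => by
    rw [norm_pow, norm_norm]
    exact pow_le_pow_left₀ (norm_nonneg _) (hC _) 2
  have ig2 : IntegrableOn (fun t => ‖g t‖ ^ 2) (Ioo 0 T) :=
    Integrable.of_bound (hg.norm.pow 2).aestronglyMeasurable (C ^ 2) (Eventually.of_forall hb2)
  have ic := integrableOn_conv hm ig
  have ic2 := integrableOn_conv hm ig2
  have iin : IntegrableOn (fun t => inner ℝ (conv m g t) (g t)) (Ioo 0 T) := by
    refine (ic.norm.mul_const C).mono' (ic.aestronglyMeasurable.inner hg.aestronglyMeasurable) ?_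
    refine Eventually.of_forall fun t => ?_
    exact (norm_inner_le_norm _ _).trans (mul_le_mul_of_nonneg_left (hC t) (norm_nonneg _))
  have cκ : ContinuousOn (fun t => κ 0 - κ t) (Icc 0 T) := by
    by_cases hT : 0 ≤ T
    · refine ContinuousOn.congr ?_ fun t ht => (hκ t ht).symm
      have := intervalIntegral.continuousOn_primitive_interval (μ := volume) (f := m)
        (a := 0) (b := T) (by
          rw [uIcc_of_le hT]
          exact (integrableOn_Icc_iff_integrableOn_Ioo (by simp) (by simp)).2 hm)
      rwa [uIcc_of_le hT] at this
    · rw [Icc_eq_empty hT]; exact continuousOn_empty _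
  have cκ' : ContinuousOn κ (Icc 0 T) := by
    have := (continuousOn_const (c := κ 0)).sub cκ
    refine this.congr fun t _ => ?_
    simp
  have iκ : ∀ z : ℝ → ℝ, ContinuousOn z (Icc 0 T) →
      IntegrableOn (fun t => z t * ‖g t‖ ^ 2) (Ioo 0 T) := by
    intro z hz
    have : IntegrableOn z (Ioo 0 T) :=
      hz.integrableOn_Icc.mono_set Ioo_subset_Icc_self
    exact Integrable.mul_bdd (c := C ^ 2) this (hg.norm.pow 2).aestronglyMeasurable
      (Eventually.of_forall hb2)
  have cκT : ContinuousOn (fun t => κ (T - t)) (Icc 0 T) :=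
    cκ'.comp (by fun_prop) fun t ht => ⟨by linarith [ht.2], by linarith [ht.1]⟩
  have j1 := iκ (fun t => κ 0 - κ t) cκ
  have j2 := iκ (fun t => κ 0 - κ (T - t)) (continuousOn_const.sub cκT)
  have j3 : IntegrableOn (fun t => κ 0 * ‖g t‖ ^ 2) (Ioo 0 T) := ig2.const_mul _
  have j4 := iκ (fun t => κ t + κ (T - t)) (cκ'.add cκT)
  have pt : ∀ t ∈ Ioo 0 T, (κ t + κ (T - t)) * ‖g t‖ ^ 2 +
        ∫ s in (0 : ℝ)..t, m s * ‖g t - g (t - s)‖ ^ 2 =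
      2 * (κ 0 * ‖g t‖ ^ 2 - inner ℝ (conv m g t) (g t)) +
        (conv m (fun τ => ‖g τ‖ ^ 2) t - (κ 0 - κ (T - t)) * ‖g t‖ ^ 2) := by
    intro t ht
    have h := inner_conv_self_eq ht hm hg hC
    rw [hκ t (Ioo_subset_Icc_self ht)] at h
    linarith
  have iR : IntegrableOn (fun t => 2 * (κ 0 * ‖g t‖ ^ 2 - inner ℝ (conv m g t) (g t)) +
      (conv m (fun τ => ‖g τ‖ ^ 2) t - (κ 0 - κ (T - t)) * ‖g t‖ ^ 2)) (Ioo 0 T) :=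
    ((j3.sub iin).const_mul 2).add (ic2.sub j2)
  refine ⟨j3.sub iin, iR.congr_fun (fun t ht => (pt t ht).symm) measurableSet_Ioo, ?_⟩
  rw [setIntegral_congr_fun measurableSet_Ioo pt]
  have s1 : ∫ t in Ioo 0 T, (2 * (κ 0 * ‖g t‖ ^ 2 - inner ℝ (conv m g t) (g t)) +
        (conv m (fun τ => ‖g τ‖ ^ 2) t - (κ 0 - κ (T - t)) * ‖g t‖ ^ 2)) =
      (∫ t in Ioo 0 T, 2 * (κ 0 * ‖g t‖ ^ 2 - inner ℝ (conv m g t) (g t))) +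
        ∫ t in Ioo 0 T, (conv m (fun τ => ‖g τ‖ ^ 2) t - (κ 0 - κ (T - t)) * ‖g t‖ ^ 2) :=
    integral_add ((j3.sub iin).const_mul 2) (ic2.sub j2)
  rw [s1]
  have s2 : ∫ t in Ioo 0 T,
      (conv m (fun τ => ‖g τ‖ ^ 2) t - (κ 0 - κ (T - t)) * ‖g t‖ ^ 2) = 0 := by
    rw [integral_sub ic2 j2, integral_conv hm ig2, sub_eq_zero]
    refine setIntegral_congr_fun measurableSet_Ioo fun t ht => ?_
    rw [hκ (T - t) ⟨by linarith [ht.2], by linarith [ht.1]⟩, smul_eq_mul]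
  rw [s2, add_zero, integral_const_mul]

end Energy

end

section

/-! ### Approximation by shifted kernels -/

variable {F : Type*} [NormedAddCommGroup F] [NormedSpace ℝ F]
variable {H : Type*} [NormedAddCommGroup H] [InnerProductSpace ℝ H]

theorem _root_.MeasureTheory.LocallyIntegrableOn.integrableOn_Ioo {E : Type*}
    [NormedAddCommGroup E] {k : ℝ → E}
    (hk : LocallyIntegrableOn k (Ici 0)) (T : ℝ) : IntegrableOn k (Ioo 0 T) :=
  (hk.integrableOn_compact_subset Icc_subset_Ici_self isCompact_Icc).mono_set
    Ioo_subset_Icc_self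

theorem CompletelyMonotone.integrableOn_shift {k : ℝ → ℝ} (hk : CompletelyMonotone k)
    {ε : ℝ} (hε : 0 < ε) (T : ℝ) : IntegrableOn (fun s => k (s + ε)) (Ioo 0 T) := by
  refine IntegrableOn.mono_set (t := Icc 0 T) ?_ Ioo_subset_Icc_self
  refine (hk.continuousOn.comp (by fun_prop) fun x hx => ?_).integrableOn_Icc
  simp only [mem_Ioi]; linarith [hx.1]

theorem CompletelyMonotone.integrableOn_neg_deriv_shift {k : ℝ → ℝ} (hk : CompletelyMonotone k)
    {ε : ℝ} (hε : 0 < ε) (T : ℝ) : IntegrableOn (fun s => -deriv k (s + ε)) (Ioo 0 T) :=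
  ((hk.continuousOn_neg_deriv_shift hε).mono
    (Icc_subset_Ici_self : Icc 0 T ⊆ Ici 0)).integrableOn_Icc.mono_set Ioo_subset_Icc_self

/-- For `g = 1 ∗ p` the function `k(· + ε) ∗ p` is the time derivative of `k(· + ε) ∗ g`, here
computed by differentiating the kernel. -/
theorem conv_shift_eq [CompleteSpace F] {k : ℝ → ℝ} (hk : CompletelyMonotone k) {ε T : ℝ}
    (hε : 0 < ε) {p : ℝ → F} (hp : IntegrableOn p (Ioo 0 T)) :
    ∀ᵐ t ∂(volume.restrict (Ioo 0 T)), conv (fun s => k (s + ε)) p t =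
      k ε • (∫ τ in (0 : ℝ)..t, p τ) -
        conv (fun s => -deriv k (s + ε)) (fun t => ∫ τ in (0 : ℝ)..t, p τ) t := by
  have hm := hk.integrableOn_neg_deriv_shift hε T
  have h1 : IntegrableOn (fun _ : ℝ => (1 : ℝ)) (Ioo 0 T) := by simp
  have hc : IntegrableOn (fun _ : ℝ => k ε) (Ioo 0 T) := by simp
  filter_upwards [conv_assoc hm h1 hp, conv_sub_left hc (integrableOn_conv hm h1) hp,
    ae_restrict_mem measurableSet_Ioo] with t h2 h3 ht
  have e : (fun s => k (s + ε)) =ᵐ[volume.restrict (Ioo 0 T)]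
      fun s => k ε - conv (fun s => -deriv k (s + ε)) (fun _ => 1) s := by
    filter_upwards [ae_restrict_mem measurableSet_Ioo] with s hs
    rw [conv_const_right, hk.integral_neg_deriv_shift hs.1.le hε]
    simp
  rw [conv_congr (Ioo_subset_Icc_self ht) e (ae_eq_refl p), h3, h2, conv_const_left]
  congr 2
  ext s
  exact conv_one_left p s

/-- `k(· + ε) → k` in `L₁(0,T)`, by dominated convergence with majorant `k`. -/
theorem tendsto_lintegral_shift_sub {k : ℝ → ℝ} (hk : CompletelyMonotone k)
    (hki : LocallyIntegrableOn k (Ici 0)) (T : ℝ) :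
    Tendsto (fun j : ℕ => ∫⁻ t in Ioo 0 T, ‖k (t + 1 / ((j : ℝ) + 1)) - k t‖ₑ) atTop (𝓝 0) := by
  have hi := hki.integrableOn_Ioo T
  have := tendsto_lintegral_of_dominated_convergence'
    (μ := volume.restrict (Ioo 0 T))
    (F := fun (j : ℕ) t => ‖k (t + 1 / ((j : ℝ) + 1)) - k t‖ₑ) (f := fun _ => 0)
    (fun t => ‖k t‖ₑ) ?_ ?_ hi.2.ne ?_
  · simpa using this
  · intro j
    exact ((hk.integrableOn_shift (by positivity) T).sub hi).aestronglyMeasurable.enorm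
  · intro j
    filter_upwards [ae_restrict_mem measurableSet_Ioo] with t ht
    rw [enorm_le_iff_norm_le, Real.norm_eq_abs, Real.norm_eq_abs]
    have hp : (0 : ℝ) < 1 / ((j : ℝ) + 1) := by positivity
    have h0 := hk.nonneg (t := t + 1 / ((j : ℝ) + 1)) (by linarith [ht.1])
    have h1 := hk.antitoneOn ht.1 (show t + 1 / ((j : ℝ) + 1) ∈ Ioi (0 : ℝ) by
      simp only [mem_Ioi]; linarith [ht.1]) (by linarith)
    rw [abs_of_nonpos (by linarith), abs_of_nonneg (by linarith)]
    linarith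
  · filter_upwards [ae_restrict_mem measurableSet_Ioo] with t ht
    have hc : ContinuousAt k t := hk.continuousOn.continuousAt (Ioi_mem_nhds ht.1)
    have h1 : Tendsto (fun j : ℕ => t + 1 / ((j : ℝ) + 1)) atTop (𝓝 t) := by
      simpa using tendsto_const_nhds.add (tendsto_one_div_add_atTop_nhds_zero_nat (𝕜 := ℝ))
    have h2 := ((hc.tendsto.comp h1).sub_const (k t)).enorm
    simpa using h2

theorem tendsto_integral_inner_conv_shift [CompleteSpace H] {k : ℝ → ℝ}
    (hk : CompletelyMonotone k)
    (hki : LocallyIntegrableOn k (Ici 0)) {T C : ℝ} {p g : ℝ → H} (hp : IntegrableOn p (Ioo 0 T))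
    (hg : StronglyMeasurable g) (hC : ∀ t, ‖g t‖ ≤ C) :
    Tendsto (fun j : ℕ => ∫ t in Ioo 0 T,
      inner ℝ (conv (fun s => k (s + 1 / ((j : ℝ) + 1))) p t) (g t)) atTop
      (𝓝 (∫ t in Ioo 0 T, inner ℝ (conv k p t) (g t))) := by
  have hi := hki.integrableOn_Ioo T
  have hint : ∀ a : ℝ → ℝ, IntegrableOn a (Ioo 0 T) →
      IntegrableOn (fun t => inner ℝ (conv a p t) (g t)) (Ioo 0 T) := by
    intro a ha
    have ic := integrableOn_conv ha hp
    refine (ic.norm.mul_const C).mono' (ic.aestronglyMeasurable.inner hg.aestronglyMeasurable) ?_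
    refine Eventually.of_forall fun t => ?_
    exact (norm_inner_le_norm _ _).trans (mul_le_mul_of_nonneg_left (hC t) (norm_nonneg _))
  have hs : ∀ j : ℕ, IntegrableOn (fun s => k (s + 1 / ((j : ℝ) + 1))) (Ioo 0 T) :=
    fun j => hk.integrableOn_shift (by positivity) T
  refine tendsto_integral_of_L1 _ (hint k hi).aestronglyMeasurable
    (Eventually.of_forall fun j => hint _ (hs j)) ?_
  have lim := ENNReal.Tendsto.mul_const (b := (∫⁻ t in Ioo 0 T, ‖p t‖ₑ) * ENNReal.ofReal C)
    (tendsto_lintegral_shift_sub hk hki T)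
    (Or.inr (ENNReal.mul_ne_top hp.2.ne ENNReal.ofReal_ne_top))
  rw [zero_mul] at lim
  refine tendsto_of_tendsto_of_tendsto_of_le_of_le tendsto_const_nhds lim
    (fun _ => zero_le) fun j => ?_
  calc ∫⁻ t in Ioo 0 T, ‖inner ℝ (conv (fun s => k (s + 1 / ((j : ℝ) + 1))) p t) (g t)
          - inner ℝ (conv k p t) (g t)‖ₑ
      ≤ ∫⁻ t in Ioo 0 T, ‖conv (fun s => k (s + 1 / ((j : ℝ) + 1)) - k s) p t‖ₑ
          * ENNReal.ofReal C := by
        refine lintegral_mono_ae ?_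
        filter_upwards [conv_sub_left (hs j) hi hp] with t ht
        rw [← inner_sub_left, ht, ← ofReal_norm, ← ofReal_norm,
          ← ENNReal.ofReal_mul (norm_nonneg _)]
        exact ENNReal.ofReal_le_ofReal ((norm_inner_le_norm _ _).trans
          (mul_le_mul_of_nonneg_left (hC t) (norm_nonneg _)))
    _ ≤ _ := by
        rw [lintegral_mul_const' _ _ ENNReal.ofReal_ne_top, ← mul_assoc]
        gcongr
        exact lintegral_enorm_conv_le ((hs j).sub hi).aestronglyMeasurable hp.aestronglyMeasurable

/-! ### The quadratic energy and its lower semicontinuity -/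

/-- The quadratic energy
`∫_0^T α(t) |g(t)|² dt + ∫_0^T ∫_0^t β(s) |g(t) - g(t-s)|² ds dt` with values in `[0, ∞]`.
For nonnegative weights `α` and `β` the truncation by `ENNReal.ofReal` is harmless. -/
noncomputable def energy {E : Type*} [NormedAddCommGroup E] (T : ℝ) (α β : ℝ → ℝ)
    (g : ℝ → E) : ENNReal :=
  ∫⁻ t in Ioo 0 T, (ENNReal.ofReal (α t * ‖g t‖ ^ 2) +
    ∫⁻ s in Ioo 0 t, ENNReal.ofReal (β s * ‖g t - g (t - s)‖ ^ 2))

theorem energy_mono {E : Type*} [NormedAddCommGroup E] {T : ℝ} {α β β' : ℝ → ℝ}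
    (g : ℝ → E) (h : ∀ s, 0 < s → β s ≤ β' s) :
    energy T α β g ≤ energy T α β' g := by
  refine lintegral_mono fun t => ?_
  refine add_le_add le_rfl ?_
  refine setLIntegral_mono_ae' measurableSet_Ioo (Eventually.of_forall fun (s : ℝ) hs => ?_)
  exact ENNReal.ofReal_le_ofReal (mul_le_mul_of_nonneg_right (h s hs.1) (by positivity))

theorem aemeasurable_energy_integrand {E : Type*} [NormedAddCommGroup E] {T : ℝ} {α β : ℝ → ℝ}
    {g : ℝ → E}
    (hα : AEMeasurable α (volume.restrict (Ioo 0 T)))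
    (hβ : AEMeasurable β (volume.restrict (Ioo 0 T))) (hg : StronglyMeasurable g) :
    AEMeasurable (fun t => ENNReal.ofReal (α t * ‖g t‖ ^ 2) +
      ∫⁻ s in Ioo 0 t, ENNReal.ofReal (β s * ‖g t - g (t - s)‖ ^ 2))
      (volume.restrict (Ioo 0 T)) := by
  refine (hα.mul (hg.norm.measurable.pow_const 2).aemeasurable).ennreal_ofReal.add ?_
  have hset : MeasurableSet {p : ℝ × ℝ | p.2 < p.1} :=
    measurableSet_lt measurable_snd measurable_fst
  have m1 : AEMeasurable ({p : ℝ × ℝ | p.2 < p.1}.indicator fun p : ℝ × ℝ =>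
      ENNReal.ofReal (β p.2 * ‖g p.1 - g (p.1 - p.2)‖ ^ 2))
      ((volume.restrict (Ioo 0 T)).prod (volume.restrict (Ioo 0 T))) := by
    refine AEMeasurable.indicator ?_ hset
    refine AEMeasurable.ennreal_ofReal ((hβ.comp_snd).mul ?_)
    have : StronglyMeasurable fun p : ℝ × ℝ => g p.1 - g (p.1 - p.2) :=
      (hg.comp_measurable measurable_fst).sub
        (hg.comp_measurable (measurable_fst.sub measurable_snd))
    exact (this.norm.measurable.pow_const 2).aemeasurable
  refine m1.lintegral_prod_right'.congr ?_
  filter_upwards [ae_restrict_mem measurableSet_Ioo] with t ht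
  rw [← lintegral_indicator measurableSet_Ioo, ← lintegral_indicator measurableSet_Ioo]
  congr 1
  ext s
  by_cases h : s ∈ Ioo 0 t
  · rw [indicator_of_mem h, indicator_of_mem (show s ∈ Ioo 0 T from ⟨h.1, h.2.trans ht.2⟩),
      indicator_of_mem (show (t, s) ∈ {p : ℝ × ℝ | p.2 < p.1} from h.2)]
  · rw [indicator_of_notMem h]
    by_cases h' : s ∈ Ioo 0 T
    · rw [indicator_of_mem h', indicator_of_notMem]
      exact fun h2 => h ⟨h'.1, h2⟩
    · rw [indicator_of_notMem h']

theorem liminf_add_liminf_le (u v : ℕ → ENNReal) :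
    liminf u atTop + liminf v atTop ≤ liminf (fun j => u j + v j) atTop := by
  have mono : ∀ w : ℕ → ENNReal, Monotone fun n => ⨅ i, ⨅ (_ : i ≥ n), w i := fun w n m h =>
    le_iInf₂ fun i hi => iInf₂_le i (h.trans hi)
  simp only [liminf_eq_iSup_iInf_of_nat]
  rw [ENNReal.iSup_add_iSup_of_monotone (mono u) (mono v)]
  exact iSup_mono fun n => le_iInf₂ fun i hi => add_le_add (iInf₂_le i hi) (iInf₂_le i hi)

/-- Fatou's lemma for the energy. -/
theorem energy_le_liminf {E : Type*} [NormedAddCommGroup E] {T : ℝ} {α β : ℝ → ℝ} {g : ℝ → E}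
    {αs βs : ℕ → ℝ → ℝ} {gs : ℕ → ℝ → E}
    (hαm : ∀ j, AEMeasurable (αs j) (volume.restrict (Ioo 0 T)))
    (hβm : ∀ j, AEMeasurable (βs j) (volume.restrict (Ioo 0 T)))
    (hgm : ∀ j, StronglyMeasurable (gs j))
    (hα : ∀ t ∈ Ioo 0 T, Tendsto (fun j => αs j t) atTop (𝓝 (α t)))
    (hβ : ∀ s ∈ Ioo 0 T, Tendsto (fun j => βs j s) atTop (𝓝 (β s)))
    (hg : ∀ᵐ t ∂(volume.restrict (Ioo 0 T)), Tendsto (fun j => gs j t) atTop (𝓝 (g t))) :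
    energy T α β g ≤ liminf (fun j => energy T (αs j) (βs j) (gs j)) atTop := by
  refine le_trans ?_ (lintegral_liminf_le' fun j =>
    aemeasurable_energy_integrand (hαm j) (hβm j) (hgm j))
  refine lintegral_mono_ae ?_
  filter_upwards [hg, ae_restrict_mem measurableSet_Ioo] with t hgt ht
  refine le_trans ?_ (liminf_add_liminf_le _ _)
  refine add_le_add ?_ ?_
  · exact (ENNReal.tendsto_ofReal ((hα t ht).mul (hgt.norm.pow 2))).liminf_eq.ge
  · have hm : ∀ j, AEMeasurable (fun s => ENNReal.ofReal (βs j s * ‖gs j t - gs j (t - s)‖ ^ 2))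
        (volume.restrict (Ioo 0 t)) := by
      intro j
      refine AEMeasurable.ennreal_ofReal (((hβm j).mono_measure
        (Measure.restrict_mono (Ioo_subset_Ioo_right ht.2.le) le_rfl)).mul ?_)
      have : StronglyMeasurable fun s => gs j t - gs j (t - s) :=
        stronglyMeasurable_const.sub ((hgm j).comp_measurable (measurable_const.sub measurable_id))
      exact (this.norm.measurable.pow_const 2).aemeasurable
    refine le_trans ?_ (lintegral_liminf_le' hm)
    refine lintegral_mono_ae ?_
    have hg' : ∀ᵐ s ∂(volume.restrict (Ioo 0 t)),
        Tendsto (fun j => gs j (t - s)) atTop (𝓝 (g (t - s))) := by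
      rw [ae_restrict_iff' measurableSet_Ioo] at hg ⊢
      filter_upwards [(quasiMeasurePreserving_sub_left_of_right_invariant volume t).ae hg]
        with s hs hs'
      exact hs ⟨by linarith [hs'.2], by linarith [hs'.1, ht.2]⟩
    filter_upwards [hg', ae_restrict_mem measurableSet_Ioo] with s hs hs'
    exact (ENNReal.tendsto_ofReal ((hβ s ⟨hs'.1, hs'.2.trans ht.2⟩).mul
      ((hgt.sub hs).norm.pow 2))).liminf_eq.ge

end

section

/-! ### The energy inequality for primitives -/

variable {H : Type*} [NormedAddCommGroup H] [InnerProductSpace ℝ H]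

theorem norm_primitive_le {p : ℝ → H} (hp : Integrable p) (t : ℝ) :
    ‖∫ τ in (0 : ℝ)..t, p τ‖ ≤ ∫ τ, ‖p τ‖ := by
  refine intervalIntegral.norm_integral_le_integral_norm_uIoc.trans ?_
  exact setIntegral_le_integral hp.norm (Eventually.of_forall fun _ => norm_nonneg _)

theorem continuous_primitive_of_integrable {p : ℝ → H} (hp : Integrable p) :
    Continuous fun t => ∫ τ in (0 : ℝ)..t, p τ :=
  intervalIntegral.continuous_primitive (fun _ _ => hp.intervalIntegrable) 0

/-- The energy identity for the kernel `k(· + ε)`. -/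
theorem energy_shift_eq [CompleteSpace H] {k : ℝ → ℝ} (hk : CompletelyMonotone k)
    {ε : ℝ} (hε : 0 < ε) (T : ℝ) {p : ℝ → H} (hp : Integrable p) :
    0 ≤ ∫ t in Ioo 0 T,
      inner ℝ (conv (fun s => k (s + ε)) p t) (∫ τ in (0 : ℝ)..t, p τ) ∧
    energy T (fun t => k (t + ε) + k (T - t + ε)) (fun s => -deriv k (s + ε))
      (fun t => ∫ τ in (0 : ℝ)..t, p τ) =
    ENNReal.ofReal (2 * ∫ t in Ioo 0 T,
      inner ℝ (conv (fun s => k (s + ε)) p t) (∫ τ in (0 : ℝ)..t, p τ)) := by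
  set g : ℝ → H := fun t => ∫ τ in (0 : ℝ)..t, p τ with hg
  have hgs : StronglyMeasurable g := (continuous_primitive_of_integrable hp).stronglyMeasurable
  have hm := hk.integrableOn_neg_deriv_shift hε T
  obtain ⟨-, i2, e⟩ := integral_inner_conv_self_eq (κ := fun s => k (s + ε)) hm
    (fun t ht => by rw [hk.integral_neg_deriv_shift ht.1 hε, zero_add]) hgs (norm_primitive_le hp)
  have hmn : ∀ s, 0 < s → 0 ≤ -deriv k (s + ε) := fun s hs => by
    linarith [hk.deriv_nonpos (t := s + ε) (by linarith)]
  have hmi : ∀ t ∈ Ioo 0 T, IntervalIntegrable (fun s => -deriv k (s + ε) *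
      ‖g t - g (t - s)‖ ^ 2) volume 0 t := by
    intro t ht
    refine IntervalIntegrable.smul_of_bounded (m := fun s => -deriv k (s + ε))
      (z := fun s => ‖g t - g (t - s)‖ ^ 2) (C := ((∫ τ, ‖p τ‖) + ∫ τ, ‖p τ‖) ^ 2) ?_
      ((stronglyMeasurable_const.sub (hgs.comp_measurable (by fun_prop))).norm.pow 2)
      fun s => ?_
    · rw [intervalIntegrable_iff_integrableOn_Ioo_of_le ht.1.le]
      exact hm.mono_set (Ioo_subset_Ioo_right ht.2.le)
    · rw [norm_pow, norm_norm]
      exact pow_le_pow_left₀ (norm_nonneg _) ((norm_sub_le _ _).trans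
        (add_le_add (norm_primitive_le hp t) (norm_primitive_le hp _))) 2
  have hn1 : ∀ t ∈ Ioo 0 T, 0 ≤ (k (t + ε) + k (T - t + ε)) * ‖g t‖ ^ 2 := fun t ht =>
    mul_nonneg (add_nonneg (hk.nonneg (by linarith [ht.1])) (hk.nonneg (by linarith [ht.2])))
      (by positivity)
  have hn2 : ∀ t ∈ Ioo 0 T, 0 ≤ ∫ s in (0 : ℝ)..t, -deriv k (s + ε) * ‖g t - g (t - s)‖ ^ 2 := by
    intro t ht
    rw [intervalIntegral.integral_of_le ht.1.le]
    exact setIntegral_nonneg measurableSet_Ioc fun s hs => mul_nonneg (hmn s hs.1) (by positivity)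
  have e' : ∫ t in Ioo 0 T, inner ℝ (conv (fun s => k (s + ε)) p t) (g t) =
      ∫ t in Ioo 0 T, (k (0 + ε) * ‖g t‖ ^ 2 -
        inner ℝ (conv (fun s => -deriv k (s + ε)) g t) (g t)) := by
    refine integral_congr_ae ?_
    filter_upwards [conv_shift_eq hk hε (hp.integrableOn (s := Ioo 0 T))] with t ht
    rw [ht, inner_sub_left, inner_smul_left, real_inner_self_eq_norm_sq, zero_add]
    rfl
  refine ⟨?_, ?_⟩
  · have : 0 ≤ 2 * ∫ t in Ioo 0 T, inner ℝ (conv (fun s => k (s + ε)) p t) (g t) := by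
      rw [e', e]
      exact setIntegral_nonneg measurableSet_Ioo fun t ht => add_nonneg (hn1 t ht) (hn2 t ht)
    linarith
  rw [e', e, ofReal_integral_eq_lintegral_ofReal i2]
  · refine setLIntegral_congr_fun measurableSet_Ioo fun t ht => ?_
    simp only
    rw [ENNReal.ofReal_add (hn1 t ht) (hn2 t ht), intervalIntegral.integral_of_le ht.1.le,
      integral_Ioc_eq_integral_Ioo, ofReal_integral_eq_lintegral_ofReal
        ((intervalIntegrable_iff_integrableOn_Ioo_of_le ht.1.le).1 (hmi t ht))]
    filter_upwards [ae_restrict_mem measurableSet_Ioo] with s hs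
    exact mul_nonneg (hmn s hs.1) (by positivity)
  · filter_upwards [ae_restrict_mem measurableSet_Ioo] with t ht
    exact add_nonneg (hn1 t ht) (hn2 t ht)

/-- The energy inequality for absolutely continuous `g = 1 ∗ p`: an estimate of the integral of
`⟨(k ∗ g)', g⟩` from below, by letting `ε → 0` in `energy_shift_eq`. Convexity of `k` replaces the
weight `-k'(s)` by the difference quotient `(k(s) - k(2s)) / s`. -/
theorem energy_primitive_le [CompleteSpace H] {k : ℝ → ℝ} (hk : CompletelyMonotone k)
    (hki : LocallyIntegrableOn k (Ici 0)) (T : ℝ) {p : ℝ → H} (hp : Integrable p) :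
    0 ≤ ∫ t in Ioo 0 T, inner ℝ (conv k p t) (∫ τ in (0 : ℝ)..t, p τ) ∧
    energy T (fun t => k (T - t) + k t) (fun s => 1 / s * (k s - k (2 * s)))
      (fun t => ∫ τ in (0 : ℝ)..t, p τ) ≤
    ENNReal.ofReal (2 * ∫ t in Ioo 0 T,
      inner ℝ (conv k p t) (∫ τ in (0 : ℝ)..t, p τ)) := by
  have hgs := (continuous_primitive_of_integrable hp).stronglyMeasurable
  set g : ℝ → H := fun t => ∫ τ in (0 : ℝ)..t, p τ with hg
  have hε : ∀ j : ℕ, (0 : ℝ) < 1 / ((j : ℝ) + 1) := fun j => by positivity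
  have h0 := tendsto_one_div_add_atTop_nhds_zero_nat (𝕜 := ℝ)
  have lim : ∀ x : ℝ, 0 < x → Tendsto (fun j : ℕ => k (x + 1 / ((j : ℝ) + 1))) atTop (𝓝 (k x)) := by
    intro x hx
    have hc : ContinuousAt k x := hk.continuousOn.continuousAt (Ioi_mem_nhds hx)
    have h1 : Tendsto (fun j : ℕ => x + 1 / ((j : ℝ) + 1)) atTop (𝓝 x) := by
      simpa using tendsto_const_nhds.add h0
    exact hc.tendsto.comp h1
  have L0 := tendsto_integral_inner_conv_shift hk hki (hp.integrableOn (s := Ioo 0 T)) hgs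
    (norm_primitive_le hp)
  refine ⟨ge_of_tendsto' L0 fun j => (energy_shift_eq hk (hε j) T hp).1, ?_⟩
  have L := ENNReal.tendsto_ofReal (L0.const_mul 2)
  rw [← L.liminf_eq]
  have cont : ∀ (j : ℕ) (c : ℝ → ℝ), Continuous c → (∀ t ∈ Ioo 0 T, 0 < c t) →
      AEMeasurable (fun t => k (c t + 1 / ((j : ℝ) + 1))) (volume.restrict (Ioo 0 T)) := by
    intro j c hc hpos
    refine ContinuousOn.aemeasurable (hk.continuousOn.comp (by fun_prop) fun t ht => ?_)
      measurableSet_Ioo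
    simp only [mem_Ioi]
    linarith [hpos t ht, hε j]
  refine (energy_le_liminf
    (αs := fun j t => k (T - t + 1 / ((j : ℝ) + 1)) + k (t + 1 / ((j : ℝ) + 1)))
    (βs := fun j s => 1 / s * (k (s + 1 / ((j : ℝ) + 1)) - k (2 * s + 1 / ((j : ℝ) + 1))))
    (gs := fun _ => g) ?_ ?_ (fun _ => hgs) ?_ ?_ ?_).trans (liminf_le_liminf
      (Eventually.of_forall fun j => ?_))
  · intro j
    exact (cont j (fun t => T - t) (by fun_prop) (fun t ht => by linarith [ht.2])).add
      (cont j (fun t => t) (by fun_prop) (fun t ht => ht.1))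
  · intro j
    exact (by fun_prop : Measurable fun s : ℝ => 1 / s).aemeasurable.mul
      ((cont j (fun t => t) (by fun_prop) (fun t ht => ht.1)).sub
      (cont j (fun t => 2 * t) (by fun_prop) (fun t ht => by linarith [ht.1])))
  · exact fun t ht => (lim _ (by linarith [ht.2])).add (lim _ ht.1)
  · exact fun s hs => ((lim s hs.1).sub (lim (2 * s) (by linarith [hs.1]))).const_mul _
  · exact Eventually.of_forall fun t => tendsto_const_nhds
  · rw [← (energy_shift_eq hk (hε j) T hp).2]
    have : (fun t => k (T - t + 1 / ((j : ℝ) + 1)) + k (t + 1 / ((j : ℝ) + 1))) =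
        fun t => k (t + 1 / ((j : ℝ) + 1)) + k (T - t + 1 / ((j : ℝ) + 1)) := by
      ext t; rw [add_comm]
    rw [this]
    refine energy_mono _ fun s hs => ?_
    rw [one_div, inv_mul_le_iff₀ hs]
    exact hk.sub_le_mul_neg_deriv hs (hε j)

/-! ### Nonnegativity of the second kernel -/

/-- Maximum principle: if `k ∗ p ≥ 0` on `(0,M)` then `1 ∗ p ≥ 0` there. Testing `k ∗ p` with the
negative part `n` of `g = 1 ∗ p` gives an integral that is nonnegative by assumption, and at most
`-½ ∫ k(T-t) n(t)² dt` by the energy identity for `n`. -/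
theorem primitive_nonneg_of_conv_nonneg {k : ℝ → ℝ} (hk : CompletelyMonotone k)
    (hki : LocallyIntegrableOn k (Ici 0)) {δ : ℝ} (hδ : 0 < δ) (hkδ : 0 < k δ) {M : ℝ}
    {p : ℝ → ℝ} (hp : Integrable p)
    (hpos : ∀ᵐ t ∂(volume.restrict (Ioo 0 M)), 0 ≤ conv k p t) {t₀ : ℝ} (ht₀ : t₀ ∈ Ioo 0 M) :
    0 ≤ ∫ τ in (0 : ℝ)..t₀, p τ := by
  by_contra! hneg
  have hgc := continuous_primitive_of_integrable hp
  have hgb := norm_primitive_le hp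
  set g : ℝ → ℝ := fun t => ∫ τ in (0 : ℝ)..t, p τ with hg
  -- If the primitive is negative at `t₀`, it stays so on an interval `[t₀, T]`, chosen so short
  -- that `k(T - t + ε) ≥ k(δ) > 0` there for `ε < δ / 2`.
  obtain ⟨T, hT, hTM, hTδ, hTneg⟩ : ∃ T, t₀ < T ∧ T < M ∧ T - t₀ < δ / 2 ∧
      ∀ t ∈ Icc t₀ T, g t < 0 := by
    have ev : ∀ᶠ t in 𝓝 t₀, g t < 0 := (hgc.tendsto t₀).eventually (gt_mem_nhds hneg)
    obtain ⟨r, hr, hr'⟩ := Metric.eventually_nhds_iff.1 ev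
    refine ⟨t₀ + min (r / 2) (min (δ / 4) ((M - t₀) / 2)), ?_, ?_, ?_, ?_⟩
    · have : 0 < min (r / 2) (min (δ / 4) ((M - t₀) / 2)) :=
        lt_min (by linarith) (lt_min (by linarith) (by linarith [ht₀.2]))
      linarith
    · have := (min_le_right (r / 2) _).trans (min_le_right (δ / 4) ((M - t₀) / 2))
      linarith [ht₀.2]
    · have := (min_le_right (r / 2) _).trans (min_le_left (δ / 4) ((M - t₀) / 2))
      linarith
    · intro t ht
      refine hr' ?_
      have := min_le_left (r / 2) (min (δ / 4) ((M - t₀) / 2))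
      rw [Real.dist_eq, abs_of_nonneg (by linarith [ht.1])]
      linarith [ht.2]
  set n : ℝ → ℝ := fun t => max (-g t) 0 with hn
  have hnc : Continuous n := hgc.neg.max continuous_const
  have hn0 : ∀ t, 0 ≤ n t := fun t => le_max_right _ _
  have hnb : ∀ t, ‖n t‖ ≤ ∫ τ, ‖p τ‖ := by
    intro t
    rw [Real.norm_eq_abs, abs_of_nonneg (hn0 t)]
    refine max_le ((neg_le_abs _).trans (hgb t)) ((norm_nonneg _).trans (hgb 0))
  have hpT : IntegrableOn p (Ioo 0 T) := hp.integrableOn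
  have inn : IntegrableOn n (Ioo 0 T) :=
    hnc.continuousOn.integrableOn_Icc.mono_set Ioo_subset_Icc_self
  have ing : IntegrableOn g (Ioo 0 T) :=
    hgc.continuousOn.integrableOn_Icc.mono_set Ioo_subset_Icc_self
  set c : ℝ := ∫ t in Ioo t₀ T, k δ * n t ^ 2 with hc
  have icn : IntegrableOn (fun t => k δ * n t ^ 2) (Ioo t₀ T) :=
    (by fun_prop : Continuous fun t => k δ * n t ^ 2).continuousOn.integrableOn_Icc.mono_set
      Ioo_subset_Icc_self
  have hcpos : 0 < c := by
    rw [hc, setIntegral_pos_iff_support_of_nonneg_ae (Eventually.of_forall fun t => by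
      have := hkδ.le; simp only [Pi.zero_apply]; positivity) icn]
    have : Function.support (fun t => k δ * n t ^ 2) ∩ Ioo t₀ T = Ioo t₀ T := by
      refine inter_eq_right.2 fun t ht => ?_
      have h1 := hTneg t (Ioo_subset_Icc_self ht)
      have h2 : 0 < n t := lt_max_of_lt_left (by linarith)
      exact (mul_pos hkδ (by positivity)).ne'
    rw [this, Real.volume_Ioo]
    simpa using hT
  have key : ∀ᶠ j : ℕ in atTop, ∫ t in Ioo 0 T,
      inner ℝ (conv (fun s => k (s + 1 / ((j : ℝ) + 1))) p t) (n t) ≤ -c / 2 := by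
    filter_upwards [(tendsto_one_div_add_atTop_nhds_zero_nat (𝕜 := ℝ)).eventually
      (gt_mem_nhds (half_pos hδ))] with j hj
    have hε : (0 : ℝ) < 1 / ((j : ℝ) + 1) := by positivity
    generalize 1 / ((j : ℝ) + 1) = ε at hj hε
    have hm := hk.integrableOn_neg_deriv_shift hε T
    have hmn : ∀ s, 0 < s → 0 ≤ -deriv k (s + ε) := fun s hs => by
      linarith [hk.deriv_nonpos (t := s + ε) (by linarith)]
    obtain ⟨i1, i2, e⟩ := integral_inner_conv_self_eq (κ := fun s => k (s + ε)) hm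
      (fun t ht => by rw [hk.integral_neg_deriv_shift ht.1 hε, zero_add])
      hnc.stronglyMeasurable hnb
    have ic := integrableOn_conv (hk.integrableOn_shift hε T) hpT
    have iin : IntegrableOn (fun t => inner ℝ (conv (fun s => k (s + ε)) p t) (n t)) (Ioo 0 T) := by
      refine (ic.norm.mul_const (∫ τ, ‖p τ‖)).mono' (ic.aestronglyMeasurable.inner
        hnc.aestronglyMeasurable) (Eventually.of_forall fun t => ?_)
      exact (norm_inner_le_norm _ _).trans (mul_le_mul_of_nonneg_left (hnb t) (norm_nonneg _))
    have upper : ∫ t in Ioo 0 T, inner ℝ (conv (fun s => k (s + ε)) p t) (n t) ≤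
        ∫ t in Ioo 0 T, -(k (0 + ε) * ‖n t‖ ^ 2 -
          inner ℝ (conv (fun s => -deriv k (s + ε)) n t) (n t)) := by
      refine integral_mono_ae iin i1.neg ?_
      filter_upwards [conv_shift_eq hk hε hpT, ae_intervalIntegrable_conv hm ing,
        ae_intervalIntegrable_conv hm inn, ae_restrict_mem measurableSet_Ioo] with t h1 h2 h3 ht
      -- `-g ≤ n`, with equality where `n` does not vanish
      have h4 : -conv (fun s => -deriv k (s + ε)) g t ≤ conv (fun s => -deriv k (s + ε)) n t := by
        rw [conv, conv, ← intervalIntegral.integral_neg]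
        refine intervalIntegral.integral_mono_on_of_le_Ioo ht.1.le h2.neg h3 fun s hs => ?_
        simp only [smul_eq_mul]
        have := mul_le_mul_of_nonneg_left (le_max_left (-g s) 0) (hmn (t - s) (by linarith [hs.2]))
        linarith
      rw [h1]
      have hin : ∀ a b : ℝ, inner ℝ a b = a * b := fun a b => by simp [mul_comm]
      simp only [smul_eq_mul, zero_add, Real.norm_eq_abs, sq_abs, hin]
      have h5 : g t * n t = -(n t) ^ 2 := by
        rcases le_total (g t) 0 with h | h
        · have : n t = -g t := max_eq_left (by linarith)
          rw [this]; ring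
        · have : n t = 0 := max_eq_right (by linarith)
          rw [this]; ring
      have h6 := mul_le_mul_of_nonneg_right h4 (hn0 t)
      have h7 : (k ε * (∫ τ in (0 : ℝ)..t, p τ)) * n t = -(k ε * n t ^ 2) := by
        have : (∫ τ in (0 : ℝ)..t, p τ) = g t := rfl
        rw [this, mul_assoc, h5]; ring
      have h8 : conv (fun s => -deriv k (s + ε)) (fun t => ∫ τ in (0 : ℝ)..t, p τ) t =
          conv (fun s => -deriv k (s + ε)) g t := rfl
      rw [h8, sub_mul, h7]
      linarith
    have lower : c ≤ ∫ t in Ioo 0 T, ((k (t + ε) + k (T - t + ε)) * ‖n t‖ ^ 2 +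
        ∫ s in (0 : ℝ)..t, -deriv k (s + ε) * ‖n t - n (t - s)‖ ^ 2) := by
      have nn : ∀ t ∈ Ioo 0 T, 0 ≤ ∫ s in (0 : ℝ)..t, -deriv k (s + ε) * ‖n t - n (t - s)‖ ^ 2 := by
        intro t ht
        rw [intervalIntegral.integral_of_le ht.1.le]
        exact setIntegral_nonneg measurableSet_Ioc fun s hs =>
          mul_nonneg (hmn s hs.1) (by positivity)
      have nk : ∀ t ∈ Ioo 0 T, 0 ≤ k (t + ε) ∧ 0 ≤ k (T - t + ε) := fun t ht =>
        ⟨hk.nonneg (by linarith [ht.1]), hk.nonneg (by linarith [ht.2])⟩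
      have hsub : Ioo t₀ T ⊆ Ioo 0 T := Ioo_subset_Ioo_left ht₀.1.le
      refine (setIntegral_mono_on icn (i2.mono_set hsub) measurableSet_Ioo fun t ht => ?_).trans
        (setIntegral_mono_set i2 ?_ (Eventually.of_forall hsub))
      · have h1 : k δ ≤ k (T - t + ε) :=
          hk.antitoneOn (by simp only [mem_Ioi]; linarith [ht.2]) hδ
            (by linarith [ht.1])
        have h2 := nn t (hsub ht)
        have h3 := nk t (hsub ht)
        rw [Real.norm_eq_abs (n t), sq_abs]
        nlinarith [sq_nonneg (n t)]
      · filter_upwards [ae_restrict_mem measurableSet_Ioo] with t ht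
        have h3 := nk t ht
        exact add_nonneg (mul_nonneg (add_nonneg h3.1 h3.2) (by positivity)) (nn t ht)
    rw [integral_neg] at upper
    linarith
  have lim := tendsto_integral_inner_conv_shift hk hki hpT hnc.stronglyMeasurable hnb
  have h1 := le_of_tendsto lim key
  have h2 : 0 ≤ ∫ t in Ioo 0 T, inner ℝ (conv k p t) (n t) := by
    refine integral_nonneg_of_ae ?_
    have := ae_restrict_of_ae_restrict_of_subset (Ioo_subset_Ioo_right hTM.le) hpos
    filter_upwards [this] with t ht
    simpa [inner] using mul_nonneg (hn0 t) ht
  linarith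

/-- As `k ∗ l = 1`, the kernel `k` does not vanish identically. -/
theorem IsPCPair.exists_pos {k l : ℝ → ℝ} (h : IsPCPair k l) : ∃ δ, 0 < δ ∧ 0 < k δ := by
  by_contra! hcon
  have h0 : ∀ t, 0 < t → k t = 0 := fun t ht => le_antisymm (hcon t ht) (h.nonneg t ht)
  have h1 : ∀ᵐ t ∂(volume.restrict (Ioi (0 : ℝ))), False := by
    filter_upwards [h.conv_eq_one, ae_restrict_mem measurableSet_Ioi] with t ht ht0
    rw [conv_congr (T := t) (a' := fun _ => 0) (v' := l) ⟨le_of_lt ht0, le_rfl⟩ ?_ (ae_eq_refl _),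
      conv_const_left, zero_smul] at ht
    · exact zero_ne_one ht
    · filter_upwards [ae_restrict_mem measurableSet_Ioo] with s hs using h0 s hs.1
  rw [ae_iff] at h1
  simp at h1

/-- The primitive of `l` is nondecreasing: with `c = b - a`, the function `p = l - l(· - c)`
satisfies `k ∗ p = 1_{(0,c)} ≥ 0`. -/
theorem integral_l_nonneg {k l : ℝ → ℝ} (hkl : IsPCPair k l) (hk : CompletelyMonotone k)
    {a b : ℝ} (ha : 0 ≤ a) (hab : a < b) : 0 ≤ ∫ τ in a..b, l τ := by
  obtain ⟨δ, hδ, hkδ⟩ := hkl.exists_pos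
  set M := b + 1 with hM
  set c := b - a with hc
  have hc0 : 0 < c := sub_pos.2 hab
  set L : ℝ → ℝ := (Ioo 0 M).indicator l with hL
  have iL : Integrable L :=
    (hkl.locallyIntegrable_l.integrableOn_Ioo M).integrable_indicator measurableSet_Ioo
  have iLc : Integrable fun τ => L (τ - c) := iL.comp_sub_right c
  have ik := hkl.locallyIntegrable_k.integrableOn_Ioo M
  have one : ∀ᵐ t ∂(volume.restrict (Ioo 0 M)), conv k L t = 1 := by
    filter_upwards [ae_restrict_of_ae_restrict_of_subset Ioo_subset_Ioi_self hkl.conv_eq_one,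
      ae_restrict_mem measurableSet_Ioo] with t h1 ht
    rw [← h1]
    refine conv_congr (T := M) (Ioo_subset_Icc_self ht) (ae_eq_refl _) ?_
    filter_upwards [ae_restrict_mem measurableSet_Ioo] with s hs using indicator_of_mem hs l
  have shift : ∀ t, conv k (fun τ => L (τ - c)) t = ∫ τ in (-c)..(t - c), k (t - c - τ) * L τ := by
    intro t
    have := intervalIntegral.integral_comp_sub_right (a := 0) (b := t)
      (fun τ => k (t - c - τ) * L τ) c
    rw [zero_sub] at this
    rw [← this, conv]
    simp only [smul_eq_mul]
    congr 1
    ext τ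
    rw [show t - c - (τ - c) = t - τ by ring]
  have hLneg : ∀ τ ≤ 0, L τ = 0 := fun τ hτ => indicator_of_notMem (fun h => not_lt.2 hτ h.1) l
  have shift_le : ∀ t, 0 ≤ t → t ≤ c → conv k (fun τ => L (τ - c)) t = 0 := by
    intro t ht0 ht
    rw [shift, intervalIntegral.integral_of_le (by linarith)]
    refine setIntegral_eq_zero_of_forall_eq_zero fun τ hτ => ?_
    rw [hLneg τ (by linarith [hτ.2]), mul_zero]
  have shift_gt : ∀ t, c < t → conv k (fun τ => L (τ - c)) t = conv k L (t - c) := by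
    intro t ht
    rw [shift, conv, intervalIntegral.integral_of_le (show -c ≤ t - c by linarith),
      intervalIntegral.integral_of_le (show 0 ≤ t - c by linarith)]
    refine setIntegral_eq_of_subset_of_forall_sdiff_eq_zero measurableSet_Ioc
      (Ioc_subset_Ioc_left (by linarith)) fun τ hτ => ?_
    have : τ ≤ 0 := by
      by_contra hh
      exact hτ.2 ⟨not_le.1 hh, hτ.1.2⟩
    rw [hLneg τ this, mul_zero]
  have one' : ∀ᵐ t ∂(volume.restrict (Ioo 0 M)), c < t → conv k L (t - c) = 1 := by
    rw [ae_restrict_iff' measurableSet_Ioo] at one ⊢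
    have := (measurePreserving_sub_right volume c).quasiMeasurePreserving.ae one
    filter_upwards [this] with t ht h1 h2
    exact ht ⟨by linarith, by linarith [h1.2]⟩
  have hpos : ∀ᵐ t ∂(volume.restrict (Ioo 0 M)),
      0 ≤ conv k (fun τ => L τ - L (τ - c)) t := by
    filter_upwards [one, one', conv_sub_right ik (iL.integrableOn (s := Ioo 0 M))
      (iLc.integrableOn (s := Ioo 0 M)), ae_restrict_mem measurableSet_Ioo] with t h1 h2 h3 ht
    rw [h3, h1]
    rcases le_or_gt t c with h | h
    · rw [shift_le t ht.1.le h]; norm_num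
    · rw [shift_gt t h, h2 h]; norm_num
  have res := primitive_nonneg_of_conv_nonneg hk hkl.locallyIntegrable_k hδ hkδ (iL.sub iLc) hpos
    (t₀ := b) ⟨by linarith, by linarith⟩
  have e1 : ∫ τ in (0 : ℝ)..b, L (τ - c) = ∫ τ in (0 : ℝ)..a, L τ := by
    rw [intervalIntegral.integral_comp_sub_right (fun τ => L τ) c, zero_sub,
      show b - c = a by rw [hc]; ring,
      ← intervalIntegral.integral_add_adjacent_intervals (b := 0) iL.intervalIntegrable
        iL.intervalIntegrable, add_eq_right, intervalIntegral.integral_of_le (by linarith)]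
    exact setIntegral_eq_zero_of_forall_eq_zero fun τ hτ => hLneg τ hτ.2
  simp only [Pi.sub_apply] at res
  rw [intervalIntegral.integral_sub iL.intervalIntegrable iLc.intervalIntegrable, e1,
    intervalIntegral.integral_interval_sub_left iL.intervalIntegrable iL.intervalIntegrable] at res
  convert res using 1
  rw [intervalIntegral.integral_of_le hab.le, intervalIntegral.integral_of_le hab.le]
  refine setIntegral_congr_fun measurableSet_Ioc fun τ hτ => ?_
  exact (indicator_of_mem (show τ ∈ Ioo 0 M from
    ⟨lt_of_le_of_lt ha hτ.1, by linarith [hτ.2]⟩) l).symm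

/-- The second kernel of the pair is nonnegative, being the derivative of a nondecreasing
function. -/
theorem IsPCPair.l_nonneg {k l : ℝ → ℝ} (hkl : IsPCPair k l) (hk : CompletelyMonotone k) (M : ℝ) :
    ∀ᵐ t ∂(volume.restrict (Ioo 0 M)), 0 ≤ l t := by
  have iL : Integrable ((Ioo 0 M).indicator l) :=
    (hkl.locallyIntegrable_l.integrableOn_Ioo M).integrable_indicator measurableSet_Ioo
  rw [ae_restrict_iff' measurableSet_Ioo]
  filter_upwards [LocallyIntegrable.ae_hasDerivAt_integral iL.locallyIntegrable] with t ht htM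
  have hd := (ht 0).hasDerivWithinAt (s := Ioo 0 M)
  rw [indicator_of_mem htM] at hd
  refine hd.nonneg_of_monotoneOn ?_ ?_
  · have hn : Ioo 0 M ∈ 𝓝 t := Ioo_mem_nhds htM.1 htM.2
    rw [accPt_iff_frequently_nhdsNE]
    exact (eventually_nhdsWithin_of_eventually_nhds hn).frequently
  · intro a ha b hb hab
    rcases hab.eq_or_lt with rfl | hab
    · exact le_rfl
    rw [← sub_nonneg, intervalIntegral.integral_interval_sub_left iL.intervalIntegrable
      iL.intervalIntegrable]
    refine (integral_l_nonneg hkl hk ha.1.le hab).trans_eq ?_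
    rw [intervalIntegral.integral_of_le hab.le, intervalIntegral.integral_of_le hab.le]
    refine setIntegral_congr_fun measurableSet_Ioc fun τ hτ => ?_
    exact (indicator_of_mem (show τ ∈ Ioo 0 M from
      ⟨ha.1.trans hτ.1, lt_of_le_of_lt hτ.2 hb.2⟩) l).symm

end

section

/-! ### Existence of the resolvent kernel -/

/-- The norm of `L₁((0,M); e^{-at} dt)`. It is submultiplicative for convolution, and for large `a`
the norm of a given function is small, so that the Neumann series converges. -/
noncomputable def weightedNorm (a M : ℝ) (v : ℝ → ℝ) : ENNReal :=
  ∫⁻ t in Ioo 0 M, ‖Real.exp (-(a * t)) * v t‖ₑ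

/-- Convolution powers `l, l ∗ l, l ∗ l ∗ l, …`; the index `j` stands for `j + 1` factors. -/
noncomputable def convPow (l : ℝ → ℝ) : ℕ → ℝ → ℝ
  | 0 => l
  | j + 1 => conv l (convPow l j)

theorem exp_mul_conv (a : ℝ) (l v : ℝ → ℝ) (t : ℝ) :
    Real.exp (-(a * t)) * conv l v t =
      conv (fun s => Real.exp (-(a * s)) * l s) (fun s => Real.exp (-(a * s)) * v s) t := by
  simp only [conv, smul_eq_mul]
  rw [← intervalIntegral.integral_const_mul]
  congr 1
  ext τ
  rw [show -(a * t) = -(a * (t - τ)) + -(a * τ) by ring, Real.exp_add]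
  ring

theorem aestronglyMeasurable_exp_mul {a M : ℝ} {v : ℝ → ℝ}
    (hv : AEStronglyMeasurable v (volume.restrict (Ioo 0 M))) :
    AEStronglyMeasurable (fun t => Real.exp (-(a * t)) * v t) (volume.restrict (Ioo 0 M)) :=
  (by fun_prop : Continuous fun t : ℝ => Real.exp (-(a * t))).aestronglyMeasurable.mul hv

theorem weightedNorm_conv_le {a M : ℝ} {l v : ℝ → ℝ}
    (hl : AEStronglyMeasurable l (volume.restrict (Ioo 0 M)))
    (hv : AEStronglyMeasurable v (volume.restrict (Ioo 0 M))) :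
    weightedNorm a M (conv l v) ≤ weightedNorm a M l * weightedNorm a M v := by
  unfold weightedNorm
  simp_rw [exp_mul_conv]
  exact lintegral_enorm_conv_le (aestronglyMeasurable_exp_mul hl) (aestronglyMeasurable_exp_mul hv)

theorem exists_weightedNorm_le {M : ℝ} {l : ℝ → ℝ} (hl : IntegrableOn l (Ioo 0 M)) :
    ∃ a : ℝ, 0 ≤ a ∧ weightedNorm a M l ≤ 1 / 2 := by
  have := tendsto_lintegral_of_dominated_convergence' (μ := volume.restrict (Ioo 0 M))
    (F := fun (n : ℕ) t => ‖Real.exp (-((n : ℝ) * t)) * l t‖ₑ) (f := fun _ => 0)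
    (fun t => ‖l t‖ₑ) (fun n => (aestronglyMeasurable_exp_mul hl.aestronglyMeasurable).enorm)
    ?_ hl.2.ne ?_
  · rw [lintegral_zero] at this
    obtain ⟨n, hn⟩ := (this.eventually (ge_mem_nhds (by norm_num : (0 : ENNReal) < 1 / 2))).exists
    exact ⟨n, n.cast_nonneg, hn⟩
  · intro n
    filter_upwards [ae_restrict_mem measurableSet_Ioo] with t ht
    rw [enorm_mul]
    refine mul_le_of_le_one_left' ?_
    rw [Real.enorm_eq_ofReal (Real.exp_nonneg _), ENNReal.ofReal_le_one, Real.exp_le_one_iff]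
    have := mul_nonneg (n.cast_nonneg (α := ℝ)) ht.1.le
    linarith
  · filter_upwards [ae_restrict_mem measurableSet_Ioo] with t ht
    have h1 : Tendsto (fun n : ℕ => Real.exp (-((n : ℝ) * t))) atTop (𝓝 0) :=
      Real.tendsto_exp_neg_atTop_nhds_zero.comp
        (tendsto_natCast_atTop_atTop.atTop_mul_const ht.1)
    simpa using (h1.mul_const (l t)).enorm

theorem integrableOn_convPow {l : ℝ → ℝ} {M : ℝ} (hl : IntegrableOn l (Ioo 0 M)) (j : ℕ) :
    IntegrableOn (convPow l j) (Ioo 0 M) := by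
  induction j with
  | zero => exact hl
  | succ j ih => exact integrableOn_conv hl ih

theorem weightedNorm_convPow_le {l : ℝ → ℝ} {a M : ℝ} (hl : IntegrableOn l (Ioo 0 M))
    (ha : weightedNorm a M l ≤ 1 / 2) (j : ℕ) :
    weightedNorm a M (convPow l j) ≤ (1 / 2) ^ (j + 1) := by
  induction j with
  | zero => simpa [convPow] using ha
  | succ j ih =>
    calc weightedNorm a M (convPow l (j + 1))
        ≤ weightedNorm a M l * weightedNorm a M (convPow l j) :=
          weightedNorm_conv_le hl.aestronglyMeasurable
            (integrableOn_convPow hl j).aestronglyMeasurable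
      _ ≤ 1 / 2 * (1 / 2) ^ (j + 1) := mul_le_mul' ha ih
      _ = _ := by rw [pow_succ' _ (j + 1)]

theorem integrableOn_of_weightedNorm_ne_top {v : ℝ → ℝ} {a M : ℝ} (ha : 0 ≤ a)
    (hv : AEStronglyMeasurable v (volume.restrict (Ioo 0 M))) (h : weightedNorm a M v ≠ ⊤) :
    IntegrableOn v (Ioo 0 M) := by
  have hi : IntegrableOn (fun t => Real.exp (-(a * t)) * v t) (Ioo 0 M) :=
    ⟨aestronglyMeasurable_exp_mul hv, h.lt_top⟩
  have := Integrable.bdd_mul (f := fun t : ℝ => Real.exp (a * t)) (c := Real.exp (a * M)) hi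
    (by fun_prop : Continuous fun t : ℝ => Real.exp (a * t)).aestronglyMeasurable ?_
  · refine this.congr (Eventually.of_forall fun t => ?_)
    simp only
    rw [← mul_assoc, ← Real.exp_add, add_neg_cancel, Real.exp_zero, one_mul]
  · filter_upwards [ae_restrict_mem measurableSet_Ioo] with t ht
    rw [Real.norm_eq_abs, Real.abs_exp, Real.exp_le_exp]
    exact mul_le_mul_of_nonneg_left ht.2.le ha

theorem ae_eq_zero_of_weightedNorm_eq_zero {v : ℝ → ℝ} {a M : ℝ}
    (hv : AEStronglyMeasurable v (volume.restrict (Ioo 0 M))) (h : weightedNorm a M v = 0) :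
    ∀ᵐ t ∂(volume.restrict (Ioo 0 M)), v t = 0 := by
  rw [weightedNorm, lintegral_eq_zero_iff' (aestronglyMeasurable_exp_mul hv).enorm] at h
  filter_upwards [h] with t ht
  simpa using ht

theorem weightedNorm_add_le {u v : ℝ → ℝ} {a M : ℝ}
    (hu : AEStronglyMeasurable u (volume.restrict (Ioo 0 M))) :
    weightedNorm a M (fun t => u t + v t) ≤ weightedNorm a M u + weightedNorm a M v := by
  unfold weightedNorm
  rw [← lintegral_add_left' (aestronglyMeasurable_exp_mul hu).enorm]
  refine lintegral_mono fun t => ?_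
  rw [mul_add]
  exact enorm_add_le _ _

/-- Almost everywhere the alternating series of convolution powers converges absolutely, and its
tails are small in the weighted norm. -/
theorem summable_convPow_and_tail_le {l : ℝ → ℝ} {a M : ℝ} (hl : IntegrableOn l (Ioo 0 M))
    (ha : weightedNorm a M l ≤ 1 / 2) :
    (∀ᵐ t ∂(volume.restrict (Ioo 0 M)), Summable fun j => (-1) ^ j * convPow l j t) ∧
    ∀ J, weightedNorm a M (fun t => (∑' j, (-1) ^ j * convPow l j t) -
      ∑ j ∈ Finset.range J, (-1) ^ j * convPow l j t) ≤ (1 / 2) ^ J := by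
  have hm : ∀ j, AEMeasurable (fun t => ‖Real.exp (-(a * t)) * convPow l j t‖ₑ)
      (volume.restrict (Ioo 0 M)) := fun j =>
    (aestronglyMeasurable_exp_mul (integrableOn_convPow hl j).aestronglyMeasurable).enorm
  have tail : ∀ J, ∫⁻ t in Ioo 0 M, ∑' j, ‖Real.exp (-(a * t)) * convPow l (j + J) t‖ₑ ≤
      (1 / 2) ^ J := by
    intro J
    rw [lintegral_tsum fun j => hm (j + J)]
    calc ∑' j, ∫⁻ t in Ioo 0 M, ‖Real.exp (-(a * t)) * convPow l (j + J) t‖ₑ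
        ≤ ∑' j, (1 / 2) ^ (j + J + 1) :=
          ENNReal.tsum_le_tsum fun j => weightedNorm_convPow_le hl ha (j + J)
      _ = ∑' j : ℕ, (1 / 2) ^ (J + 1) * (1 / 2) ^ j := by
          congr 1; ext j; rw [← pow_add]; congr 1; ring
      _ = (1 / 2) ^ J := by
          rw [ENNReal.tsum_mul_left, ENNReal.tsum_geometric, pow_succ, mul_assoc,
            one_div, ENNReal.one_sub_inv_two, inv_inv, ENNReal.inv_mul_cancel (by simp) (by simp),
            mul_one]
  have sm : ∀ᵐ t ∂(volume.restrict (Ioo 0 M)), Summable fun j => (-1) ^ j * convPow l j t := by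
    have h0 := tail 0
    simp only [add_zero, pow_zero] at h0
    have hfin := ae_lt_top' (AEMeasurable.tsum hm) (h0.trans_lt ENNReal.one_lt_top).ne
    filter_upwards [hfin] with t ht
    have h1 : Summable fun j => ‖Real.exp (-(a * t)) * convPow l j t‖ := by
      have := ENNReal.summable_toReal ht.ne
      simpa using this
    have h2 : Summable fun j => ‖(-1) ^ j * convPow l j t‖ := by
      refine (h1.mul_left (Real.exp (a * t))).congr fun j => ?_
      rw [norm_mul, norm_mul, ← mul_assoc, Real.norm_eq_abs (Real.exp _), Real.abs_exp,
        ← Real.exp_add, add_neg_cancel, Real.exp_zero]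
      simp
    exact h2.of_norm
  refine ⟨sm, fun J => (lintegral_mono_ae ?_).trans (tail J)⟩
  filter_upwards [sm] with t ht
  rw [← ht.sum_add_tsum_nat_add J, add_sub_cancel_left, ← tsum_mul_left]
  refine enorm_tsum_le_tsum_enorm.trans (ENNReal.tsum_le_tsum fun j => le_of_eq ?_)
  simp [enorm_mul]

/-- Existence of the resolvent kernel with parameter one, by the Neumann series. -/
theorem exists_isResolventKernel {l : ℝ → ℝ} (hl : LocallyIntegrableOn l (Ici 0)) :
    ∃ h, IsResolventKernel 1 l h := by
  set h : ℝ → ℝ := fun t => ∑' j, (-1) ^ j * convPow l j t with hh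
  have main : ∀ M : ℝ, IntegrableOn h (Ioo 0 M) ∧
      ∀ᵐ t ∂(volume.restrict (Ioo 0 M)), h t + 1 * conv h l t = 1 * l t := by
    intro M
    have hlM := hl.integrableOn_Ioo M
    obtain ⟨a, ha0, ha⟩ := exists_weightedNorm_le hlM
    obtain ⟨sm, tail⟩ := summable_convPow_and_tail_le hlM ha
    set S : ℕ → ℝ → ℝ := fun J t => ∑ j ∈ Finset.range J, (-1) ^ j * convPow l j t with hS
    have iS : ∀ J, IntegrableOn (S J) (Ioo 0 M) := fun J =>
      integrable_finsetSum _ fun j _ => (integrableOn_convPow hlM j).const_mul _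
    have hm : AEStronglyMeasurable h (volume.restrict (Ioo 0 M)) := by
      refine aestronglyMeasurable_of_tendsto_ae atTop (fun J => (iS J).aestronglyMeasurable) ?_
      filter_upwards [sm] with t ht using ht.hasSum.tendsto_sum_nat
    have ih : IntegrableOn h (Ioo 0 M) := by
      refine integrableOn_of_weightedNorm_ne_top ha0 hm ?_
      have := tail 0
      simp only [Finset.range_zero, Finset.sum_empty, sub_zero, pow_zero] at this
      exact (this.trans_lt ENNReal.one_lt_top).ne
    refine ⟨ih, ?_⟩
    -- the partial sums satisfy `S (J + 1) + l ∗ S J = l`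
    have partialSum : ∀ J, ∀ᵐ t ∂(volume.restrict (Ioo 0 M)),
        S (J + 1) t + conv l (S J) t = l t := by
      intro J
      induction J with
      | zero =>
        refine Eventually.of_forall fun t => ?_
        simp [hS, conv, convPow]
      | succ J ihJ =>
        have e : S (J + 1) = fun t => S J t + (-1) ^ J * convPow l J t := by
          ext t; exact Finset.sum_range_succ _ _
        filter_upwards [ihJ, conv_add_right hlM (iS J)
          ((integrableOn_convPow hlM J).const_mul ((-1) ^ J))] with t h1 h2
        have h3 : conv l (fun t => (-1) ^ J * convPow l J t) t =
            (-1) ^ J * convPow l (J + 1) t := by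
          simp only [conv, convPow, smul_eq_mul]
          rw [← intervalIntegral.integral_const_mul]
          congr 1; ext τ; ring
        have h4 : S (J + 1 + 1) t = S (J + 1) t + (-1) ^ (J + 1) * convPow l (J + 1) t :=
          Finset.sum_range_succ _ _
        rw [h4, e, h2, h3, pow_succ, ← h1, e]
        ring
    -- hence the residual `h + l ∗ h - l` has arbitrarily small weighted norm
    have ires : IntegrableOn (fun t => h t + conv l h t - l t) (Ioo 0 M) :=
      (ih.add (integrableOn_conv hlM ih)).sub hlM
    have small : ∀ J : ℕ, weightedNorm a M (fun t => h t + conv l h t - l t) ≤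
        2 * (1 / 2) ^ J := by
      intro J
      have id1 : weightedNorm a M (fun t => h t + conv l h t - l t) =
          weightedNorm a M (fun t => (h t - S (J + 1) t) + conv l (fun s => h s - S J s) t) := by
        refine lintegral_congr_ae ?_
        filter_upwards [partialSum J, conv_sub_right hlM ih (iS J)] with t h1 h2
        rw [h2, ← h1]
        congr 2; ring
      rw [id1]
      calc _ ≤ weightedNorm a M (fun t => h t - S (J + 1) t) +
            weightedNorm a M (conv l (fun s => h s - S J s)) :=
            weightedNorm_add_le (ih.sub (iS _)).aestronglyMeasurable
        _ ≤ (1 / 2) ^ (J + 1) + 1 / 2 * (1 / 2) ^ J := by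
            refine add_le_add (tail (J + 1)) ((weightedNorm_conv_le hlM.aestronglyMeasurable
              (ih.sub (iS _)).aestronglyMeasurable).trans (mul_le_mul' ha (tail J)))
        _ ≤ (1 / 2) ^ J + 1 * (1 / 2) ^ J := by
            have h2 : (1 / 2 : ENNReal) ≤ 1 := by
              rw [one_div]; exact ENNReal.inv_le_one.2 one_le_two
            exact add_le_add (pow_le_pow_right_of_le_one' h2 (Nat.le_succ J))
              (mul_le_mul' h2 le_rfl)
        _ = 2 * (1 / 2) ^ J := by rw [one_mul, two_mul]
    have zero : weightedNorm a M (fun t => h t + conv l h t - l t) = 0 := by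
      have lim : Tendsto (fun J : ℕ => (2 : ENNReal) * (1 / 2) ^ J) atTop (𝓝 0) := by
        simpa using ENNReal.Tendsto.const_mul (a := (2 : ENNReal))
          (ENNReal.tendsto_pow_atTop_nhds_zero_of_lt_one (r := (1 / 2 : ENNReal)) (by norm_num))
          (Or.inr (by simp))
      exact le_antisymm (ge_of_tendsto lim (Eventually.of_forall small)) (by simp)
    filter_upwards [ae_eq_zero_of_weightedNorm_eq_zero ires.aestronglyMeasurable zero,
      ae_restrict_mem measurableSet_Ioo] with t h1 ht
    rw [conv_comm ht.1.le]
    linarith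
  refine ⟨h, ?_, ?_⟩
  · intro x hx
    refine ⟨Icc 0 (x + 1), ?_, ?_⟩
    · refine mem_nhdsWithin.2 ⟨Iio (x + 1), isOpen_Iio, by simp, fun y hy => ⟨hy.2, le_of_lt hy.1⟩⟩
    · exact (integrableOn_Icc_iff_integrableOn_Ioo (by simp) (by simp)).2 (main (x + 1)).1
  · have hall : ∀ᵐ t ∂(volume : Measure ℝ), ∀ n : ℕ, t ∈ Ioo (0 : ℝ) n →
        h t + 1 * conv h l t = 1 * l t :=
      ae_all_iff.2 fun n => (ae_restrict_iff' measurableSet_Ioo).1 (main n).2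
    rw [ae_restrict_iff' measurableSet_Ioi]
    filter_upwards [hall] with t ht ht0
    obtain ⟨n, hn⟩ := exists_nat_gt t
    exact ht n ⟨ht0, hn⟩

end

section

/-! ### The energy inequality for convolutions with `l` -/

variable {F : Type*} [NormedAddCommGroup F] [NormedSpace ℝ F]
variable {H : Type*} [NormedAddCommGroup H] [InnerProductSpace ℝ H]

theorem eLpNorm_two_sq {α E : Type*} [MeasurableSpace α] [NormedAddCommGroup E] (f : α → E)
    (μ : Measure α) : eLpNorm f 2 μ ^ 2 = ∫⁻ x, ‖f x‖ₑ ^ 2 ∂μ := by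
  have h := eLpNorm_nnreal_pow_eq_lintegral (f := f) (μ := μ) (p := 2) (by norm_num)
  simpa using h

theorem eLpNorm_conv_le {T : ℝ} {a : ℝ → ℝ} {v : ℝ → F}
    (ha : AEStronglyMeasurable a (volume.restrict (Ioo 0 T)))
    (hv : AEStronglyMeasurable v (volume.restrict (Ioo 0 T))) :
    eLpNorm (conv a v) 2 (volume.restrict (Ioo 0 T)) ≤
      (∫⁻ t in Ioo 0 T, ‖a t‖ₑ) * eLpNorm v 2 (volume.restrict (Ioo 0 T)) := by
  have h := lintegral_enorm_conv_sq_le ha hv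
  rw [← eLpNorm_two_sq, ← eLpNorm_two_sq, ← mul_pow] at h
  exact (ENNReal.pow_le_pow_left_iff two_ne_zero).1 h

theorem memLp_conv {T : ℝ} {a : ℝ → ℝ} {v : ℝ → F} (ha : IntegrableOn a (Ioo 0 T))
    (hv : MemLp v 2 (volume.restrict (Ioo 0 T))) :
    MemLp (conv a v) 2 (volume.restrict (Ioo 0 T)) :=
  ⟨(integrableOn_conv ha (hv.integrable (by norm_num))).aestronglyMeasurable,
    (eLpNorm_conv_le ha.aestronglyMeasurable hv.1).trans_lt (ENNReal.mul_lt_top ha.2 hv.2)⟩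

theorem conv_smul_const [CompleteSpace F] (k l : ℝ → ℝ) (c : F) (t : ℝ) :
    conv k (fun τ => l τ • c) t = conv k l t • c := by
  simp only [conv]
  rw [← intervalIntegral.integral_smul_const]
  simp only [smul_smul, smul_eq_mul]

/-- For smooth `G` the function `l ∗ G` is absolutely continuous, with derivative
`p = G(0) l + l ∗ G'`, and `k ∗ p = G`. -/
theorem exists_primitive_of_contDiff [CompleteSpace F] {k l : ℝ → ℝ} (hkl : IsPCPair k l) (T : ℝ)
    {G : ℝ → F} (hG : ContDiff ℝ ∞ G) :
    ∃ p : ℝ → F, Integrable p ∧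
      (∀ᵐ t ∂(volume.restrict (Ioo 0 T)), conv k p t = G t) ∧
      ∀ᵐ t ∂(volume.restrict (Ioo 0 T)), ∫ τ in (0 : ℝ)..t, p τ = conv l G t := by
  have ik := hkl.locallyIntegrable_k.integrableOn_Ioo T
  have il := hkl.locallyIntegrable_l.integrableOn_Ioo T
  have i1 : IntegrableOn (fun _ : ℝ => (1 : ℝ)) (Ioo 0 T) := by simp
  have cG' : Continuous (deriv G) := hG.continuous_deriv (by simp)
  have iG' : IntegrableOn (deriv G) (Ioo 0 T) :=
    cG'.continuousOn.integrableOn_Icc.mono_set Ioo_subset_Icc_self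
  have iconst : IntegrableOn (fun _ : ℝ => G 0) (Ioo 0 T) := by simp
  have ftc : ∀ t, G t = G 0 + conv (fun _ => 1) (deriv G) t := by
    intro t
    rw [conv_one_left, intervalIntegral.integral_deriv_eq_sub
      (fun x _ => hG.differentiable (by simp) x) (cG'.intervalIntegrable _ _)]
    abel
  set q : ℝ → F := fun τ => l τ • G 0 + conv l (deriv G) τ with hq
  have ilc := integrableOn_conv il iG'
  have ils : IntegrableOn (fun τ => l τ • G 0) (Ioo 0 T) := il.smul_const _
  have iq : IntegrableOn q (Ioo 0 T) := ils.add ilc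
  have hpq : (Ioo 0 T).indicator q =ᵐ[volume.restrict (Ioo 0 T)] q := by
    filter_upwards [ae_restrict_mem measurableSet_Ioo] with t ht using indicator_of_mem ht q
  refine ⟨(Ioo 0 T).indicator q, iq.integrable_indicator measurableSet_Ioo, ?_, ?_⟩
  · have one := ae_restrict_of_ae_restrict_of_subset (Ioo_subset_Ioi_self : Ioo 0 T ⊆ Ioi 0)
      hkl.conv_eq_one
    filter_upwards [ae_restrict_mem measurableSet_Ioo, one, conv_add_right ik ils ilc,
      conv_assoc ik il iG'] with t ht h1 h2 h3
    rw [conv_congr (Ioo_subset_Icc_self ht) (ae_eq_refl k) hpq, h2, conv_smul_const, h1, ← h3,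
      conv_congr (Ioo_subset_Icc_self ht) one (ae_eq_refl (deriv G)), one_smul, ← ftc]
  · filter_upwards [ae_restrict_mem measurableSet_Ioo, conv_add_right il iconst
      (integrableOn_conv i1 iG'), conv_assoc il i1 iG', conv_assoc i1 il iG'] with t ht h1 h2 h3
    have hcomm : conv l (fun _ => 1) =ᵐ[volume.restrict (Ioo 0 T)] conv (fun _ => 1) l := by
      filter_upwards [ae_restrict_mem measurableSet_Ioo] with s hs using conv_comm hs.1.le _ _
    have e : (fun τ => G 0 + conv (fun _ => 1) (deriv G) τ) = G := by
      ext τ; exact (ftc τ).symm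
    rw [e] at h1
    rw [← conv_one_left, conv_congr (Ioo_subset_Icc_self ht) (ae_eq_refl (fun _ => (1 : ℝ))) hpq,
      h1, ← h2, conv_congr (Ioo_subset_Icc_self ht) hcomm (ae_eq_refl _), h3, conv_const_right,
      conv_one_left, conv_one_left, ← intervalIntegral.integral_smul_const]
    have sub : Ioo 0 t ⊆ Ioo 0 T := Ioo_subset_Ioo_right ht.2.le
    refine intervalIntegral.integral_add ?_ ?_
    · exact (intervalIntegrable_iff_integrableOn_Ioo_of_le ht.1.le).2 (ils.mono_set sub)
    · exact (intervalIntegrable_iff_integrableOn_Ioo_of_le ht.1.le).2 (ilc.mono_set sub)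

theorem tendsto_integral_inner_of_eLpNorm {α : Type*} [MeasurableSpace α] {μ : Measure α}
    {f g : α → H} {fs gs : ℕ → α → H} (hf : MemLp f 2 μ) (hg : MemLp g 2 μ)
    (hfs : ∀ j, MemLp (fs j) 2 μ) (hgs : ∀ j, MemLp (gs j) 2 μ)
    (hfl : Tendsto (fun j => eLpNorm (fs j - f) 2 μ) atTop (𝓝 0))
    (hgl : Tendsto (fun j => eLpNorm (gs j - g) 2 μ) atTop (𝓝 0)) :
    Tendsto (fun j => ∫ x, inner ℝ (fs j x) (gs j x) ∂μ) atTop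
      (𝓝 (∫ x, inner ℝ (f x) (g x) ∂μ)) := by
  have e : ∀ (u v : α → H) (hu : MemLp u 2 μ) (hv : MemLp v 2 μ),
      ∫ x, inner ℝ (u x) (v x) ∂μ = inner ℝ (hu.toLp u) (hv.toLp v) := by
    intro u v hu hv
    rw [L2.inner_def]
    refine integral_congr_ae ?_
    filter_upwards [hu.coeFn_toLp, hv.coeFn_toLp] with x h1 h2
    rw [h1, h2]
  rw [e f g hf hg]
  simp_rw [fun j => e (fs j) (gs j) (hfs j) (hgs j)]
  exact ((Lp.tendsto_Lp_iff_tendsto_eLpNorm'' fs hfs f hf).2 hfl).inner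
    ((Lp.tendsto_Lp_iff_tendsto_eLpNorm'' gs hgs g hg).2 hgl)

/-- The weights of the energy are only known to be measurable on `(0,T)`: nothing is assumed of `k`
on `(-∞, 0]`. -/
theorem aemeasurable_energy_weights {k : ℝ → ℝ} (hk : CompletelyMonotone k) (T : ℝ) :
    AEMeasurable (fun t => k (T - t) + k t) (volume.restrict (Ioo 0 T)) ∧
    AEMeasurable (fun s => 1 / s * (k s - k (2 * s))) (volume.restrict (Ioo 0 T)) := by
  have cont : ∀ (c : ℝ → ℝ), Continuous c → (∀ t ∈ Ioo 0 T, 0 < c t) →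
      AEMeasurable (fun t => k (c t)) (volume.restrict (Ioo 0 T)) := fun c hc hpos =>
    ContinuousOn.aemeasurable (hk.continuousOn.comp hc.continuousOn hpos) measurableSet_Ioo
  exact ⟨(cont (fun t => T - t) (by fun_prop) (fun t ht => by linarith [ht.2])).add
      (cont (fun t => t) (by fun_prop) (fun t ht => ht.1)),
    (by fun_prop : Measurable fun s : ℝ => 1 / s).aemeasurable.mul
      ((cont (fun t => t) (by fun_prop) (fun t ht => ht.1)).sub
      (cont (fun t => 2 * t) (by fun_prop) (fun t ht => by linarith [ht.1])))⟩

/-- The energy inequality for `y = l ∗ G`, formally the solution of `(k ∗ y)' = G`. Smooth `G` are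
covered by `energy_primitive_le`; the general case follows by density and Fatou's lemma. -/
theorem energy_conv_le [CompleteSpace H] {k l : ℝ → ℝ} (hkl : IsPCPair k l)
    (hk : CompletelyMonotone k) (T : ℝ)
    {G : ℝ → H} (hG : MemLp G 2 (volume.restrict (Ioo 0 T))) :
    0 ≤ ∫ t in Ioo 0 T, inner ℝ (G t) (conv l G t) ∧
    energy T (fun t => k (T - t) + k t) (fun s => 1 / s * (k s - k (2 * s))) (conv l G) ≤
      ENNReal.ofReal (2 * ∫ t in Ioo 0 T, inner ℝ (G t) (conv l G t)) := by
  set μ := volume.restrict (Ioo (0 : ℝ) T) with hμ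
  have il := hkl.locallyIntegrable_l.integrableOn_Ioo T
  have approx : ∀ j : ℕ, ∃ g : ℝ → H, HasCompactSupport g ∧ ContDiff ℝ ∞ g ∧
      eLpNorm (G - g) 2 μ ≤ ENNReal.ofReal (1 / ((j : ℝ) + 1)) := fun j =>
    hG.exist_eLpNorm_sub_le (by norm_num) (by norm_num) (by positivity)
  choose Gs hc hs hle using approx
  have hGs : ∀ j, MemLp (Gs j) 2 μ := fun j => (hs j).continuous.memLp_of_hasCompactSupport (hc j)
  have lim0 : Tendsto (fun j : ℕ => ENNReal.ofReal (1 / ((j : ℝ) + 1))) atTop (𝓝 0) := by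
    simpa using ENNReal.tendsto_ofReal (tendsto_one_div_add_atTop_nhds_zero_nat (𝕜 := ℝ))
  have limG : Tendsto (fun j => eLpNorm (Gs j - G) 2 μ) atTop (𝓝 0) := by
    refine tendsto_of_tendsto_of_tendsto_of_le_of_le tendsto_const_nhds lim0
      (fun _ => zero_le) fun j => ?_
    show eLpNorm (Gs j - G) 2 μ ≤ _
    rw [eLpNorm_sub_comm]
    exact hle j
  have hcG := memLp_conv il hG
  have hcGs := fun j => memLp_conv il (hGs j)
  have limc : Tendsto (fun j => eLpNorm (conv l (Gs j) - conv l G) 2 μ) atTop (𝓝 0) := by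
    have lim1 := ENNReal.Tendsto.const_mul (a := ∫⁻ t in Ioo 0 T, ‖l t‖ₑ) limG
      (Or.inr il.2.ne)
    rw [mul_zero] at lim1
    refine tendsto_of_tendsto_of_tendsto_of_le_of_le tendsto_const_nhds lim1
      (fun _ => zero_le) fun j => ?_
    have e : conv l (Gs j) - conv l G =ᵐ[μ] conv l (Gs j - G) := by
      filter_upwards [conv_sub_right il ((hGs j).integrable (by norm_num))
        (hG.integrable (by norm_num))] with t ht using ht.symm
    show eLpNorm (conv l (Gs j) - conv l G) 2 μ ≤ _
    rw [eLpNorm_congr_ae e]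
    exact eLpNorm_conv_le il.aestronglyMeasurable ((hGs j).sub hG).1
  choose p hp hkp hlp using fun j => exists_primitive_of_contDiff hkl T (hs j)
  have I : ∀ j, ∫ t in Ioo 0 T, inner ℝ (conv k (p j) t) (∫ τ in (0 : ℝ)..t, p j τ) =
      ∫ t in Ioo 0 T, inner ℝ (Gs j t) (conv l (Gs j) t) := by
    intro j
    refine integral_congr_ae ?_
    filter_upwards [hkp j, hlp j] with t h1 h2
    rw [h1, h2]
  have limI := tendsto_integral_inner_of_eLpNorm hG hcG hGs hcGs limG limc
  have core := fun j => energy_primitive_le hk hkl.locallyIntegrable_k T (hp j)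
  simp_rw [I] at core
  refine ⟨ge_of_tendsto' limI fun j => (core j).1, ?_⟩
  obtain ⟨ns, hns, hae⟩ := (tendstoInMeasure_of_tendsto_eLpNorm (by norm_num)
    (fun j => (hcGs j).1) hcG.1 limc).exists_seq_tendsto_ae
  have limI' := ENNReal.tendsto_ofReal ((limI.comp hns.tendsto_atTop).const_mul 2)
  rw [← limI'.liminf_eq]
  obtain ⟨m1, m2⟩ := aemeasurable_energy_weights hk T
  refine (energy_le_liminf (αs := fun _ t => k (T - t) + k t)
    (βs := fun _ s => 1 / s * (k s - k (2 * s)))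
    (gs := fun j t => ∫ τ in (0 : ℝ)..t, p (ns j) τ) ?_ ?_ ?_ ?_ ?_ ?_).trans (liminf_le_liminf
      (Eventually.of_forall fun j => (core (ns j)).2))
  · exact fun _ => m1
  · exact fun _ => m2
  · exact fun j => (continuous_primitive_of_integrable (hp (ns j))).stronglyMeasurable
  · exact fun _ _ => tendsto_const_nhds
  · exact fun _ _ => tendsto_const_nhds
  · filter_upwards [hae, ae_all_iff.2 fun j => hlp (ns j)] with t h1 h2
    simp_rw [h2]
    exact h1

/-! ### Time reversal -/

theorem dualConv_eq_conv (T : ℝ) (l : ℝ → ℝ) (g : ℝ → F) (t : ℝ) :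
    dualConv T l g t = conv l (fun τ => g (T - τ)) (T - t) := by
  have := intervalIntegral.integral_comp_sub_left (a := 0) (b := T - t)
    (fun x => l (x - t) • g x) T
  simp only [sub_sub_cancel, sub_zero] at this
  rw [dualConv, conv, ← this]
  congr 1
  ext τ
  rw [show T - t - τ = T - τ - t by ring]

theorem measurePreserving_reflect (T : ℝ) :
    MeasurePreserving (fun t => T - t) (volume.restrict (Ioo 0 T)) (volume.restrict (Ioo 0 T)) := by
  have h := (Measure.measurePreserving_sub_left volume T).restrict_preimage
    (measurableSet_Ioo (a := (0 : ℝ)) (b := T))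
  have e : (fun t => T - t) ⁻¹' Ioo 0 T = Ioo 0 T := by
    ext t
    simp only [mem_preimage, mem_Ioo]
    constructor <;> rintro ⟨h1, h2⟩ <;> constructor <;> linarith
  rwa [e] at h

theorem ae_comp_sub {T t : ℝ} (ht : t ∈ Ioo 0 T) {P : ℝ → Prop}
    (h : ∀ᵐ τ ∂(volume.restrict (Ioo 0 T)), P τ) :
    ∀ᵐ s ∂(volume.restrict (Ioo 0 t)), P (t - s) := by
  rw [ae_restrict_iff' measurableSet_Ioo] at h ⊢
  filter_upwards [(quasiMeasurePreserving_sub_left_of_right_invariant volume t).ae h] with s hs hs'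
  exact hs ⟨by linarith [hs'.2], by linarith [hs'.1, ht.2]⟩

theorem energy_congr {E : Type*} [NormedAddCommGroup E] {T : ℝ} (α β : ℝ → ℝ) {g g' : ℝ → E}
    (h : g =ᵐ[volume.restrict (Ioo 0 T)] g') : energy T α β g = energy T α β g' := by
  refine lintegral_congr_ae ?_
  filter_upwards [h, ae_restrict_mem measurableSet_Ioo] with t h1 ht
  have h2 : ∫⁻ s in Ioo 0 t, ENNReal.ofReal (β s * ‖g t - g (t - s)‖ ^ 2) =
      ∫⁻ s in Ioo 0 t, ENNReal.ofReal (β s * ‖g' t - g' (t - s)‖ ^ 2) := by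
    refine lintegral_congr_ae ?_
    filter_upwards [ae_comp_sub ht h] with s hs
    rw [h1, hs]
  rw [h2, h1]

/-- The double integral in the energy as an integral in `s` of an integral in `t`. -/
theorem lintegral_increment_eq {E : Type*} [NormedAddCommGroup E] {T : ℝ} {β : ℝ → ℝ} {g : ℝ → E}
    (hβ : AEMeasurable β (volume.restrict (Ioo 0 T))) (hg : StronglyMeasurable g) :
    ∫⁻ t in Ioo 0 T, ∫⁻ s in Ioo 0 t, ENNReal.ofReal (β s * ‖g t - g (t - s)‖ ^ 2) =
    ∫⁻ s in Ioo 0 T, ∫⁻ t, (Ioo s T).indicator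
      (fun t => ENNReal.ofReal (β s * ‖g t - g (t - s)‖ ^ 2)) t := by
  have hset : MeasurableSet {p : ℝ × ℝ | p.2 ∈ Ioo p.1 T} :=
    (measurableSet_lt measurable_fst measurable_snd).inter
      (measurableSet_lt measurable_snd measurable_const)
  have m1 : AEMeasurable (fun p : ℝ × ℝ => {p : ℝ × ℝ | p.2 ∈ Ioo p.1 T}.indicator
      (fun p : ℝ × ℝ => ENNReal.ofReal (β p.1 * ‖g p.2 - g (p.2 - p.1)‖ ^ 2)) p)
      ((volume.restrict (Ioo 0 T)).prod volume) := by
    refine AEMeasurable.indicator ?_ hset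
    refine AEMeasurable.ennreal_ofReal ((hβ.comp_fst).mul ?_)
    have : StronglyMeasurable fun p : ℝ × ℝ => g p.2 - g (p.2 - p.1) :=
      (hg.comp_measurable measurable_snd).sub
        (hg.comp_measurable (measurable_snd.sub measurable_fst))
    exact (this.norm.measurable.pow_const 2).aemeasurable
  have swap := lintegral_lintegral_swap
    (f := fun s t => {p : ℝ × ℝ | p.2 ∈ Ioo p.1 T}.indicator
      (fun p : ℝ × ℝ => ENNReal.ofReal (β p.1 * ‖g p.2 - g (p.2 - p.1)‖ ^ 2)) (s, t)) m1
  have e1 : ∀ s t, {p : ℝ × ℝ | p.2 ∈ Ioo p.1 T}.indicator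
      (fun p : ℝ × ℝ => ENNReal.ofReal (β p.1 * ‖g p.2 - g (p.2 - p.1)‖ ^ 2)) (s, t) =
      (Ioo s T).indicator (fun t => ENNReal.ofReal (β s * ‖g t - g (t - s)‖ ^ 2)) t :=
    fun s t => rfl
  simp_rw [e1] at swap
  rw [swap, ← lintegral_indicator measurableSet_Ioo]
  congr 1
  ext t
  rw [← lintegral_indicator measurableSet_Ioo]
  by_cases ht : t ∈ Ioo 0 T
  · rw [indicator_of_mem ht, ← lintegral_indicator measurableSet_Ioo]
    congr 1
    ext s
    by_cases hs : s ∈ Ioo 0 t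
    · rw [indicator_of_mem hs, indicator_of_mem (show s ∈ Ioo 0 T from ⟨hs.1, hs.2.trans ht.2⟩),
        indicator_of_mem (show t ∈ Ioo s T from ⟨hs.2, ht.2⟩)]
    · rw [indicator_of_notMem hs]
      by_cases h2 : s ∈ Ioo 0 T
      · rw [indicator_of_mem h2, indicator_of_notMem]
        exact fun h => hs ⟨h2.1, h.1⟩
      · rw [indicator_of_notMem h2]
  · rw [indicator_of_notMem ht]
    refine (lintegral_eq_zero_of_ae_eq_zero (Eventually.of_forall fun s => ?_)).symm
    by_cases h2 : s ∈ Ioo 0 T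
    · rw [indicator_of_mem h2, indicator_of_notMem]
      · rfl
      · exact fun h => ht ⟨h2.1.trans h.1, h.2⟩
    · rw [indicator_of_notMem h2]; rfl

theorem energy_eq_add {E : Type*} [NormedAddCommGroup E] {T : ℝ} {α β : ℝ → ℝ} {g : ℝ → E}
    (hα : AEMeasurable α (volume.restrict (Ioo 0 T))) (hg : StronglyMeasurable g) :
    energy T α β g = (∫⁻ t in Ioo 0 T, ENNReal.ofReal (α t * ‖g t‖ ^ 2)) +
      ∫⁻ t in Ioo 0 T, ∫⁻ s in Ioo 0 t, ENNReal.ofReal (β s * ‖g t - g (t - s)‖ ^ 2) :=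
  lintegral_add_left' (hα.mul (hg.norm.measurable.pow_const 2).aemeasurable).ennreal_ofReal _

/-- The energy is invariant under time reversal. -/
theorem energy_reflect {E : Type*} [NormedAddCommGroup E] {T : ℝ} {α β : ℝ → ℝ} {g : ℝ → E}
    (hα : AEMeasurable α (volume.restrict (Ioo 0 T))) (hαs : ∀ t, α (T - t) = α t)
    (hβ : AEMeasurable β (volume.restrict (Ioo 0 T)))
    (hg : AEStronglyMeasurable g (volume.restrict (Ioo 0 T))) :
    energy T α β (fun t => g (T - t)) = energy T α β g := by
  obtain ⟨g', hg', hgg⟩ := hg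
  have hr : (fun t => g (T - t)) =ᵐ[volume.restrict (Ioo 0 T)] fun t => g' (T - t) :=
    (measurePreserving_reflect T).quasiMeasurePreserving.ae_eq_comp hgg
  rw [energy_congr α β hgg, energy_congr α β hr]
  have hg'' : StronglyMeasurable fun t => g' (T - t) := hg'.comp_measurable (by fun_prop)
  rw [energy_eq_add hα hg', energy_eq_add hα hg'', lintegral_increment_eq hβ hg',
    lintegral_increment_eq hβ hg'']
  congr 1
  · have hm : MeasurableEmbedding fun t : ℝ => T - t :=
      (Homeomorph.subLeft T).measurableEmbedding
    rw [← (measurePreserving_reflect T).lintegral_comp_emb hm]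
    simp_rw [hαs, sub_sub_cancel]
  · -- for fixed `s`, the substitution `t ↦ T + s - t` exchanges the two end points of an increment
    refine lintegral_congr fun s => ?_
    rw [← lintegral_sub_left_eq_self _ (T + s)]
    refine lintegral_congr fun t => ?_
    by_cases ht : t ∈ Ioo s T
    · rw [indicator_of_mem ht, indicator_of_mem]
      · rw [show T - (T + s - t) = t - s by ring, show T - (T + s - t - s) = t by ring,
          norm_sub_rev]
      · exact ⟨by linarith [ht.2], by linarith [ht.1]⟩
    · rw [indicator_of_notMem ht, indicator_of_notMem]
      exact fun h => ht ⟨by linarith [h.2], by linarith [h.1]⟩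

theorem dualConv_eq_integral {T t : ℝ} (ht : t ∈ Ioo 0 T) (l : ℝ → ℝ) (v : ℝ → F) :
    dualConv T l v t = ∫ τ, (Ioo 0 T).indicator l (τ - t) • (Ioo 0 T).indicator v τ := by
  rw [dualConv, intervalIntegral.integral_of_le ht.2.le, integral_Ioc_eq_integral_Ioo,
    ← integral_indicator measurableSet_Ioo]
  congr 1
  ext τ
  by_cases h : τ ∈ Ioo t T
  · rw [indicator_of_mem h, indicator_of_mem (show τ ∈ Ioo 0 T from ⟨ht.1.trans h.1, h.2⟩),
      indicator_of_mem (show τ - t ∈ Ioo 0 T from ⟨by linarith [h.1], by linarith [h.2, ht.1]⟩)]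
  · rw [indicator_of_notMem h]
    by_cases h2 : τ ∈ Ioo 0 T
    · rw [indicator_of_notMem, zero_smul]
      exact fun h3 => h ⟨by linarith [h3.1], h2.2⟩
    · rw [indicator_of_notMem h2, smul_zero]

/-- The dual convolution is the adjoint of the convolution in `L₂(0,T)`. -/
theorem integral_inner_conv_eq [CompleteSpace H] {T : ℝ} {l : ℝ → ℝ} {u v : ℝ → H}
    (hl : IntegrableOn l (Ioo 0 T)) (hu : MemLp u 2 (volume.restrict (Ioo 0 T)))
    (hv : MemLp v 2 (volume.restrict (Ioo 0 T))) :
    ∫ t in Ioo 0 T, inner ℝ (conv l u t) (v t) =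
      ∫ t in Ioo 0 T, inner ℝ (u t) (dualConv T l v t) := by
  set L := (Ioo 0 T).indicator l with hL
  set U := (Ioo 0 T).indicator u with hU
  set V := (Ioo 0 T).indicator v with hV
  have iL : Integrable L := hl.integrable_indicator measurableSet_Ioo
  have iU : Integrable U :=
    IntegrableOn.integrable_indicator (hu.integrable (by norm_num)) measurableSet_Ioo
  have iV : Integrable V :=
    IntegrableOn.integrable_indicator (hv.integrable (by norm_num)) measurableSet_Ioo
  have iLn : Integrable fun s => L (-s) := iL.comp_neg
  have mU : MemLp U 2 volume := (memLp_indicator_iff_restrict measurableSet_Ioo).2 hu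
  have mV : MemLp V 2 volume := (memLp_indicator_iff_restrict measurableSet_Ioo).2 hv
  have iU2 : Integrable fun s => ‖U s‖ ^ 2 := mU.integrable_norm_pow (by norm_num)
  have iV2 : Integrable fun s => ‖V s‖ ^ 2 := mV.integrable_norm_pow (by norm_num)
  -- The integrand of the double integral is dominated by `|L(t-τ)| (|U(τ)|² + |V(t)|²)`.
  have b1 : Integrable (fun p : ℝ × ℝ => ‖U p.2‖ ^ 2 * ‖L (p.1 - p.2)‖) (volume.prod volume) :=
    iU2.convolution_integrand (ContinuousLinearMap.mul ℝ ℝ) iL.norm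
  have b2 : Integrable (fun p : ℝ × ℝ => ‖V p.1‖ ^ 2 * ‖L (p.1 - p.2)‖) (volume.prod volume) := by
    have := (iV2.convolution_integrand (μ := volume) (ContinuousLinearMap.mul ℝ ℝ) iLn.norm).swap
    refine this.congr (Eventually.of_forall fun p => ?_)
    simp
  have iK : Integrable (fun p : ℝ × ℝ => L (p.1 - p.2) * inner ℝ (U p.2) (V p.1))
      (volume.prod volume) := by
    refine (b1.add b2).mono' ?_ (Eventually.of_forall fun p => ?_)
    · exact (iL.aestronglyMeasurable.comp_quasiMeasurePreserving
        (quasiMeasurePreserving_sub_of_right_invariant volume volume)).mul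
        (iU.aestronglyMeasurable.comp_snd.inner iV.aestronglyMeasurable.comp_fst)
    · rw [norm_mul, Pi.add_apply, ← add_mul, mul_comm]
      refine mul_le_mul_of_nonneg_right ?_ (norm_nonneg _)
      have := norm_inner_le_norm (𝕜 := ℝ) (U p.2) (V p.1)
      nlinarith [sq_nonneg (‖U p.2‖ - ‖V p.1‖), sq_nonneg ‖U p.2‖, sq_nonneg ‖V p.1‖]
  have ex1 := Integrable.ae_convolution_exists (μ := volume) (ν := volume)
    (ContinuousLinearMap.lsmul ℝ ℝ (E := H)).flip iU iL
  have ex2 := Integrable.ae_convolution_exists (μ := volume) (ν := volume)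
    (ContinuousLinearMap.lsmul ℝ ℝ (E := H)).flip iV iLn
  have lhs : ∫ t in Ioo 0 T, inner ℝ (conv l u t) (v t) =
      ∫ t, ∫ τ, L (t - τ) * inner ℝ (U τ) (V t) := by
    rw [← integral_indicator measurableSet_Ioo]
    refine integral_congr_ae ?_
    filter_upwards [ex1] with t h1
    have h1' : Integrable fun τ => L (t - τ) • U τ := h1
    by_cases ht : t ∈ Ioo 0 T
    · rw [indicator_of_mem ht, conv_eq_convolution (Ioo_subset_Icc_self ht),
        convolution_lsmul_swap, real_inner_comm, ← integral_inner h1']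
      refine integral_congr_ae (Eventually.of_forall fun τ => ?_)
      simp only
      rw [inner_smul_right, real_inner_comm, hV, indicator_of_mem ht]
    · rw [indicator_of_notMem ht, hV, indicator_of_notMem ht]
      simp
  have rhs : ∫ t in Ioo 0 T, inner ℝ (u t) (dualConv T l v t) =
      ∫ τ, ∫ t, L (t - τ) * inner ℝ (U τ) (V t) := by
    rw [← integral_indicator measurableSet_Ioo]
    refine integral_congr_ae ?_
    filter_upwards [ex2] with τ h1
    have h1' : Integrable fun t => L (t - τ) • V t := by
      refine Integrable.congr h1 (Eventually.of_forall fun t => ?_)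
      simp
    by_cases hτ : τ ∈ Ioo 0 T
    · rw [indicator_of_mem hτ, dualConv_eq_integral hτ, ← integral_inner h1']
      refine integral_congr_ae (Eventually.of_forall fun t => ?_)
      simp only
      rw [inner_smul_right, hU, indicator_of_mem hτ]
    · rw [indicator_of_notMem hτ, hU, indicator_of_notMem hτ]
      simp
  rw [lhs, rhs]
  exact integral_integral_swap iK

/-- The energy inequality for the dual convolution `l ∗ᵀ D`, by time reversal. By duality its
right-hand side can be written with the convolution `l ∗ D`. -/
theorem energy_dualConv_le [CompleteSpace H] {k l : ℝ → ℝ} (hkl : IsPCPair k l)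
    (hk : CompletelyMonotone k) (T : ℝ)
    {D : ℝ → H} (hD : MemLp D 2 (volume.restrict (Ioo 0 T))) :
    0 ≤ ∫ t in Ioo 0 T, inner ℝ (conv l D t) (D t) ∧
    energy T (fun t => k (T - t) + k t) (fun s => 1 / s * (k s - k (2 * s))) (dualConv T l D) ≤
      ENNReal.ofReal (2 * ∫ t in Ioo 0 T, inner ℝ (conv l D t) (D t)) := by
  have il := hkl.locallyIntegrable_l.integrableOn_Ioo T
  have hr := measurePreserving_reflect T
  have hG : MemLp (fun τ => D (T - τ)) 2 (volume.restrict (Ioo 0 T)) :=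
    hD.comp_measurePreserving hr
  have e : dualConv T l D = fun t => conv l (fun τ => D (T - τ)) (T - t) :=
    funext fun t => dualConv_eq_conv T l D t
  have hm : MeasurableEmbedding fun t : ℝ => T - t :=
    (Homeomorph.subLeft T).measurableEmbedding
  have eI : ∫ t in Ioo 0 T, inner ℝ (conv l D t) (D t) =
      ∫ t in Ioo 0 T, inner ℝ (D (T - t)) (conv l (fun τ => D (T - τ)) t) := by
    rw [integral_inner_conv_eq il hD hD, e, ← hr.integral_comp hm]
    simp only [sub_sub_cancel]
  obtain ⟨m1, m2⟩ := aemeasurable_energy_weights hk T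
  rw [eI, e, energy_reflect m1 (fun t => by rw [sub_sub_cancel, add_comm]) m2
    (memLp_conv il hG).1]
  exact energy_conv_le hkl hk T hG

end

section

/-! ### Convolution in time of space-time functions -/

variable {F : Type*} [NormedAddCommGroup F] [NormedSpace ℝ F]
variable {α : Type*} [MeasurableSpace α] {ν : Measure α} [SFinite ν]

theorem ae_ae_swap_of_ae_prod {μ : Measure ℝ} [SFinite μ] {P : ℝ × α → Prop}
    (h : ∀ᵐ p ∂(μ.prod ν), P p) : ∀ᵐ x ∂ν, ∀ᵐ t ∂μ, P (t, x) :=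
  Measure.ae_ae_of_ae_prod (p := fun p : α × ℝ => P p.swap)
    (Measure.measurePreserving_swap.quasiMeasurePreserving.ae h)

theorem ae_prod_eq_of_ae_ae {E : Type*} [NormedAddCommGroup E] {μ : Measure ℝ} [SFinite μ]
    {f g : ℝ × α → E} (hf : AEStronglyMeasurable f (μ.prod ν))
    (hg : AEStronglyMeasurable g (μ.prod ν))
    (h : ∀ᵐ x ∂ν, ∀ᵐ t ∂μ, f (t, x) = g (t, x)) : f =ᵐ[μ.prod ν] g := by
  obtain ⟨f', hf', hff⟩ := hf
  obtain ⟨g', hg', hgg⟩ := hg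
  have hset : MeasurableSet {p : α × ℝ | f' p.swap = g' p.swap} :=
    measurable_swap (hf'.measurableSet_eq_fun hg')
  have h1 : ∀ᵐ p ∂(ν.prod μ), f' p.swap = g' p.swap := by
    rw [Measure.ae_prod_iff_ae_ae hset]
    filter_upwards [h, ae_ae_swap_of_ae_prod hff, ae_ae_swap_of_ae_prod hgg] with x h1 h2 h3
    filter_upwards [h1, h2, h3] with t h1 h2 h3
    exact (h2.symm.trans h1).trans h3
  have h2 : ∀ᵐ p ∂(μ.prod ν), f' p = g' p :=
    (Measure.measurePreserving_swap (μ := μ) (ν := ν)).quasiMeasurePreserving.ae h1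
  filter_upwards [hff, hgg, h2] with p h1 h2 h3
  rw [h1, h2, h3]

theorem ae_aestronglyMeasurable_section {E : Type*} [NormedAddCommGroup E] {μ : Measure ℝ}
    [SFinite μ] {f : ℝ × α → E} (hf : AEStronglyMeasurable f (μ.prod ν)) :
    ∀ᵐ x ∂ν, AEStronglyMeasurable (fun t => f (t, x)) μ :=
  hf.prod_swap.prodMk_left

theorem ae_memLp_section {E : Type*} [NormedAddCommGroup E] {μ : Measure ℝ} [SFinite μ]
    {f : ℝ × α → E} (hf : MemLp f 2 (μ.prod ν)) :
    (∀ᵐ x ∂ν, MemLp (fun t => f (t, x)) 2 μ) ∧ ∀ᵐ t ∂μ, MemLp (fun x => f (t, x)) 2 ν := by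
  have hi : ∫⁻ p, ‖f p‖ₑ ^ 2 ∂(μ.prod ν) < ⊤ := by
    rw [← eLpNorm_two_sq]; exact ENNReal.pow_lt_top hf.2
  have hm : AEMeasurable (fun p => ‖f p‖ₑ ^ 2) (μ.prod ν) := hf.1.enorm.pow_const 2
  constructor
  · have h1 : ∫⁻ x, ∫⁻ t, ‖f (t, x)‖ₑ ^ 2 ∂μ ∂ν < ⊤ := by
      rwa [lintegral_prod_symm _ hm] at hi
    filter_upwards [ae_aestronglyMeasurable_section hf.1,
      ae_lt_top' hm.prod_swap.lintegral_prod_right' h1.ne] with x h2 h3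
    refine ⟨h2, ?_⟩
    have h3' : ∫⁻ t, ‖f (t, x)‖ₑ ^ 2 ∂μ < ⊤ := h3
    rw [← eLpNorm_two_sq] at h3'
    exact (ENNReal.pow_lt_top_iff.1 h3').resolve_right (by norm_num)
  · have h1 : ∫⁻ t, ∫⁻ x, ‖f (t, x)‖ₑ ^ 2 ∂ν ∂μ < ⊤ := by
      rwa [lintegral_prod _ hm] at hi
    filter_upwards [hf.1.prodMk_left, ae_lt_top' hm.lintegral_prod_right' h1.ne] with x h2 h3
    refine ⟨h2, ?_⟩
    rw [← eLpNorm_two_sq] at h3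
    exact (ENNReal.pow_lt_top_iff.1 h3).resolve_right (by norm_num)

/-- Joint measurability of the convolution in time of a space-time function. -/
theorem aestronglyMeasurable_conv_prod {T : ℝ} {a : ℝ → ℝ} {v : ℝ → α → F}
    (ha : AEStronglyMeasurable a (volume.restrict (Ioo 0 T)))
    (hv : AEStronglyMeasurable (fun p : ℝ × α => v p.1 p.2) ((volume.restrict (Ioo 0 T)).prod ν)) :
    AEStronglyMeasurable (fun p : ℝ × α => conv a (fun τ => v τ p.2) p.1)
      ((volume.restrict (Ioo 0 T)).prod ν) := by
  obtain ⟨a', ha', haa⟩ := ha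
  obtain ⟨v', hv', hvv⟩ := hv
  have hind : StronglyMeasurable fun q : (ℝ × α) × ℝ =>
      (Ioo 0 T).indicator a' (q.1.1 - q.2) • (Ioo 0 T).indicator (fun τ => v' (τ, q.1.2)) q.2 := by
    refine StronglyMeasurable.smul ?_ ?_
    · exact (ha'.indicator measurableSet_Ioo).comp_measurable (by fun_prop)
    · have : (fun q : (ℝ × α) × ℝ => (Ioo 0 T).indicator (fun τ => v' (τ, q.1.2)) q.2) =
          ((fun q : (ℝ × α) × ℝ => q.2) ⁻¹' Ioo 0 T).indicator fun q => v' (q.2, q.1.2) := by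
        ext q; rfl
      rw [this]
      exact (hv'.comp_measurable (by fun_prop)).indicator (measurable_snd measurableSet_Ioo)
  refine ⟨fun p => ∫ τ, (Ioo 0 T).indicator a' (p.1 - τ) •
    (Ioo 0 T).indicator (fun τ => v' (τ, p.2)) τ, hind.integral_prod_right, ?_⟩
  have h1 : ∀ᵐ p ∂((volume.restrict (Ioo 0 T)).prod ν), p.1 ∈ Ioo 0 T :=
    Measure.quasiMeasurePreserving_fst.ae (ae_restrict_mem measurableSet_Ioo)
  have h2 : ∀ᵐ p ∂((volume.restrict (Ioo 0 T)).prod ν),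
      (fun τ => v τ p.2) =ᵐ[volume.restrict (Ioo 0 T)] fun τ => v' (τ, p.2) :=
    Measure.quasiMeasurePreserving_snd.ae (ae_ae_swap_of_ae_prod hvv)
  filter_upwards [h1, h2] with p h1 h2
  rw [conv_congr (Ioo_subset_Icc_self h1) haa h2, conv_eq_convolution (Ioo_subset_Icc_self h1),
    convolution_lsmul_swap]

/-- Convolution in time with an `L₁` kernel maps `L₂((0,T) × α)` into itself. -/
theorem memLp_conv_prod {T : ℝ} {a : ℝ → ℝ} {v : ℝ → α → F} (ha : IntegrableOn a (Ioo 0 T))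
    (hv : MemLp (fun p : ℝ × α => v p.1 p.2) 2 ((volume.restrict (Ioo 0 T)).prod ν)) :
    MemLp (fun p : ℝ × α => conv a (fun τ => v τ p.2) p.1) 2
      ((volume.restrict (Ioo 0 T)).prod ν) := by
  have hm := aestronglyMeasurable_conv_prod ha.aestronglyMeasurable hv.1
  refine ⟨hm, ?_⟩
  have hi : ∫⁻ p, ‖v p.1 p.2‖ₑ ^ 2 ∂((volume.restrict (Ioo 0 T)).prod ν) < ⊤ := by
    rw [← eLpNorm_two_sq (fun p : ℝ × α => v p.1 p.2)]; exact ENNReal.pow_lt_top hv.2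
  have key : ∫⁻ p, ‖conv a (fun τ => v τ p.2) p.1‖ₑ ^ 2
      ∂((volume.restrict (Ioo 0 T)).prod ν) < ⊤ := by
    rw [lintegral_prod_symm _ (hm.enorm.pow_const 2)]
    rw [lintegral_prod_symm _ (hv.1.enorm.pow_const 2)] at hi
    calc _ ≤ ∫⁻ x, ((∫⁻ t in Ioo 0 T, ‖a t‖ₑ) ^ 2 * ∫⁻ t in Ioo 0 T, ‖v t x‖ₑ ^ 2) ∂ν := by
          refine lintegral_mono_ae ?_
          filter_upwards [ae_aestronglyMeasurable_section hv.1] with x hx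
          exact lintegral_enorm_conv_sq_le ha.aestronglyMeasurable hx
      _ = (∫⁻ t in Ioo 0 T, ‖a t‖ₑ) ^ 2 * ∫⁻ x, (∫⁻ t in Ioo 0 T, ‖v t x‖ₑ ^ 2) ∂ν :=
          lintegral_const_mul' _ _ (ENNReal.pow_ne_top ha.2.ne)
      _ < ⊤ := ENNReal.mul_lt_top (ENNReal.pow_lt_top ha.2) hi
  rw [← eLpNorm_two_sq (fun p : ℝ × α => conv a (fun τ => v τ p.2) p.1)] at key
  exact (ENNReal.pow_lt_top_iff.1 key).resolve_right (by norm_num)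

/-- Convolution in time commutes with integration in space. -/
theorem integral_conv_prod {T : ℝ} {l : ℝ → ℝ} {a : ℝ → α → ℝ} (hl : IntegrableOn l (Ioo 0 T))
    (ha : Integrable (fun p : ℝ × α => a p.1 p.2) ((volume.restrict (Ioo 0 T)).prod ν)) :
    ∀ᵐ t ∂(volume.restrict (Ioo 0 T)),
      ∫ x, conv l (fun τ => a τ x) t ∂ν = conv l (fun τ => ∫ x, a τ x ∂ν) t := by
  have hN : IntegrableOn (fun τ => ∫ x, ‖a τ x‖ ∂ν) (Ioo 0 T) := ha.integral_norm_prod_left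
  filter_upwards [ae_intervalIntegrable_conv hl.norm hN, ae_restrict_mem measurableSet_Ioo]
    with t h1 ht
  have hsub : Ioc 0 t ⊆ Ioo 0 T := fun τ hτ => ⟨hτ.1, lt_of_le_of_lt hτ.2 ht.2⟩
  have ha' : Integrable (fun p : ℝ × α => a p.1 p.2) ((volume.restrict (Ioc 0 t)).prod ν) :=
    ha.mono_measure (Measure.prod_mono (Measure.restrict_mono hsub le_rfl) le_rfl)
  have hlm : AEStronglyMeasurable (fun τ => l (t - τ)) (volume.restrict (Ioc 0 t)) := by
    have h0 : AEStronglyMeasurable ((Ioo 0 T).indicator l) volume :=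
      (hl.integrable_indicator measurableSet_Ioo).aestronglyMeasurable
    have h2 := h0.comp_quasiMeasurePreserving
      (quasiMeasurePreserving_sub_left_of_right_invariant volume t)
    rw [← restrict_Ioo_eq_restrict_Ioc]
    refine (h2.restrict (s := Ioo 0 t)).congr ?_
    filter_upwards [ae_restrict_mem measurableSet_Ioo] with τ hτ
    exact indicator_of_mem (show t - τ ∈ Ioo 0 T from
      ⟨by linarith [hτ.2], by linarith [hτ.1, ht.2]⟩) l
  have hint : Integrable (fun p : ℝ × α => l (t - p.1) • a p.1 p.2)
      ((volume.restrict (Ioc 0 t)).prod ν) := by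
    have hm2 : AEStronglyMeasurable (fun p : ℝ × α => l (t - p.1) • a p.1 p.2)
      ((volume.restrict (Ioc 0 t)).prod ν) := hlm.comp_fst.smul ha'.aestronglyMeasurable
    rw [integrable_prod_iff hm2]
    refine ⟨?_, ?_⟩
    · filter_upwards [ha'.prod_right_ae] with τ hτ using hτ.smul (l (t - τ))
    · rw [intervalIntegrable_iff_integrableOn_Ioc_of_le ht.1.le] at h1
      refine Integrable.congr h1 (Eventually.of_forall fun τ => ?_)
      simp only [norm_mul, smul_eq_mul]
      rw [integral_const_mul]
  have sw := integral_integral_swap (f := fun τ x => l (t - τ) • a τ x) hint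
  simp only [conv, intervalIntegral.integral_of_le ht.1.le]
  rw [← sw]
  congr 1
  ext τ
  exact integral_smul _ _

end

section

/-! ### The regularized kernel and its time derivative -/

variable {F : Type*} [NormedAddCommGroup F] [NormedSpace ℝ F]

/-- `(h + l ∗ h) ∗ v = l ∗ v` for the resolvent kernel `h` of `l`. -/
theorem IsResolventKernel.conv_add_conv_conv [CompleteSpace F] {l h : ℝ → ℝ}
    (hh : IsResolventKernel 1 l h) (hl : LocallyIntegrableOn l (Ici 0)) {T : ℝ} {v : ℝ → F}
    (hv : IntegrableOn v (Ioo 0 T)) :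
    ∀ᵐ t ∂(volume.restrict (Ioo 0 T)), conv h v t + conv l (conv h v) t = conv l v t := by
  have ih := hh.1.integrableOn_Ioo T
  have il := hl.integrableOn_Ioo T
  have e : (fun t => h t + conv l h t) =ᵐ[volume.restrict (Ioo 0 T)] l := by
    filter_upwards [ae_restrict_of_ae_restrict_of_subset Ioo_subset_Ioi_self hh.2,
      ae_restrict_mem measurableSet_Ioo] with t h1 ht
    rw [one_mul, one_mul, conv_comm ht.1.le] at h1
    exact h1
  filter_upwards [conv_assoc il ih hv, conv_add_left ih (integrableOn_conv il ih) hv,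
    ae_restrict_mem measurableSet_Ioo] with t h1 h2 ht
  rw [← h1, ← h2]
  exact conv_congr (Ioo_subset_Icc_self ht) e (ae_eq_refl v)

/-- `G = v - h ∗ v` satisfies `G + l ∗ G = v`. -/
theorem IsResolventKernel.sub_conv_add_conv [CompleteSpace F] {l h : ℝ → ℝ}
    (hh : IsResolventKernel 1 l h) (hl : LocallyIntegrableOn l (Ici 0)) {T : ℝ} {v : ℝ → F}
    (hv : IntegrableOn v (Ioo 0 T)) :
    ∀ᵐ t ∂(volume.restrict (Ioo 0 T)),
      (v t - conv h v t) + conv l (fun τ => v τ - conv h v τ) t = v t := by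
  have ih := hh.1.integrableOn_Ioo T
  have il := hl.integrableOn_Ioo T
  filter_upwards [hh.conv_add_conv_conv hl hv, conv_sub_right il hv (integrableOn_conv ih hv)]
    with t h1 h2
  rw [h2, ← h1]
  abel

/-- The regularized kernel is `k ∗ h = 1 - 1 ∗ h`, hence `(k ∗ h) ∗ v = 1 ∗ (v - h ∗ v)`. -/
theorem IsResolventKernel.conv_conv_eq_integral [CompleteSpace F] {k l h : ℝ → ℝ}
    (hkl : IsPCPair k l)
    (hh : IsResolventKernel 1 l h) {T : ℝ} {v : ℝ → F} (hv : IntegrableOn v (Ioo 0 T)) :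
    ∀ᵐ t ∂(volume.restrict (Ioo 0 T)),
      conv (conv k h) v t = conv (fun _ => 1) (fun τ => v τ - conv h v τ) t := by
  have ih := hh.1.integrableOn_Ioo T
  have il := hkl.locallyIntegrable_l.integrableOn_Ioo T
  have ik := hkl.locallyIntegrable_k.integrableOn_Ioo T
  have i1 : IntegrableOn (fun _ : ℝ => (1 : ℝ)) (Ioo 0 T) := by simp
  have one := ae_restrict_of_ae_restrict_of_subset (Ioo_subset_Ioi_self : Ioo 0 T ⊆ Ioi 0)
    hkl.conv_eq_one
  have e : (fun t => h t + conv l h t) =ᵐ[volume.restrict (Ioo 0 T)] l := by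
    filter_upwards [ae_restrict_of_ae_restrict_of_subset Ioo_subset_Ioi_self hh.2,
      ae_restrict_mem measurableSet_Ioo] with t h1 ht
    rw [one_mul, one_mul, conv_comm ht.1.le] at h1
    exact h1
  have hkh : conv k h =ᵐ[volume.restrict (Ioo 0 T)] fun t => 1 - conv (fun _ => 1) h t := by
    filter_upwards [conv_assoc ik il ih, conv_add_right ik ih (integrableOn_conv il ih), one,
      ae_restrict_mem measurableSet_Ioo] with t h1 h2 h3 ht
    rw [conv_congr (Ioo_subset_Icc_self ht) (ae_eq_refl k) e, h3, ← h1,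
      conv_congr (Ioo_subset_Icc_self ht) one (ae_eq_refl h)] at h2
    linarith
  filter_upwards [conv_assoc i1 ih hv, conv_sub_left i1 (integrableOn_conv i1 ih) hv,
    conv_sub_right i1 hv (integrableOn_conv ih hv), ae_restrict_mem measurableSet_Ioo]
    with t h1 h2 h3 ht
  rw [conv_congr (Ioo_subset_Icc_self ht) hkh (ae_eq_refl v), h2, h1, h3]

/-- Integration by parts in time against a function vanishing at the end point. -/
theorem integral_conv_one_mul_deriv {T : ℝ} {g φ : ℝ → ℝ}
    (hg : MemLp g 2 (volume.restrict (Ioo 0 T))) (hφ : ContDiff ℝ 1 φ) (hT : φ T = 0) :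
    ∫ t in Ioo 0 T, conv (fun _ => 1) g t * deriv φ t = -∫ t in Ioo 0 T, g t * φ t := by
  have i1 : IntegrableOn (fun _ : ℝ => (1 : ℝ)) (Ioo 0 T) := by simp
  have cφ : Continuous (deriv φ) := hφ.continuous_deriv le_rfl
  have mφ : MemLp (deriv φ) 2 (volume.restrict (Ioo 0 T)) := by
    obtain ⟨C, hC⟩ := isCompact_Icc.exists_bound_of_continuousOn
      (cφ.continuousOn (s := Icc 0 T))
    refine MemLp.of_bound cφ.aestronglyMeasurable C ?_
    filter_upwards [ae_restrict_mem measurableSet_Ioo] with t ht using hC t (Ioo_subset_Icc_self ht)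
  have h := integral_inner_conv_eq i1 hg mφ
  have hin : ∀ a b : ℝ, inner ℝ a b = a * b := fun a b => by simp [mul_comm]
  simp only [hin] at h
  rw [h, ← integral_neg]
  congr 1
  ext t
  rw [dualConv]
  simp only [one_smul]
  rw [intervalIntegral.integral_deriv_eq_sub (fun x _ => hφ.differentiable (by simp) x)
    (cφ.intervalIntegrable _ _), hT]
  ring

section Cylinder

variable {N : ℕ}

theorem restrict_cylinder (T : ℝ) (Ω : Set (EuclideanSpace ℝ (Fin N))) :
    (volume : Measure (ℝ × EuclideanSpace ℝ (Fin N))).restrict (cylinder T Ω) =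
      (volume.restrict (Ioo 0 T)).prod (volume.restrict Ω) := by
  rw [cylinder, Measure.volume_eq_prod, Measure.prod_restrict]

/-- `∂_t ((k ∗ h) ∗ v) = v - h ∗ v` for the resolvent kernel `h` of `l`. -/
theorem isWeakTimeDeriv_sub_conv {T : ℝ} {Ω : Set (EuclideanSpace ℝ (Fin N))} {k l h : ℝ → ℝ}
    (hkl : IsPCPair k l) (hh : IsResolventKernel 1 l h) {v : ℝ → EuclideanSpace ℝ (Fin N) → ℝ}
    (hv : MemLp (fun p : ℝ × EuclideanSpace ℝ (Fin N) => v p.1 p.2) 2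
      ((volume.restrict (Ioo 0 T)).prod (volume.restrict Ω))) :
    IsWeakTimeDeriv T Ω (fun t x => conv (conv k h) (fun τ => v τ x) t)
      (fun t x => v t x - conv h (fun τ => v τ x) t) := by
  have ih := hh.1.integrableOn_Ioo T
  have ik := hkl.locallyIntegrable_k.integrableOn_Ioo T
  have mh := memLp_conv_prod ih hv
  have mG : MemLp (fun p : ℝ × EuclideanSpace ℝ (Fin N) =>
      v p.1 p.2 - conv h (fun τ => v τ p.2) p.1) 2
      ((volume.restrict (Ioo 0 T)).prod (volume.restrict Ω)) := hv.sub mh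
  have mF := memLp_conv_prod (integrableOn_conv ik ih) hv
  refine ⟨by rw [restrict_cylinder]; exact mG, fun φ hφ => ?_⟩
  obtain ⟨hφs, hφc, hφt⟩ := hφ
  rw [restrict_cylinder]
  set μν := (volume.restrict (Ioo 0 T)).prod (volume.restrict Ω) with hμν
  have hφ1 : ContDiff ℝ 1 φ := hφs.of_le (by simp)
  have mφ : MemLp φ 2 μν := by
    have := (hφ1.continuous.memLp_of_hasCompactSupport (p := 2) (μ := volume) hφc).restrict
      (cylinder T Ω)
    rwa [restrict_cylinder] at this
  have mdφ : MemLp (fun p => fderiv ℝ φ p (1, 0)) 2 μν := by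
    have c1 : Continuous fun p => fderiv ℝ φ p (1, 0) :=
      (hφ1.continuous_fderiv one_ne_zero).clm_apply continuous_const
    have c2 : HasCompactSupport fun p => fderiv ℝ φ p (1, 0) := hφc.fderiv_apply (𝕜 := ℝ) (1, 0)
    have := (c1.memLp_of_hasCompactSupport (p := 2) (μ := volume) c2).restrict (cylinder T Ω)
    rwa [restrict_cylinder] at this
  have i1 : Integrable (fun p : ℝ × EuclideanSpace ℝ (Fin N) =>
      conv (conv k h) (fun τ => v τ p.2) p.1 * fderiv ℝ φ p (1, 0)) μν := mF.integrable_mul mdφ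
  have i2 : Integrable (fun p : ℝ × EuclideanSpace ℝ (Fin N) =>
      (v p.1 p.2 - conv h (fun τ => v τ p.2) p.1) * φ p) μν := mG.integrable_mul mφ
  rw [hμν, integral_prod_symm _ i1, integral_prod_symm _ i2, ← integral_neg]
  refine integral_congr_ae ?_
  filter_upwards [(ae_memLp_section hv).1, (ae_memLp_section mG).1] with x hx hGx
  have hline : ContDiff ℝ 1 fun t : ℝ => φ (t, x) :=
    hφ1.comp (contDiff_id.prodMk contDiff_const)
  have hT0 : φ (T, x) = 0 := by
    by_contra hne
    exact lt_irrefl T (hφt (subset_tsupport φ hne)).1.2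
  have hd : ∀ t, deriv (fun t : ℝ => φ (t, x)) t = fderiv ℝ φ (t, x) (1, 0) := by
    intro t
    have h1 : HasDerivAt (fun t : ℝ => (t, x)) ((1 : ℝ), (0 : EuclideanSpace ℝ (Fin N))) t :=
      (hasDerivAt_id t).prodMk (hasDerivAt_const t x)
    exact (((hφ1.differentiable one_ne_zero) (t, x)).hasFDerivAt.comp_hasDerivAt t h1).deriv
  have key := integral_conv_one_mul_deriv hGx hline hT0
  simp only [hd] at key
  rw [← key]
  refine integral_congr_ae ?_
  filter_upwards [hh.conv_conv_eq_integral hkl (hx.integrable (by norm_num))] with t ht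
  rw [ht]

/-! ### A common null set for all test functions -/

/-- A family of inequalities, each valid for almost every `t`, holds for almost every `t`
simultaneously, because `L₂ × L₂` is separable and the inequalities are stable under `L₂`-limits of
the test functions. -/
theorem ae_forall_test_of_forall_ae {Ω : Set (EuclideanSpace ℝ (Fin N))} {μ : Measure ℝ}
    {C : (EuclideanSpace ℝ (Fin N) → ℝ) →
      (EuclideanSpace ℝ (Fin N) → EuclideanSpace ℝ (Fin N)) → Prop}
    (hC : ∀ ψ Dψ, C ψ Dψ → MemLp ψ 2 (volume.restrict Ω) ∧ MemLp Dψ 2 (volume.restrict Ω))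
    {R : ℝ → EuclideanSpace ℝ (Fin N) → ℝ}
    {S : ℝ → EuclideanSpace ℝ (Fin N) → EuclideanSpace ℝ (Fin N)}
    (hR : ∀ᵐ t ∂μ, MemLp (R t) 2 (volume.restrict Ω))
    (hS : ∀ᵐ t ∂μ, MemLp (S t) 2 (volume.restrict Ω))
    (h : ∀ ψ Dψ, C ψ Dψ → ∀ᵐ t ∂μ,
      ∫ x in Ω, (ψ x * R t x + inner ℝ (S t x) (Dψ x)) ≤ 0) :
    ∀ᵐ t ∂μ, ∀ ψ Dψ, C ψ Dψ → ∫ x in Ω, (ψ x * R t x + inner ℝ (S t x) (Dψ x)) ≤ 0 := by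
  have : Fact ((2 : ENNReal) ≠ ⊤) := ⟨by norm_num⟩
  have s2 : SecondCountableTopology (Lp ℝ 2 (volume.restrict Ω)) := inferInstance
  have s3 : SecondCountableTopology (Lp (EuclideanSpace ℝ (Fin N)) 2 (volume.restrict Ω)) :=
    inferInstance
  set A : Set (Lp ℝ 2 (volume.restrict Ω) × Lp (EuclideanSpace ℝ (Fin N)) 2 (volume.restrict Ω)) :=
    {q | ∃ ψ Dψ, C ψ Dψ ∧ ψ =ᵐ[volume.restrict Ω] q.1 ∧ Dψ =ᵐ[volume.restrict Ω] q.2} with hA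
  obtain ⟨D, hDA, hDc, hAD⟩ :=
    (TopologicalSpace.IsSeparable.of_separableSpace A).exists_countable_dense_subset
  have eq : ∀ (t : ℝ) (hRt : MemLp (R t) 2 (volume.restrict Ω))
      (hSt : MemLp (S t) 2 (volume.restrict Ω)) (ψ : EuclideanSpace ℝ (Fin N) → ℝ)
      (Dψ : EuclideanSpace ℝ (Fin N) → EuclideanSpace ℝ (Fin N)), C ψ Dψ →
      ∀ q : Lp ℝ 2 (volume.restrict Ω) × Lp (EuclideanSpace ℝ (Fin N)) 2 (volume.restrict Ω),
      ψ =ᵐ[volume.restrict Ω] q.1 → Dψ =ᵐ[volume.restrict Ω] q.2 →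
      ∫ x in Ω, (ψ x * R t x + inner ℝ (S t x) (Dψ x)) =
        inner ℝ (hRt.toLp (R t)) q.1 + inner ℝ (hSt.toLp (S t)) q.2 := by
    intro t hRt hSt ψ Dψ hψ q h1 h2
    rw [L2.inner_def, L2.inner_def,
      ← integral_add (L2.integrable_inner _ _) (L2.integrable_inner _ _)]
    refine integral_congr_ae ?_
    filter_upwards [h1, h2, hRt.coeFn_toLp, hSt.coeFn_toLp] with x h1 h2 h3 h4
    rw [← h1, ← h2, h3, h4]
    simp
  have hcount : ∀ᵐ t ∂μ, ∀ q ∈ D, ∀ (hRt : MemLp (R t) 2 (volume.restrict Ω))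
      (hSt : MemLp (S t) 2 (volume.restrict Ω)),
      inner ℝ (hRt.toLp (R t)) q.1 + inner ℝ (hSt.toLp (S t)) q.2 ≤ 0 := by
    rw [ae_ball_iff hDc]
    intro q hq
    obtain ⟨ψ, Dψ, hψ, h1, h2⟩ := hDA hq
    filter_upwards [h ψ Dψ hψ] with t ht hRt hSt
    rwa [← eq t hRt hSt ψ Dψ hψ q h1 h2]
  filter_upwards [hcount, hR, hS] with t ht hRt hSt ψ Dψ hψ
  obtain ⟨m1, m2⟩ := hC ψ Dψ hψ
  rw [eq t hRt hSt ψ Dψ hψ (m1.toLp ψ, m2.toLp Dψ) m1.coeFn_toLp.symm m2.coeFn_toLp.symm]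
  have hmem : (m1.toLp ψ, m2.toLp Dψ) ∈ closure D :=
    hAD ⟨ψ, Dψ, hψ, m1.coeFn_toLp.symm, m2.coeFn_toLp.symm⟩
  have hclosed : IsClosed {q : Lp ℝ 2 (volume.restrict Ω) ×
      Lp (EuclideanSpace ℝ (Fin N)) 2 (volume.restrict Ω) |
      inner ℝ (hRt.toLp (R t)) q.1 + inner ℝ (hSt.toLp (S t)) q.2 ≤ 0} :=
    isClosed_le (by fun_prop) continuous_const
  exact closure_minimal (fun q hq => ht q hq hRt hSt) hclosed hmem

end Cylinder

end

section

/-! ### Testing the inequality with the solution -/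

variable {N : ℕ}

theorem integrable_inner_of_memLp {α H : Type*} [MeasurableSpace α] {μ : Measure α}
    [NormedAddCommGroup H] [InnerProductSpace ℝ H] {f g : α → H} (hf : MemLp f 2 μ)
    (hg : MemLp g 2 μ) : Integrable (fun x => inner ℝ (f x) (g x)) μ := by
  have h : Integrable (fun x => ‖f x‖ * ‖g x‖) μ := hf.norm.integrable_mul hg.norm
  exact h.mono' (hf.1.inner hg.1) (Eventually.of_forall fun x => norm_inner_le_norm _ _)

theorem conv_nonpos {l a : ℝ → ℝ} {T t : ℝ} (ht : t ∈ Icc 0 T)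
    (hl : ∀ᵐ s ∂(volume.restrict (Ioo 0 T)), 0 ≤ l s)
    (ha : ∀ᵐ s ∂(volume.restrict (Ioo 0 T)), a s ≤ 0) : conv l a t ≤ 0 := by
  have e1 : l =ᵐ[volume.restrict (Ioo 0 T)] fun s => max (l s) 0 := by
    filter_upwards [hl] with s hs using (max_eq_left hs).symm
  have e2 : a =ᵐ[volume.restrict (Ioo 0 T)] fun s => min (a s) 0 := by
    filter_upwards [ha] with s hs using (min_eq_left hs).symm
  rw [conv_congr ht e1 e2, conv, ← neg_nonneg, ← intervalIntegral.integral_neg]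
  refine intervalIntegral.integral_nonneg_of_forall ht.1 fun τ => ?_
  rw [smul_eq_mul, ← mul_neg]
  exact mul_nonneg (le_max_right _ _) (neg_nonneg.2 (min_le_right _ _))

theorem ae_conv_inner_const {H : Type*} [NormedAddCommGroup H] [InnerProductSpace ℝ H]
    [CompleteSpace H] {l : ℝ → ℝ} {T : ℝ} {g : ℝ → H} (hl : IntegrableOn l (Ioo 0 T))
    (hg : IntegrableOn g (Ioo 0 T)) (c : H) :
    ∀ᵐ t ∂(volume.restrict (Ioo 0 T)),
      conv l (fun τ => inner ℝ (g τ) c) t = inner ℝ (conv l g t) c := by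
  filter_upwards [ae_intervalIntegrable_conv hl hg] with t ht
  have h := (innerSL ℝ c).intervalIntegral_comp_comm ht
  simp only [innerSL_apply_apply, inner_smul_right] at h
  rw [real_inner_comm, conv, conv, ← h]
  simp only [smul_eq_mul, real_inner_comm]

/-- Adding to the time-regularized inequality (with `n = 1`) its convolution with `l ≥ 0` removes
the regularization: as `h + l ∗ h = l` and `(v - h ∗ v) + l ∗ (v - h ∗ v) = v` for `v = u - u₀`, the
result is the weak form of `u - u₀ - l ∗ Δw ≤ l ∗ f`. -/
theorem WeakInequality.ae_integral_nonpos {T : ℝ} {Ω : Set (EuclideanSpace ℝ (Fin N))}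
    {X : (EuclideanSpace ℝ (Fin N) → ℝ) →
      (EuclideanSpace ℝ (Fin N) → EuclideanSpace ℝ (Fin N)) → Prop}
    (hX : ∀ ψ Dψ, X ψ Dψ → MemLp ψ 2 (volume.restrict Ω) ∧ MemLp Dψ 2 (volume.restrict Ω))
    {k l : ℝ → ℝ} (hkl : IsPCPair k l) (hk : CompletelyMonotone k)
    {u₀ : EuclideanSpace ℝ (Fin N) → ℝ} {f u : ℝ → EuclideanSpace ℝ (Fin N) → ℝ}
    {Dw : ℝ → EuclideanSpace ℝ (Fin N) → EuclideanSpace ℝ (Fin N)}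
    (hv : MemLp (fun p : ℝ × EuclideanSpace ℝ (Fin N) => u p.1 p.2 - u₀ p.2) 2
      ((volume.restrict (Ioo 0 T)).prod (volume.restrict Ω)))
    (hf : MemLp (fun p : ℝ × EuclideanSpace ℝ (Fin N) => f p.1 p.2) 2
      ((volume.restrict (Ioo 0 T)).prod (volume.restrict Ω)))
    (hDw : MemLp (fun p : ℝ × EuclideanSpace ℝ (Fin N) => Dw p.1 p.2) 2
      ((volume.restrict (Ioo 0 T)).prod (volume.restrict Ω)))
    (hW : WeakInequality T Ω X k l u₀ f u Dw)
    {ψ : EuclideanSpace ℝ (Fin N) → ℝ}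
    {Dψ : EuclideanSpace ℝ (Fin N) → EuclideanSpace ℝ (Fin N)} (hψ : X ψ Dψ)
    (hψ0 : ∀ᵐ x ∂(volume.restrict Ω), 0 ≤ ψ x) :
    ∀ᵐ t ∂(volume.restrict (Ioo 0 T)),
      ∫ x in Ω, (ψ x * (u t x - u₀ x - conv l (fun τ => f τ x) t) +
        inner ℝ (conv l (fun τ => Dw τ x) t) (Dψ x)) ≤ 0 := by
  obtain ⟨h, hh⟩ := exists_isResolventKernel hkl.locallyIntegrable_l
  have ih := hh.1.integrableOn_Ioo T
  have hlL := hkl.locallyIntegrable_l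
  have il := hlL.integrableOn_Ioo T
  have mhv := memLp_conv_prod ih (v := fun t x => u t x - u₀ x) hv
  have mhf := memLp_conv_prod ih hf
  have mQ := memLp_conv_prod ih hDw
  obtain ⟨mψ, mDψ⟩ := hX ψ Dψ hψ
  have mψ' := mψ.comp_snd (volume.restrict (Ioo (0 : ℝ) T))
  have mDψ' := mDψ.comp_snd (volume.restrict (Ioo (0 : ℝ) T))
  set v : ℝ → EuclideanSpace ℝ (Fin N) → ℝ := fun t x => u t x - u₀ x with hvdef
  set P : ℝ → EuclideanSpace ℝ (Fin N) → ℝ := fun t x =>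
    (v t x - conv h (fun τ => v τ x) t) - conv h (fun τ => f τ x) t with hP
  set Q : ℝ → EuclideanSpace ℝ (Fin N) → EuclideanSpace ℝ (Fin N) := fun t x =>
    conv h (fun τ => Dw τ x) t with hQ
  have mP : MemLp (fun p : ℝ × EuclideanSpace ℝ (Fin N) => P p.1 p.2) 2
      ((volume.restrict (Ioo 0 T)).prod (volume.restrict Ω)) := (hv.sub mhv).sub mhf
  set a : ℝ → EuclideanSpace ℝ (Fin N) → ℝ := fun t x =>
    ψ x * P t x + inner ℝ (Q t x) (Dψ x) with ha
  have ia : Integrable (fun p : ℝ × EuclideanSpace ℝ (Fin N) => a p.1 p.2)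
      ((volume.restrict (Ioo 0 T)).prod (volume.restrict Ω)) :=
    (mψ'.integrable_mul mP).add (integrable_inner_of_memLp mQ mDψ')
  -- The inequality of the hypothesis, tested with `ψ`.
  have hA : ∀ᵐ t ∂(volume.restrict (Ioo 0 T)), ∫ x in Ω, a t x ≤ 0 := by
    have h1 := hW 1 le_rfl h (by simpa using hh) _ (isWeakTimeDeriv_sub_conv hkl hh hv) ψ Dψ hψ hψ0
    filter_upwards [h1, (ae_memLp_section (hv.sub mhv)).2, (ae_memLp_section mhf).2,
      (ae_memLp_section mQ).2] with t h1 h2 h3 h4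
    have e : ∀ x, a t x = (ψ x * (v t x - conv h (fun τ => v τ x) t) +
        inner ℝ (conv h (fun τ => Dw τ x) t) (Dψ x)) - conv h (fun τ => f τ x) t * ψ x := by
      intro x; simp only [ha, hP, hQ]; ring
    simp only [e]
    have j1 : Integrable (fun x => ψ x * (v t x - conv h (fun τ => v τ x) t) +
        inner ℝ (conv h (fun τ => Dw τ x) t) (Dψ x)) (volume.restrict Ω) :=
      (mψ.integrable_mul h2).add (integrable_inner_of_memLp h4 mDψ)
    have j2 : Integrable (fun x => conv h (fun τ => f τ x) t * ψ x) (volume.restrict Ω) :=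
      h3.integrable_mul mψ
    rw [integral_sub j1 j2]
    exact sub_nonpos.2 h1
  -- The same integrand without regularization is `a + l ∗ a`.
  have mS := memLp_conv_prod il hDw
  have mR : MemLp (fun p : ℝ × EuclideanSpace ℝ (Fin N) =>
      v p.1 p.2 - conv l (fun τ => f τ p.2) p.1) 2
      ((volume.restrict (Ioo 0 T)).prod (volume.restrict Ω)) := hv.sub (memLp_conv_prod il hf)
  have mb : AEStronglyMeasurable (fun p : ℝ × EuclideanSpace ℝ (Fin N) =>
      ψ p.2 * (v p.1 p.2 - conv l (fun τ => f τ p.2) p.1) +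
        inner ℝ (conv l (fun τ => Dw τ p.2) p.1) (Dψ p.2))
      ((volume.restrict (Ioo 0 T)).prod (volume.restrict Ω)) :=
    (mψ'.1.mul mR.1).add (mS.1.inner mDψ'.1)
  have mla := aestronglyMeasurable_conv_prod il.aestronglyMeasurable ia.aestronglyMeasurable
  have e : (fun p : ℝ × EuclideanSpace ℝ (Fin N) =>
      ψ p.2 * (v p.1 p.2 - conv l (fun τ => f τ p.2) p.1) +
        inner ℝ (conv l (fun τ => Dw τ p.2) p.1) (Dψ p.2))
      =ᵐ[(volume.restrict (Ioo 0 T)).prod (volume.restrict Ω)]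
      fun p => a p.1 p.2 + conv l (fun τ => a τ p.2) p.1 := by
    refine ae_prod_eq_of_ae_ae mb (ia.aestronglyMeasurable.add mla) ?_
    filter_upwards [(ae_memLp_section hv).1, (ae_memLp_section hf).1, (ae_memLp_section hDw).1]
      with x hvx hfx hDx
    have ivx : IntegrableOn (fun t => v t x) (Ioo 0 T) := hvx.integrable (by norm_num)
    have ifx : IntegrableOn (fun t => f t x) (Ioo 0 T) := hfx.integrable (by norm_num)
    have iDx : IntegrableOn (fun t => Dw t x) (Ioo 0 T) := hDx.integrable (by norm_num)
    have iG : IntegrableOn (fun t => v t x - conv h (fun τ => v τ x) t) (Ioo 0 T) :=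
      ivx.sub (integrableOn_conv ih ivx)
    have ihf := integrableOn_conv ih ifx
    have ihD := integrableOn_conv ih iDx
    have iP : IntegrableOn (fun t => P t x) (Ioo 0 T) := iG.sub ihf
    have iQ : IntegrableOn (fun t => inner ℝ (Q t x) (Dψ x)) (Ioo 0 T) := ihD.inner_const _
    filter_upwards [hh.sub_conv_add_conv hlL ivx, hh.conv_add_conv_conv hlL ifx,
      hh.conv_add_conv_conv hlL iDx, conv_sub_right il iG ihf,
      conv_add_right il (iP.const_mul (ψ x)) iQ, ae_conv_inner_const il ihD (Dψ x)]
      with t h1 h2 h3 h4 h5 h6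
    have h7 : conv l (fun τ => ψ x * P τ x) t = ψ x * conv l (fun τ => P τ x) t := by
      simp only [conv, smul_eq_mul, mul_left_comm _ (ψ x)]
      exact intervalIntegral.integral_const_mul _ _
    simp only [ha]
    rw [h5, h7, h6, ← h3, inner_add_left]
    simp only [hP, hQ]
    rw [h4]
    linear_combination ψ x * h2 - ψ x * h1
  filter_upwards [Measure.ae_ae_of_ae_prod e, integral_conv_prod il ia, ia.prod_right_ae,
    ae_restrict_mem measurableSet_Ioo, hA, (ae_memLp_section mR).2, (ae_memLp_section mS).2]
    with t h1 h2 h3 ht h4 h5 h6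
  have ib : Integrable (fun x => ψ x * (v t x - conv l (fun τ => f τ x) t) +
      inner ℝ (conv l (fun τ => Dw τ x) t) (Dψ x)) (volume.restrict Ω) :=
    (mψ.integrable_mul h5).add (integrable_inner_of_memLp h6 mDψ)
  have ila : Integrable (fun x => conv l (fun τ => a τ x) t) (volume.restrict Ω) := by
    refine (ib.sub h3).congr ?_
    filter_upwards [h1] with x hx
    simp only [Pi.sub_apply]
    rw [hx]
    ring
  rw [integral_congr_ae h1, integral_add h3 ila, h2]
  exact add_nonpos h4 (conv_nonpos (Ioo_subset_Icc_self ht) (hkl.l_nonneg hk T) hA)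

/-- The result of the choice `ψ = w(t, ·)` and integration in time. The test function depends on
`t`, so the exceptional set must not depend on the test function. -/
theorem WeakInequality.integral_le {T : ℝ} {Ω : Set (EuclideanSpace ℝ (Fin N))}
    {X : (EuclideanSpace ℝ (Fin N) → ℝ) →
      (EuclideanSpace ℝ (Fin N) → EuclideanSpace ℝ (Fin N)) → Prop}
    (hX : ∀ ψ Dψ, X ψ Dψ → MemLp ψ 2 (volume.restrict Ω) ∧ MemLp Dψ 2 (volume.restrict Ω))
    {k l : ℝ → ℝ} (hkl : IsPCPair k l) (hk : CompletelyMonotone k)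
    {u₀ : EuclideanSpace ℝ (Fin N) → ℝ} {f u w : ℝ → EuclideanSpace ℝ (Fin N) → ℝ}
    {Dw : ℝ → EuclideanSpace ℝ (Fin N) → EuclideanSpace ℝ (Fin N)}
    (hu₀ : MemLp u₀ 2 (volume.restrict Ω))
    (hf : MemLp (fun p : ℝ × EuclideanSpace ℝ (Fin N) => f p.1 p.2) 2
      (volume.restrict (cylinder T Ω)))
    (hu : MemLp (fun p : ℝ × EuclideanSpace ℝ (Fin N) => u p.1 p.2) 2
      (volume.restrict (cylinder T Ω)))
    (hw0 : ∀ᵐ p ∂(volume.restrict (cylinder T Ω)), 0 ≤ w p.1 p.2)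
    (hw : MemL2H1 T Ω X w Dw) (hW : WeakInequality T Ω X k l u₀ f u Dw) :
    IntegrableOn (fun p : ℝ × EuclideanSpace ℝ (Fin N) => w p.1 p.2 * u p.1 p.2)
      (cylinder T Ω) ∧
    IntegrableOn (fun p : ℝ × EuclideanSpace ℝ (Fin N) =>
      (u₀ p.2 + conv l (fun τ => f τ p.2) p.1) * w p.1 p.2) (cylinder T Ω) ∧
    (∫ p in cylinder T Ω, w p.1 p.2 * u p.1 p.2) +
      (∫ p in cylinder T Ω, inner ℝ (conv l (fun τ => Dw τ p.2) p.1) (Dw p.1 p.2)) ≤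
      ∫ p in cylinder T Ω, (u₀ p.2 + conv l (fun τ => f τ p.2) p.1) * w p.1 p.2 := by
  have mw := hw.memLp
  have mDw := hw.memLp_grad
  simp only [IntegrableOn]
  rw [restrict_cylinder] at *
  have il := hkl.locallyIntegrable_l.integrableOn_Ioo T
  have mu₀ := hu₀.comp_snd (volume.restrict (Ioo (0 : ℝ) T))
  have mv : MemLp (fun p : ℝ × EuclideanSpace ℝ (Fin N) => u p.1 p.2 - u₀ p.2) 2
    ((volume.restrict (Ioo 0 T)).prod (volume.restrict Ω)) := hu.sub mu₀
  have mlf := memLp_conv_prod il hf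
  have mS := memLp_conv_prod il mDw
  have i1 : Integrable (fun p : ℝ × EuclideanSpace ℝ (Fin N) => w p.1 p.2 * u p.1 p.2)
    ((volume.restrict (Ioo 0 T)).prod (volume.restrict Ω)) := mw.integrable_mul hu
  have i2 : Integrable (fun p : ℝ × EuclideanSpace ℝ (Fin N) =>
      (u₀ p.2 + conv l (fun τ => f τ p.2) p.1) * w p.1 p.2)
    ((volume.restrict (Ioo 0 T)).prod (volume.restrict Ω)) := (mu₀.add mlf).integrable_mul mw
  have i3 := integrable_inner_of_memLp mS mDw
  refine ⟨i1, i2, ?_⟩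
  have mR : MemLp (fun p : ℝ × EuclideanSpace ℝ (Fin N) =>
      u p.1 p.2 - u₀ p.2 - conv l (fun τ => f τ p.2) p.1) 2
      ((volume.restrict (Ioo 0 T)).prod (volume.restrict Ω)) := mv.sub mlf
  have hall := ae_forall_test_of_forall_ae (μ := volume.restrict (Ioo 0 T)) (Ω := Ω)
    (C := fun ψ Dψ => X ψ Dψ ∧ ∀ᵐ x ∂(volume.restrict Ω), 0 ≤ ψ x)
    (R := fun t x => u t x - u₀ x - conv l (fun τ => f τ x) t)
    (S := fun t x => conv l (fun τ => Dw τ x) t) (fun ψ Dψ h => hX ψ Dψ h.1)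
    (ae_memLp_section mR).2 (ae_memLp_section mS).2
    fun ψ Dψ h => hW.ae_integral_nonpos hX hkl hk mv hf mDw h.1 h.2
  have hle : ∫ p, (w p.1 p.2 * (u p.1 p.2 - u₀ p.2 - conv l (fun τ => f τ p.2) p.1) +
      inner ℝ (conv l (fun τ => Dw τ p.2) p.1) (Dw p.1 p.2))
      ∂((volume.restrict (Ioo 0 T)).prod (volume.restrict Ω)) ≤ 0 := by
    have i4 : Integrable (fun p : ℝ × EuclideanSpace ℝ (Fin N) =>
        w p.1 p.2 * (u p.1 p.2 - u₀ p.2 - conv l (fun τ => f τ p.2) p.1) +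
          inner ℝ (conv l (fun τ => Dw τ p.2) p.1) (Dw p.1 p.2))
        ((volume.restrict (Ioo 0 T)).prod (volume.restrict Ω)) := (mw.integrable_mul mR).add i3
    rw [integral_prod _ i4]
    refine integral_nonpos_of_ae ?_
    filter_upwards [hall, hw.mem_ae, Measure.ae_ae_of_ae_prod hw0] with t h1 h2 h3
    exact h1 (w t) (Dw t) ⟨h2, h3⟩
  have e : ∀ p : ℝ × EuclideanSpace ℝ (Fin N),
      w p.1 p.2 * (u p.1 p.2 - u₀ p.2 - conv l (fun τ => f τ p.2) p.1) +
        inner ℝ (conv l (fun τ => Dw τ p.2) p.1) (Dw p.1 p.2) =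
      w p.1 p.2 * u p.1 p.2 + inner ℝ (conv l (fun τ => Dw τ p.2) p.1) (Dw p.1 p.2) -
        (u₀ p.2 + conv l (fun τ => f τ p.2) p.1) * w p.1 p.2 := fun p => by ring
  simp only [e] at hle
  have i5 : Integrable (fun p : ℝ × EuclideanSpace ℝ (Fin N) =>
      w p.1 p.2 * u p.1 p.2 + inner ℝ (conv l (fun τ => Dw τ p.2) p.1) (Dw p.1 p.2))
      ((volume.restrict (Ioo 0 T)).prod (volume.restrict Ω)) := i1.add i3
  rw [integral_sub i5 i2, integral_add i1 i3] at hle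
  exact sub_nonpos.1 hle

end

section

/-! ### The energy inequality in space and time -/

variable {F : Type*} [NormedAddCommGroup F]
variable {α : Type*} [MeasurableSpace α] {ν : Measure α} [SFinite ν]

theorem aestronglyMeasurable_dualConv_prod [NormedSpace ℝ F] {T : ℝ} {l : ℝ → ℝ} {v : ℝ → α → F}
    (hl : AEStronglyMeasurable l (volume.restrict (Ioo 0 T)))
    (hv : AEStronglyMeasurable (fun p : ℝ × α => v p.1 p.2) ((volume.restrict (Ioo 0 T)).prod ν)) :
    AEStronglyMeasurable (fun p : ℝ × α => dualConv T l (fun τ => v τ p.2) p.1)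
      ((volume.restrict (Ioo 0 T)).prod ν) := by
  have hr := ((measurePreserving_reflect T).prod (MeasurePreserving.id ν)).quasiMeasurePreserving
  have h1 : AEStronglyMeasurable (fun p : ℝ × α => v (T - p.1) p.2)
      ((volume.restrict (Ioo 0 T)).prod ν) := hv.comp_quasiMeasurePreserving hr
  have h2 := (aestronglyMeasurable_conv_prod (v := fun t x => v (T - t) x) hl
    h1).comp_quasiMeasurePreserving hr
  refine h2.congr (Eventually.of_forall fun p => ?_)
  exact (dualConv_eq_conv T l (fun τ => v τ p.2) p.1).symm

theorem lintegral_prod_prod_eq {μ : Measure ℝ} [SFinite μ] {C : ℝ × ℝ × α → ENNReal}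
    (hC : AEMeasurable C (μ.prod (μ.prod ν))) :
    ∫⁻ p, C p ∂(μ.prod (μ.prod ν)) = ∫⁻ x, ∫⁻ t, ∫⁻ s, C (t, s, x) ∂μ ∂μ ∂ν := by
  have hp := measurePreserving_prodAssoc μ μ ν
  have hC' : AEMeasurable (fun q : (ℝ × ℝ) × α => C (q.1.1, q.1.2, q.2)) ((μ.prod μ).prod ν) :=
    hC.comp_quasiMeasurePreserving hp.quasiMeasurePreserving
  rw [← hp.lintegral_comp_emb MeasurableEquiv.prodAssoc.measurableEmbedding]
  change ∫⁻ q, C (q.1.1, q.1.2, q.2) ∂((μ.prod μ).prod ν) = _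
  rw [lintegral_prod_symm _ hC']
  refine lintegral_congr_ae ?_
  filter_upwards [hC'.aestronglyMeasurable.prod_swap.prodMk_left] with x hx
  exact lintegral_prod _ hx.aemeasurable

/-- The increments `g(t, x) - g(t-s, x)` are measurable in `(t, s, x)`, because `(t, s) ↦ t - s` is
quasi-measure-preserving. -/
theorem aestronglyMeasurable_increment {T : ℝ} {g : ℝ × α → F}
    (hg : AEStronglyMeasurable g ((volume.restrict (Ioo 0 T)).prod ν)) :
    AEStronglyMeasurable (fun p : ℝ × ℝ × α => g (p.1, p.2.2) - g (p.1 - p.2.1, p.2.2))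
      (((volume.restrict (Ioo 0 T)).prod ((volume.restrict (Ioo 0 T)).prod ν)).restrict
        {p | p.2.1 < p.1}) := by
  have hset : MeasurableSet {p : ℝ × ℝ × α | p.2.1 < p.1} :=
    measurableSet_lt (measurable_fst.comp measurable_snd) measurable_fst
  have q1 : Measure.QuasiMeasurePreserving (Prod.map id Prod.snd)
      ((volume.restrict (Ioo 0 T)).prod ((volume.restrict (Ioo 0 T)).prod ν))
      ((volume.restrict (Ioo (0 : ℝ) T)).prod ν) :=
    MeasureTheory.QuasiMeasurePreserving.prodMap (.id _) Measure.quasiMeasurePreserving_snd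
  have h1 : AEStronglyMeasurable (fun p : ℝ × ℝ × α => g (p.1, p.2.2))
      ((volume.restrict (Ioo 0 T)).prod ((volume.restrict (Ioo 0 T)).prod ν)) :=
    hg.comp_quasiMeasurePreserving q1
  have hm : MeasurableSet (Ioo 0 T ×ˢ (univ : Set α)) := measurableSet_Ioo.prod .univ
  have hr : (volume.restrict (Ioo 0 T)).prod ν =
      ((volume : Measure ℝ).prod ν).restrict (Ioo 0 T ×ˢ univ) := by
    rw [← Measure.prod_restrict, Measure.restrict_univ]
  have h2 : AEStronglyMeasurable ((Ioo 0 T ×ˢ (univ : Set α)).indicator g)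
      ((volume : Measure ℝ).prod ν) := by
    rw [aestronglyMeasurable_indicator_iff hm, ← hr]; exact hg
  have q2 : Measure.QuasiMeasurePreserving (fun p : ℝ × ℝ × α => (p.1 - p.2.1, p.2.2))
      ((volume : Measure ℝ).prod ((volume : Measure ℝ).prod ν)) ((volume : Measure ℝ).prod ν) :=
    (MeasureTheory.QuasiMeasurePreserving.prodMap
      (quasiMeasurePreserving_sub_of_right_invariant (volume : Measure ℝ) volume) (.id ν)).comp
      ((measurePreserving_prodAssoc (volume : Measure ℝ) (volume : Measure ℝ) ν).symm
        _).quasiMeasurePreserving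
  have h3 := (h2.comp_quasiMeasurePreserving q2).mono_measure
    (Measure.prod_mono (μ := volume.restrict (Ioo 0 T)) Measure.restrict_le_self
      (Measure.prod_mono (μ := volume.restrict (Ioo 0 T)) (ν := ν) Measure.restrict_le_self le_rfl))
  refine ((h1.mono_measure Measure.restrict_le_self).sub
    (h3.mono_measure Measure.restrict_le_self)).congr ?_
  have hmem : ∀ᵐ p ∂((volume.restrict (Ioo (0 : ℝ) T)).prod
      ((volume.restrict (Ioo (0 : ℝ) T)).prod ν)), p.1 ∈ Ioo 0 T ∧ p.2.1 ∈ Ioo 0 T :=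
    (Measure.quasiMeasurePreserving_fst.ae (ae_restrict_mem measurableSet_Ioo)).and
      ((Measure.quasiMeasurePreserving_fst.comp Measure.quasiMeasurePreserving_snd).ae
        (ae_restrict_mem measurableSet_Ioo))
  filter_upwards [ae_restrict_of_ae hmem, ae_restrict_mem hset] with p hp hlt
  have : (p.1 - p.2.1, p.2.2) ∈ Ioo 0 T ×ˢ (univ : Set α) :=
    ⟨⟨sub_pos.2 hlt, by linarith [hp.1.2, hp.2.1]⟩, trivial⟩
  simp only [Pi.sub_apply, Function.comp]
  rw [indicator_of_mem this]

/-- By Tonelli's theorem, the integral over space of the energies of `g(·, x)` is the sum of an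
integral over the cylinder and one over the set `s < t` of triples `(t, s, x)`. -/
theorem lintegral_energy_eq {T : ℝ} {a b : ℝ → ℝ} {g : ℝ → α → F}
    (ha : AEMeasurable a (volume.restrict (Ioo 0 T)))
    (hb : AEMeasurable b (volume.restrict (Ioo 0 T)))
    (hg : AEStronglyMeasurable (fun p : ℝ × α => g p.1 p.2) ((volume.restrict (Ioo 0 T)).prod ν)) :
    ∫⁻ x, energy T a b (fun t => g t x) ∂ν =
      ∫⁻ p, ENNReal.ofReal (a p.1 * ‖g p.1 p.2‖ ^ 2) ∂((volume.restrict (Ioo 0 T)).prod ν) +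
      ∫⁻ p in {p : ℝ × ℝ × α | p.2.1 < p.1},
        ENNReal.ofReal (b p.2.1 * ‖g p.1 p.2.2 - g (p.1 - p.2.1) p.2.2‖ ^ 2)
        ∂((volume.restrict (Ioo 0 T)).prod ((volume.restrict (Ioo 0 T)).prod ν)) := by
  have hset : MeasurableSet {p : ℝ × ℝ × α | p.2.1 < p.1} :=
    measurableSet_lt (measurable_fst.comp measurable_snd) measurable_fst
  have mA : AEMeasurable (fun p : ℝ × α => ENNReal.ofReal (a p.1 * ‖g p.1 p.2‖ ^ 2))
      ((volume.restrict (Ioo 0 T)).prod ν) :=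
    (ha.comp_fst.mul (hg.norm.aemeasurable.pow_const 2)).ennreal_ofReal
  have mA' : AEMeasurable (fun x => ∫⁻ t in Ioo 0 T, ENNReal.ofReal (a t * ‖g t x‖ ^ 2)) ν :=
    mA.prod_swap.lintegral_prod_right'
  have mb : AEMeasurable (fun p : ℝ × ℝ × α => b p.2.1)
      ((volume.restrict (Ioo 0 T)).prod ((volume.restrict (Ioo 0 T)).prod ν)) :=
    hb.comp_fst.comp_snd
  have mB : AEMeasurable (fun p : ℝ × ℝ × α =>
      ENNReal.ofReal (b p.2.1 * ‖g p.1 p.2.2 - g (p.1 - p.2.1) p.2.2‖ ^ 2))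
      (((volume.restrict (Ioo 0 T)).prod ((volume.restrict (Ioo 0 T)).prod ν)).restrict
        {p | p.2.1 < p.1}) :=
    ((mb.mono_measure Measure.restrict_le_self).mul
      ((aestronglyMeasurable_increment hg).norm.aemeasurable.pow_const 2)).ennreal_ofReal
  rw [← lintegral_indicator hset, lintegral_prod_prod_eq ((aemeasurable_indicator_iff hset).2 mB),
    lintegral_prod_symm _ mA, ← lintegral_add_left' mA']
  refine lintegral_congr_ae ?_
  filter_upwards [mA.aestronglyMeasurable.prod_swap.prodMk_left] with x hx
  have hx' : AEMeasurable (fun t => ENNReal.ofReal (a t * ‖g t x‖ ^ 2))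
    (volume.restrict (Ioo 0 T)) := hx.aemeasurable
  rw [energy, lintegral_add_left' hx']
  congr 1
  refine setLIntegral_congr_fun measurableSet_Ioo fun t ht => ?_
  have e : (fun s => {p : ℝ × ℝ × α | p.2.1 < p.1}.indicator (fun p : ℝ × ℝ × α =>
      ENNReal.ofReal (b p.2.1 * ‖g p.1 p.2.2 - g (p.1 - p.2.1) p.2.2‖ ^ 2)) (t, s, x)) =
      (Iio t).indicator fun s => ENNReal.ofReal (b s * ‖g t x - g (t - s) x‖ ^ 2) := by
    ext s; rfl
  rw [e, lintegral_indicator measurableSet_Iio, Measure.restrict_restrict measurableSet_Iio]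
  have : Iio t ∩ Ioo 0 T = Ioo 0 t := by
    ext s
    exact ⟨fun h => ⟨h.2.1, h.1⟩, fun h => ⟨h.2, h.1, h.2.trans ht.2⟩⟩
  rw [this]

/-- Fubini's theorem on the set `s < t` of triples `(t, s, x)`. -/
theorem intervalIntegral_intervalIntegral_eq {T : ℝ} (hT : 0 ≤ T) {f : ℝ × ℝ × α → ℝ}
    (hf : IntegrableOn f {p | p.2.1 < p.1}
      ((volume.restrict (Ioo 0 T)).prod ((volume.restrict (Ioo 0 T)).prod ν))) :
    ∫ t in (0 : ℝ)..T, ∫ s in (0 : ℝ)..t, ∫ x, f (t, s, x) ∂ν =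
      ∫ p in {p | p.2.1 < p.1}, f p
        ∂((volume.restrict (Ioo 0 T)).prod ((volume.restrict (Ioo 0 T)).prod ν)) := by
  have hset : MeasurableSet {p : ℝ × ℝ × α | p.2.1 < p.1} :=
    measurableSet_lt (measurable_fst.comp measurable_snd) measurable_fst
  have hi := hf.integrable_indicator hset
  rw [← integral_indicator hset, integral_prod _ hi, intervalIntegral.integral_of_le hT,
    integral_Ioc_eq_integral_Ioo]
  refine integral_congr_ae ?_
  filter_upwards [hi.prod_right_ae, ae_restrict_mem measurableSet_Ioo] with t h1 ht
  rw [integral_prod _ h1, intervalIntegral.integral_of_le ht.1.le, integral_Ioc_eq_integral_Ioo]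
  have e : ∀ s, ∫ x, {p : ℝ × ℝ × α | p.2.1 < p.1}.indicator f (t, s, x) ∂ν =
      (Iio t).indicator (fun s => ∫ x, f (t, s, x) ∂ν) s := by
    intro s
    by_cases hs : s < t
    · rw [indicator_of_mem (show s ∈ Iio t from hs)]
      congr 1
      ext x
      exact indicator_of_mem (show (t, s, x) ∈ {p : ℝ × ℝ × α | p.2.1 < p.1} from hs) f
    · rw [indicator_of_notMem (show s ∉ Iio t from hs)]
      rw [← integral_zero α ℝ (μ := ν)]
      congr 1
      ext x
      exact indicator_of_notMem (show (t, s, x) ∉ {p : ℝ × ℝ × α | p.2.1 < p.1} from hs) f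
  simp only [e]
  rw [integral_indicator measurableSet_Iio, Measure.restrict_restrict measurableSet_Iio]
  have : Iio t ∩ Ioo 0 T = Ioo 0 t := by
    ext s
    exact ⟨fun h => ⟨h.2.1, h.1⟩, fun h => ⟨h.2, h.1, h.2.trans ht.2⟩⟩
  rw [this]

/-- `energy_dualConv_le` integrated over space, with Bochner integrals. -/
theorem integral_energy_dualConv_le {H : Type*} [NormedAddCommGroup H] [InnerProductSpace ℝ H]
    [CompleteSpace H] {k l : ℝ → ℝ} (hkl : IsPCPair k l) (hk : CompletelyMonotone k) {T : ℝ}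
    {D : ℝ → α → H}
    (hD : MemLp (fun p : ℝ × α => D p.1 p.2) 2 ((volume.restrict (Ioo 0 T)).prod ν)) :
    Integrable (fun p : ℝ × α =>
      (k (T - p.1) + k p.1) * ‖dualConv T l (fun τ => D τ p.2) p.1‖ ^ 2)
      ((volume.restrict (Ioo 0 T)).prod ν) ∧
    IntegrableOn (fun p : ℝ × ℝ × α => 1 / p.2.1 * (k p.2.1 - k (2 * p.2.1)) *
      ‖dualConv T l (fun τ => D τ p.2.2) p.1 -
        dualConv T l (fun τ => D τ p.2.2) (p.1 - p.2.1)‖ ^ 2) {p | p.2.1 < p.1}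
      ((volume.restrict (Ioo 0 T)).prod ((volume.restrict (Ioo 0 T)).prod ν)) ∧
    1 / 2 * (∫ p, (k (T - p.1) + k p.1) * ‖dualConv T l (fun τ => D τ p.2) p.1‖ ^ 2
      ∂((volume.restrict (Ioo 0 T)).prod ν)) +
    1 / 2 * (∫ p in {p | p.2.1 < p.1}, 1 / p.2.1 * (k p.2.1 - k (2 * p.2.1)) *
      ‖dualConv T l (fun τ => D τ p.2.2) p.1 -
        dualConv T l (fun τ => D τ p.2.2) (p.1 - p.2.1)‖ ^ 2
      ∂((volume.restrict (Ioo 0 T)).prod ((volume.restrict (Ioo 0 T)).prod ν))) ≤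
    ∫ p, inner ℝ (conv l (fun τ => D τ p.2) p.1) (D p.1 p.2)
      ∂((volume.restrict (Ioo 0 T)).prod ν) := by
  have il := hkl.locallyIntegrable_l.integrableOn_Ioo T
  obtain ⟨ha, hb⟩ := aemeasurable_energy_weights hk T
  have hg := aestronglyMeasurable_dualConv_prod il.aestronglyMeasurable hD.1
  have iJ := integrable_inner_of_memLp (memLp_conv_prod il hD) hD
  have hset : MeasurableSet {p : ℝ × ℝ × α | p.2.1 < p.1} :=
    measurableSet_lt (measurable_fst.comp measurable_snd) measurable_fst
  set J : α → ℝ := fun x => ∫ t in Ioo 0 T, inner ℝ (conv l (fun τ => D τ x) t) (D t x) with hJ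
  have hE : ∀ᵐ x ∂ν, 0 ≤ J x ∧ energy T (fun t => k (T - t) + k t)
      (fun s => 1 / s * (k s - k (2 * s))) (fun t => dualConv T l (fun τ => D τ x) t) ≤
      ENNReal.ofReal (2 * J x) := by
    filter_upwards [(ae_memLp_section hD).1] with x hx
    exact energy_dualConv_le hkl hk T hx
  have iJx : Integrable (fun x => 2 * J x) ν := iJ.integral_prod_right.const_mul 2
  have hJtot : ∫ x, J x ∂ν = ∫ p, inner ℝ (conv l (fun τ => D τ p.2) p.1) (D p.1 p.2)
      ∂((volume.restrict (Ioo 0 T)).prod ν) := (integral_prod_symm _ iJ).symm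
  have hJ0 : 0 ≤ ∫ x, J x ∂ν := integral_nonneg_of_ae (hE.mono fun x hx => hx.1)
  have hsum := lintegral_energy_eq (ν := ν) (g := fun t x => dualConv T l (fun τ => D τ x) t)
    ha hb hg
  have hle : ∫⁻ x, energy T (fun t => k (T - t) + k t) (fun s => 1 / s * (k s - k (2 * s)))
      (fun t => dualConv T l (fun τ => D τ x) t) ∂ν ≤ ENNReal.ofReal (2 * ∫ x, J x ∂ν) := by
    rw [← integral_const_mul, ofReal_integral_eq_lintegral_ofReal iJx
      (hE.mono fun x hx => mul_nonneg zero_le_two hx.1)]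
    exact lintegral_mono_ae (hE.mono fun x hx => hx.2)
  rw [hsum] at hle
  have m2 : AEStronglyMeasurable (fun p : ℝ × α =>
      (k (T - p.1) + k p.1) * ‖dualConv T l (fun τ => D τ p.2) p.1‖ ^ 2)
      ((volume.restrict (Ioo 0 T)).prod ν) :=
    (ha.comp_fst.mul (hg.norm.aemeasurable.pow_const 2)).aestronglyMeasurable
  have hb' : AEMeasurable (fun p : ℝ × ℝ × α => 1 / p.2.1 * (k p.2.1 - k (2 * p.2.1)))
      ((volume.restrict (Ioo 0 T)).prod ((volume.restrict (Ioo 0 T)).prod ν)) :=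
    hb.comp_fst.comp_snd
  have m3 : AEStronglyMeasurable (fun p : ℝ × ℝ × α => 1 / p.2.1 * (k p.2.1 - k (2 * p.2.1)) *
      ‖dualConv T l (fun τ => D τ p.2.2) p.1 -
        dualConv T l (fun τ => D τ p.2.2) (p.1 - p.2.1)‖ ^ 2)
      (((volume.restrict (Ioo 0 T)).prod ((volume.restrict (Ioo 0 T)).prod ν)).restrict
        {p | p.2.1 < p.1}) :=
    ((hb'.mono_measure Measure.restrict_le_self).mul
      ((aestronglyMeasurable_increment hg).norm.aemeasurable.pow_const 2)).aestronglyMeasurable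
  have n2 : ∀ᵐ p ∂((volume.restrict (Ioo 0 T)).prod ν),
      0 ≤ (k (T - p.1) + k p.1) * ‖dualConv T l (fun τ => D τ p.2) p.1‖ ^ 2 := by
    filter_upwards [Measure.quasiMeasurePreserving_fst.ae
      (ae_restrict_mem (measurableSet_Ioo (a := (0 : ℝ)) (b := T)))] with p hp
    exact mul_nonneg (add_nonneg (hkl.nonneg _ (sub_pos.2 hp.2)) (hkl.nonneg _ hp.1)) (sq_nonneg _)
  have n3 : ∀ᵐ p ∂(((volume.restrict (Ioo 0 T)).prod
      ((volume.restrict (Ioo 0 T)).prod ν)).restrict {p | p.2.1 < p.1}),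
      0 ≤ 1 / p.2.1 * (k p.2.1 - k (2 * p.2.1)) *
        ‖dualConv T l (fun τ => D τ p.2.2) p.1 -
          dualConv T l (fun τ => D τ p.2.2) (p.1 - p.2.1)‖ ^ 2 := by
    filter_upwards [ae_restrict_of_ae ((Measure.quasiMeasurePreserving_fst.comp
      Measure.quasiMeasurePreserving_snd).ae
      (ae_restrict_mem (measurableSet_Ioo (a := (0 : ℝ)) (b := T))))] with p hp
    have hs : 0 < p.2.1 := hp.1
    have h2 : k (2 * p.2.1) ≤ k p.2.1 :=
      hkl.antitone hs (show (0 : ℝ) < 2 * p.2.1 by linarith) (by linarith)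
    exact mul_nonneg (mul_nonneg (by positivity) (sub_nonneg.2 h2)) (sq_nonneg _)
  have f2 := (le_self_add.trans hle).trans_lt ENNReal.ofReal_lt_top
  have f3 := (le_add_self.trans hle).trans_lt ENNReal.ofReal_lt_top
  refine ⟨⟨m2, (hasFiniteIntegral_iff_ofReal n2).2 f2⟩,
    ⟨m3, (hasFiniteIntegral_iff_ofReal n3).2 f3⟩, ?_⟩
  rw [← hJtot, integral_eq_lintegral_of_nonneg_ae n2 m2, integral_eq_lintegral_of_nonneg_ae n3 m3,
    ← mul_add, ← ENNReal.toReal_add f2.ne f3.ne]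
  have := ENNReal.toReal_mono ENNReal.ofReal_ne_top hle
  rw [ENNReal.toReal_ofReal (by positivity)] at this
  linarith

theorem restrict_tripleDomain {N : ℕ} (T : ℝ) (Ω : Set (EuclideanSpace ℝ (Fin N))) :
    (volume : Measure (ℝ × ℝ × EuclideanSpace ℝ (Fin N))).restrict (tripleDomain T Ω) =
      ((volume.restrict (Ioo 0 T)).prod ((volume.restrict (Ioo 0 T)).prod
        (volume.restrict Ω))).restrict {p | p.2.1 < p.1} := by
  have hset : MeasurableSet {p : ℝ × ℝ × EuclideanSpace ℝ (Fin N) | p.2.1 < p.1} :=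
    measurableSet_lt (measurable_fst.comp measurable_snd) measurable_fst
  rw [Measure.prod_restrict, Measure.prod_restrict, Measure.restrict_restrict hset,
    Measure.volume_eq_prod, Measure.volume_eq_prod]
  congr 1
  ext p
  simp only [tripleDomain, mem_ofPred_eq, mem_inter_iff, mem_prod, mem_Ioo]
  constructor
  · rintro ⟨h1, h2, h3, h4, h5⟩
    exact ⟨h4, ⟨h1, h2⟩, ⟨h3, h4.trans h2⟩, h5⟩
  · rintro ⟨h4, ⟨h1, h2⟩, ⟨h3, -⟩, h5⟩
    exact ⟨h1, h2, h3, h4, h5⟩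

end

end Subdiffusion

theorem mainTheorem5 {N : ℕ} (T : ℝ) (hT : 0 < T)
    (Ω : Set (EuclideanSpace ℝ (Fin N)))
    (hΩ_open : IsOpen Ω) (hΩ_conn : IsConnected Ω) (hΩ_bdd : Bornology.IsBounded Ω)
    (k l : ℝ → ℝ) (hkl : Subdiffusion.IsPCPair k l)
    (hk : Subdiffusion.CompletelyMonotone k)
    (u₀ : EuclideanSpace ℝ (Fin N) → ℝ)
    (f u w : ℝ → EuclideanSpace ℝ (Fin N) → ℝ)
    (Dw : ℝ → EuclideanSpace ℝ (Fin N) → EuclideanSpace ℝ (Fin N))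
    (hu₀ : MemLp u₀ 2 (volume.restrict Ω))
    (hf : MemLp (fun p : ℝ × EuclideanSpace ℝ (Fin N) => f p.1 p.2) 2
      (volume.restrict (Subdiffusion.cylinder T Ω)))
    (hu : MemLp (fun p : ℝ × EuclideanSpace ℝ (Fin N) => u p.1 p.2) 2
      (volume.restrict (Subdiffusion.cylinder T Ω)))
    (hku : Subdiffusion.ConvContinuousVanishing T Ω k u)
    (hw : ∀ᵐ p ∂(volume.restrict (Subdiffusion.cylinder T Ω)), 0 ≤ w p.1 p.2)
    (hDN :
      (Subdiffusion.MemL2H1 T Ω (Subdiffusion.MemH10 Ω) w Dw ∧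
        Subdiffusion.WeakInequality T Ω (Subdiffusion.MemH10 Ω) k l u₀ f u Dw) ∨
      (Subdiffusion.MemL2H1 T Ω (Subdiffusion.MemH1 Ω) w Dw ∧
        Subdiffusion.WeakInequality T Ω (Subdiffusion.MemH1 Ω) k l u₀ f u Dw)) :
    IntegrableOn (fun p : ℝ × EuclideanSpace ℝ (Fin N) => w p.1 p.2 * u p.1 p.2)
      (Subdiffusion.cylinder T Ω) ∧
    IntegrableOn (fun p : ℝ × EuclideanSpace ℝ (Fin N) =>
        (k (T - p.1) + k p.1) *
          ‖Subdiffusion.dualConv T l (fun τ => Dw τ p.2) p.1‖ ^ 2)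
      (Subdiffusion.cylinder T Ω) ∧
    IntegrableOn (fun p : ℝ × ℝ × EuclideanSpace ℝ (Fin N) =>
        1 / p.2.1 * (k p.2.1 - k (2 * p.2.1)) *
          ‖Subdiffusion.dualConv T l (fun τ => Dw τ p.2.2) p.1 -
            Subdiffusion.dualConv T l (fun τ => Dw τ p.2.2) (p.1 - p.2.1)‖ ^ 2)
      (Subdiffusion.tripleDomain T Ω) ∧
    IntegrableOn (fun p : ℝ × EuclideanSpace ℝ (Fin N) =>
        (u₀ p.2 + Subdiffusion.conv l (fun τ => f τ p.2) p.1) * w p.1 p.2)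
      (Subdiffusion.cylinder T Ω) ∧
    (∫ t in (0 : ℝ)..T, ∫ x in Ω, w t x * u t x) +
      1 / 2 * (∫ t in (0 : ℝ)..T, ∫ x in Ω,
        (k (T - t) + k t) * ‖Subdiffusion.dualConv T l (fun τ => Dw τ x) t‖ ^ 2) +
      1 / 2 * (∫ t in (0 : ℝ)..T, ∫ s in (0 : ℝ)..t, ∫ x in Ω,
        1 / s * (k s - k (2 * s)) *
          ‖Subdiffusion.dualConv T l (fun τ => Dw τ x) t -
            Subdiffusion.dualConv T l (fun τ => Dw τ x) (t - s)‖ ^ 2) ≤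
    ∫ t in (0 : ℝ)..T, ∫ x in Ω,
      (u₀ x + Subdiffusion.conv l (fun τ => f τ x) t) * w t x := by
  -- The two cases differ only in the space of test functions, of which only `X ⊆ H^1_2(Ω)` matters.
  have main : ∀ X : (EuclideanSpace ℝ (Fin N) → ℝ) →
      (EuclideanSpace ℝ (Fin N) → EuclideanSpace ℝ (Fin N)) → Prop,
      (∀ ψ Dψ, X ψ Dψ → Subdiffusion.MemH1 Ω ψ Dψ) →
      Subdiffusion.MemL2H1 T Ω X w Dw → Subdiffusion.WeakInequality T Ω X k l u₀ f u Dw → _ :=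
    fun X hX h1 h2 => And.intro h1.memLp_grad
      (h2.integral_le (fun ψ Dψ h => ⟨(hX ψ Dψ h).memLp, (hX ψ Dψ h).memLp_grad⟩)
        hkl hk hu₀ hf hu hw h1)
  obtain ⟨hDw, i1, i4, hle⟩ := hDN.elim (fun h => main _ (fun _ _ h => h.memH1) h.1 h.2)
    (fun h => main _ (fun _ _ h => h) h.1 h.2)
  rw [Subdiffusion.restrict_cylinder] at hDw
  obtain ⟨i2, i3, he⟩ := Subdiffusion.integral_energy_dualConv_le hkl hk hDw
  have iter : ∀ F : ℝ × EuclideanSpace ℝ (Fin N) → ℝ,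
      IntegrableOn F (Subdiffusion.cylinder T Ω) →
      ∫ p in Subdiffusion.cylinder T Ω, F p = ∫ t in (0 : ℝ)..T, ∫ x in Ω, F (t, x) := by
    intro F hF
    rw [IntegrableOn, Subdiffusion.restrict_cylinder] at hF
    rw [Subdiffusion.restrict_cylinder, integral_prod _ hF,
      intervalIntegral.integral_of_le hT.le, integral_Ioc_eq_integral_Ioo]
  rw [← Subdiffusion.restrict_cylinder] at i2
  have i3' := i3
  rw [IntegrableOn, ← Subdiffusion.restrict_tripleDomain] at i3'
  refine ⟨i1, i2, i3', i4, ?_⟩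
  have h1 := iter _ i1
  have h2 := iter _ i2
  have h3 := Subdiffusion.intervalIntegral_intervalIntegral_eq hT.le i3
  have h4 := iter _ i4
  simp only at h1 h2 h3 h4
  rw [← h1, ← h2, h3, ← h4]
  simp only [Subdiffusion.restrict_cylinder] at hle ⊢
  linarith
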